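/- Notation and hypotheses. Let $0<H_1\le H_2<\infty$, $H_1,H_2\neq 1$, $H_1H_2<H_1+H_2$, $c>0$, $\gamma_0:=H_1/H_2$. Let $X=\{X(t,s)\}_{(t,s)\in\mathbb Z^2}$ be a stationary zero-mean real Gaussian random field with spectral density on $[-\pi,\pi]^2$ $$f(x,y)=\frac{g(x,y)}{(|x|^2+c|y|^{2H_2/H_1})^{H_1/2}},\qquad \operatorname{Cov}(X(t,s),X(t',s'))=\int_{[-\pi,\pi]^2}e^{i((t-t')x+(s-s')y)}f(x,y)\,dx\,dy,$$ where $g$ is bounded, and continuous at the origin with $g(0,0)=1$. For $\gamma>0$ put $S_{n\gamma}(x,y)=\sum_{1\le t\le nx,\,1\le s\le n^\gamma y}X(t,s)$. Let $W$ and $W_1$ be standard complex-valued Gaussian noises on $\mathbb R^2$ and on $\mathbb R$ (such noises exist): $\overline{W(A)}=W(-A)$, $\mathrm E\,W(A)=0$, $\mathrm E\,W(A)\overline{W(B)}=\operatorname{Leb}(A\cap B)$, with real and imaginary parts jointly Gaussian, and similarly for $W_1$. Let $h(u,v)=(|u|^2+c|v|^{2H_2/H_1})^{-H_1/2}$, $k_x(u)=\frac{1-e^{iux}}{iu}$,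 and let $B$ be the beta function, $\rho_1^2=B(\frac12,\frac{H_1-1}2)$ (if $H_1>1$), $\rho_2^2=\frac{H_1}{H_2}B\big(\frac{H_1}{2H_2},\frac{H_1H_2-H_1}{2H_2}\big)$ (if $H_2>1$). For $x,y\ge 0$ define $$V_{\gamma_0}(x,y)=\int_{\mathbb R^2}k_x(u)k_y(v)\sqrt{h(u,v)}\,W(du,dv),$$ $$V_+(x,y)=\begin{cases}\int_{\mathbb R^2}k_x(u)k_y(v)|u|^{-H_1/2}W(du,dv),&H_1<1,\\ x\,\rho_1c^{(1-H_1)/4}\int_{\mathbb R}k_y(v)|v|^{-(H_1H_2-H_2)/(2H_1)}W_1(dv),&H_1>1,\end{cases}$$ $$V_-(x,y)=\begin{cases}c^{-H_1/4}\int_{\mathbb R^2}k_x(u)k_y(v)|v|^{-H_2/2}W(du,dv),&H_2<1,\\ y\,\rho_2c^{-H_1/(4H_2)}\int_{\mathbb R}k_x(u)|u|^{-(H_1H_2-H_1)/(2H_2)}W_1(du),&H_2>1.\end{cases}$$ For $\gamma>\gamma_0$ let $V_\gamma=V_+$ and let $H(\gamma)=\frac{1+\gamma+H_1}2$ if $H_1<1$,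 $H(\gamma)=\frac{\gamma H_1+\gamma H_1H_2-\gamma H_2+2H_1}{2H_1}$ if $H_1>1$. For $0<\gamma<\gamma_0$ let $V_\gamma=V_-$ and let $H(\gamma)=\frac{1+\gamma+\gamma H_2}2$ if $H_2<1$, $H(\gamma)=\frac{H_2+H_1H_2-H_1+2\gamma H_2}{2H_2}$ if $H_2>1$. Let $H(\gamma_0)=\frac{H_1+H_2+H_1H_2}{2H_2}$. Definitions. A scaling limit of $X$ at $\gamma$ is a random field $V$, not a.s. zero at every $(x,y)$ with $x,y>0$, such that for some $A_n\to\infty$ the finite-dimensional distributions of $A_n^{-1}S_{n\gamma}(x,y)$, $x,y>0$, converge to those of $V$. $X$ exhibits scaling transition at $\gamma_0>0$ if it has a scaling limit $V_\gamma$ at each $\gamma>0$, all $V_\gamma$ with $\gamma>\gamma_0$ have the finite-dimensional distributions of one field $V_+$, all those with $\gamma<\gamma_0$ have the finite-dimensional distributions of one field $V_-$, and for no $a>0$ do $V_+$ and $aV_-$ have the same finite-dimensional distributions. Let $V$ be a random field on $x,y\ge 0$ that vanishes a.s. on the axes and has stationary rectangular increments $V(K)=V(x,y)-V(u,y)-V(x,v)+V(u,v)$,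 $K=(u,x]\times(v,y]$. It has independent rectangular increments in the direction of a line $\ell\ni 0$ if $V(K),V(K')$ are independent whenever the rectangles $K,K'$ in the open quadrant lie on different sides of a line orthogonal to $\ell$; it has invariant rectangular increments in the direction $\ell$ if $V(K)=V(K+z)$ a.s. for all $z\in\ell$ and all rectangles $K,K+z$ in the open quadrant; and it has dependent rectangular increments if neither holds for any $\ell$. $X$ has Type I distributional LRD, with exceptional value $\gamma_0$, if it has scaling limits $V_\gamma$, $\gamma>0$, of this kind, and $\gamma_0>0$ is the unique value such that $V_{\gamma_0}$ has dependent rectangular increments while no $V_\gamma$ with $\gamma\ne\gamma_0$ has; it is isotropic if $\gamma_0=1$ and anisotropic if $\gamma_0\neq1$. Theorem. For every $\gamma>0$, as $n\to\infty$, the finite-dimensional distributions of $n^{-H(\gamma)}S_{n\gamma}(x,y)$, $x,y>0$, converge to those of $V_\gamma(x,y)$. Consequently $X$ exhibits scaling transition at $\gamma_0=H_1/H_2$. Moreover $X$ has Type I distributional LRD with exceptional value $\gamma_0=H_1/H_2$; it is isotropic if $H_1=H_2$ and anisotropic if $H_1\ne H_2$. -/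

import Mathlib

open MeasureTheory ProbabilityTheory Filter
open scoped ENNReal Topology

noncomputable section

namespace RandomField

/-! ### Complex Gaussian noise and the stochastic integral -/

section Noise

variable {E Ω : Type*} [MeasureSpace E] [MeasurableSpace Ω]

/-- Measurable sets of finite volume. -/
abbrev FinSet (E : Type*) [MeasureSpace E] : Type _ :=
  {A : Set E // MeasurableSet A ∧ (volume : Measure E) A < ∞}

/-- `W` is a standard complex-valued Gaussian noise on `E` with `conj (W(dx)) = W(-dx)`, zero mean
and `E |W(dx)|² = dx`: a jointly Gaussian (over `ℝ`, i.e. real and imaginary parts together) family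
`W(A)` indexed by the measurable sets of finite volume, orthogonally scattered with respect to the
volume. Finite and countable additivity follow from `covariance_eq`. -/
structure IsComplexGaussianNoise [Neg E] (W : Set E → Ω → ℂ) (P : Measure Ω) : Prop where
  gaussian : IsGaussianProcess (fun (A : FinSet E) ω => W A.1 ω) P
  mean_zero : ∀ A : FinSet E, ∫ ω, W A.1 ω ∂P = 0
  covariance_eq : ∀ A B : FinSet E,
    ∫ ω, W A.1 ω * (starRingEnd ℂ) (W B.1 ω) ∂P = ((volume.real (A.1 ∩ B.1) : ℝ) : ℂ)
  hermitian : ∀ A : FinSet E,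
    (fun ω => W (Neg.neg ⁻¹' A.1) ω) =ᵐ[P] fun ω => (starRingEnd ℂ) (W A.1 ω)

/-- `W(A)` as an element of `L²(Ω)`. -/
def noiseLp (W : Set E → Ω → ℂ) (P : Measure Ω) (A : FinSet E) : Lp ℂ 2 P :=
  open Classical in if h : MemLp (W A.1) 2 P then h.toLp (W A.1) else 0

/-- The simple function `∑ aⱼ 1_{Aⱼ}` in `L²(E)`. -/
def simpleLp (E : Type*) [MeasureSpace E] : (FinSet E →₀ ℂ) →ₗ[ℂ] Lp ℂ 2 (volume : Measure E) :=
  Finsupp.linearCombination ℂ fun A => indicatorConstLp 2 A.2.1 A.2.2.ne 1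

/-- The integral `∑ aⱼ W(Aⱼ)` of the simple function `∑ aⱼ 1_{Aⱼ}`. -/
def simpleIntegral (W : Set E → Ω → ℂ) (P : Measure Ω) : (FinSet E →₀ ℂ) →ₗ[ℂ] Lp ℂ 2 P :=
  Finsupp.linearCombination ℂ (noiseLp W P)

/-- The stochastic integral as an operator `L²(E) → L²(Ω)`: the continuous linear extension of
`∑ aⱼ 1_{Aⱼ} ↦ ∑ aⱼ W(Aⱼ)`. -/
def stochasticIntegralLp (W : Set E → Ω → ℂ) (P : Measure Ω) :
    Lp ℂ 2 (volume : Measure E) →L[ℂ] Lp ℂ 2 P :=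
  (simpleIntegral W P).extendOfNorm (simpleLp E)

/-- The stochastic integral `∫ f(x) W(dx)` of a square integrable function `f`. -/
def stochasticIntegral (W : Set E → Ω → ℂ) (P : Measure Ω) (f : E → ℂ) : Ω → ℂ :=
  open Classical in
    if hf : MemLp f 2 (volume : Measure E) then ⇑(stochasticIntegralLp W P (hf.toLp f)) else 0

end Noise

/-! ### Random fields -/

section Fields

variable {Ω Ω' : Type*} [MeasurableSpace Ω] [MeasurableSpace Ω']

/-- Strict stationarity of a random field on `ℤ²`. -/
def IsStationary (X : ℤ → ℤ → Ω → ℝ) (P : Measure Ω) : Prop :=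
  ∀ (a b : ℤ) (k : ℕ) (p : Fin k → ℤ × ℤ),
    IdentDistrib (fun ω i => X ((p i).1 + a) ((p i).2 + b) ω) (fun ω i => X (p i).1 (p i).2 ω) P P

/-- The square `[-π, π]²`. -/
def freqSquare : Set (ℝ × ℝ) :=
  Set.Icc (-Real.pi) Real.pi ×ˢ Set.Icc (-Real.pi) Real.pi

/-- The random field `X` on `ℤ²` has spectral density `f` on `[-π, π]²`. -/
structure HasSpectralDensity (X : ℤ → ℤ → Ω → ℝ) (P : Measure Ω) (f : ℝ → ℝ → ℝ) : Prop where
  nonneg : ∀ᵐ p ∂((volume : Measure (ℝ × ℝ)).restrict freqSquare), 0 ≤ f p.1 p.2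
  integrable : IntegrableOn (fun p : ℝ × ℝ => f p.1 p.2) freqSquare
  covariance_eq : ∀ t s t' s' : ℤ, ((cov[X t s, X t' s'; P] : ℝ) : ℂ) =
    ∫ p in freqSquare,
      Complex.exp (Complex.I * (((t - t' : ℤ) : ℂ) * (p.1 : ℂ) + ((s - s' : ℤ) : ℂ) * (p.2 : ℂ))) *
        (f p.1 p.2 : ℂ)

/-- `S_{nγ}(x,y) = ∑ X(t,s)` over integers `1 ≤ t ≤ n x`, `1 ≤ s ≤ n^γ y`. -/
def partialSum (X : ℤ → ℤ → Ω → ℝ) (γ : ℝ) (n : ℕ) (x y : ℝ) (ω : Ω) : ℝ :=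
  ∑ t ∈ Finset.Icc (1 : ℤ) ⌊(n : ℝ) * x⌋, ∑ s ∈ Finset.Icc (1 : ℤ) ⌊(n : ℝ) ^ γ * y⌋, X t s ω

/-- Convergence of finite-dimensional distributions over the open quadrant `x, y > 0`. -/
def FddTendsto (S : ℕ → ℝ → ℝ → Ω → ℝ) (P : Measure Ω) [IsProbabilityMeasure P]
    (V : ℝ → ℝ → Ω' → ℝ) (P' : Measure Ω') [IsProbabilityMeasure P'] : Prop :=
  ∀ (k : ℕ) (p : Fin k → ℝ × ℝ), (∀ i, 0 < (p i).1 ∧ 0 < (p i).2) →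
    TendstoInDistribution (fun n ω i => S n (p i).1 (p i).2 ω) atTop
      (fun ω i => V (p i).1 (p i).2 ω) (fun _ => P) P'

/-- Equality of finite-dimensional distributions over the open quadrant `x, y > 0`. -/
def FddEq (V V' : ℝ → ℝ → Ω' → ℝ) (P' : Measure Ω') : Prop :=
  ∀ (k : ℕ) (p : Fin k → ℝ × ℝ), (∀ i, 0 < (p i).1 ∧ 0 < (p i).2) →
    IdentDistrib (fun ω i => V (p i).1 (p i).2 ω) (fun ω i => V' (p i).1 (p i).2 ω) P' P'

/-- `V` is a nontrivial limit of the partial sums over `[1, n x] × [1, n^γ y]`, for some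
normalization `A n → ∞`. -/
def IsScalingLimit (X : ℤ → ℤ → Ω → ℝ) (P : Measure Ω) [IsProbabilityMeasure P] (γ : ℝ)
    (V : ℝ → ℝ → Ω' → ℝ) (P' : Measure Ω') [IsProbabilityMeasure P'] : Prop :=
  (∃ A : ℕ → ℝ, Tendsto A atTop atTop ∧
    FddTendsto (fun n x y ω => (A n)⁻¹ * partialSum X γ n x y ω) P V P') ∧
  ∃ x y : ℝ, 0 < x ∧ 0 < y ∧ ¬ (V x y =ᵐ[P'] 0)

/-- `X` exhibits scaling transition at `γ₀`: scaling limits `V γ` exist for all `γ > 0`, they do not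
depend on `γ` (in law) on either side of `γ₀`, and the limits `Vp`, `Vm` on the two sides differ in
law, even up to a positive constant. -/
def ExhibitsScalingTransitionAt (X : ℤ → ℤ → Ω → ℝ) (P : Measure Ω) [IsProbabilityMeasure P]
    (γ₀ : ℝ) : Prop :=
  0 < γ₀ ∧
  ∃ (Ω' : Type) (_ : MeasurableSpace Ω') (P' : Measure Ω') (_ : IsProbabilityMeasure P')
    (V : ℝ → ℝ → ℝ → Ω' → ℝ) (Vp Vm : ℝ → ℝ → Ω' → ℝ),
    (∀ γ, 0 < γ → IsScalingLimit X P γ (V γ) P') ∧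
    (∀ γ, γ₀ < γ → FddEq (V γ) Vp P') ∧
    (∀ γ, 0 < γ → γ < γ₀ → FddEq (V γ) Vm P') ∧
    ∀ a : ℝ, 0 < a → ¬ FddEq Vp (fun x y ω => a * Vm x y ω) P'

/-! ### Dependence of rectangular increments -/

/-- The nonempty rectangles `(u, x] × (v, y]` contained in the open quadrant. -/
structure Rect where
  u : ℝ
  v : ℝ
  x : ℝ
  y : ℝ
  u_nonneg : 0 ≤ u
  v_nonneg : 0 ≤ v
  u_lt_x : u < x
  v_lt_y : v < y

/-- The rectangle as a set of points. -/
def Rect.toSet (K : Rect) : Set (ℝ × ℝ) := Set.Ioc K.u K.x ×ˢ Set.Ioc K.v K.y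

/-- `V(x,y) - V(u,y) - V(x,v) + V(u,v)`. -/
def increment (V : ℝ → ℝ → Ω' → ℝ) (u v x y : ℝ) (ω : Ω') : ℝ :=
  V x y ω - V u y ω - V x v ω + V u v ω

/-- The increment of `V` on the rectangle `K`. -/
def Rect.incr (K : Rect) (V : ℝ → ℝ → Ω' → ℝ) : Ω' → ℝ := increment V K.u K.v K.x K.y

/-- The rectangles lie on different sides of the line `a x + b y = c`. -/
def Rect.SeparatedBy (K K' : Rect) (a b c : ℝ) : Prop :=
  ((∀ p ∈ K.toSet, a * p.1 + b * p.2 ≤ c) ∧ (∀ p ∈ K'.toSet, c ≤ a * p.1 + b * p.2)) ∨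
  ((∀ p ∈ K'.toSet, a * p.1 + b * p.2 ≤ c) ∧ (∀ p ∈ K.toSet, c ≤ a * p.1 + b * p.2))

/-- Stationary rectangular increments. -/
def HasStationaryIncrements (V : ℝ → ℝ → Ω' → ℝ) (P' : Measure Ω') : Prop :=
  ∀ u v : ℝ, 0 < u → 0 < v → ∀ (k : ℕ) (p : Fin k → ℝ × ℝ), (∀ i, u ≤ (p i).1 ∧ v ≤ (p i).2) →
    IdentDistrib (fun ω i => increment V u v (p i).1 (p i).2 ω)
      (fun ω i => increment V 0 0 ((p i).1 - u) ((p i).2 - v) ω) P' P'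

/-- `V(x,0) = V(0,y) = 0` for `x, y ≥ 0`. -/
def VanishesOnAxes (V : ℝ → ℝ → Ω' → ℝ) (P' : Measure Ω') : Prop :=
  (∀ x, 0 ≤ x → V x 0 =ᵐ[P'] 0) ∧ (∀ y, 0 ≤ y → V 0 y =ᵐ[P'] 0)

/-- Independent rectangular increments in the direction of the line `a x + b y = 0`. -/
def IndependentIncrementsAlong (V : ℝ → ℝ → Ω' → ℝ) (P' : Measure Ω') (a b : ℝ) : Prop :=
  ∀ a' b' c' : ℝ, (a', b') ≠ (0, 0) → a * a' + b * b' = 0 →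
    ∀ K K' : Rect, K.SeparatedBy K' a' b' c' → IndepFun (K.incr V) (K'.incr V) P'

/-- Invariant rectangular increments in the direction of the line `a x + b y = 0`. -/
def InvariantIncrementsAlong (V : ℝ → ℝ → Ω' → ℝ) (P' : Measure Ω') (a b : ℝ) : Prop :=
  ∀ z w : ℝ, a * z + b * w = 0 → ∀ K K' : Rect,
    K'.u = K.u + z → K'.x = K.x + z → K'.v = K.v + w → K'.y = K.y + w →
      K.incr V =ᵐ[P'] K'.incr V

/-- Dependent rectangular increments: in every direction, the rectangular increments are neither
independent nor invariant. -/
def HasDependentIncrements (V : ℝ → ℝ → Ω' → ℝ) (P' : Measure Ω') : Prop :=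
  ∀ a b : ℝ, (a, b) ≠ (0, 0) →
    ¬ IndependentIncrementsAlong V P' a b ∧ ¬ InvariantIncrementsAlong V P' a b

/-- Among the fields `V γ`, `γ > 0`, the one with `γ = γ₀ > 0` has dependent rectangular increments
and no other one has. -/
def IsDependencePoint (V : ℝ → ℝ → ℝ → Ω' → ℝ) (P' : Measure Ω') (γ₀ : ℝ) : Prop :=
  0 < γ₀ ∧ HasDependentIncrements (V γ₀) P' ∧
    ∀ γ, 0 < γ → γ ≠ γ₀ → ¬ HasDependentIncrements (V γ) P'

/-- Type I distributional long-range dependence, with `γ₀` as the unique exceptional value. -/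
def HasTypeILRDAt (X : ℤ → ℤ → Ω → ℝ) (P : Measure Ω) [IsProbabilityMeasure P] (γ₀ : ℝ) : Prop :=
  ∃ (Ω' : Type) (_ : MeasurableSpace Ω') (P' : Measure Ω') (_ : IsProbabilityMeasure P')
    (V : ℝ → ℝ → ℝ → Ω' → ℝ),
    (∀ γ, 0 < γ → IsScalingLimit X P γ (V γ) P' ∧
      VanishesOnAxes (V γ) P' ∧ HasStationaryIncrements (V γ) P') ∧
    IsDependencePoint V P' γ₀ ∧ ∀ γ, IsDependencePoint V P' γ → γ = γ₀

/-- Type I isotropic distributional long-range dependence. -/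
def HasTypeIIsotropicLRD (X : ℤ → ℤ → Ω → ℝ) (P : Measure Ω) [IsProbabilityMeasure P] : Prop :=
  HasTypeILRDAt X P 1

/-- Type I anisotropic distributional long-range dependence. -/
def HasTypeIAnisotropicLRD (X : ℤ → ℤ → Ω → ℝ) (P : Measure Ω) [IsProbabilityMeasure P] : Prop :=
  ∃ γ₀ : ℝ, γ₀ ≠ 1 ∧ HasTypeILRDAt X P γ₀

end Fields

/-! ### The limit fields -/

section Limits

/-- `h(u,v) = (|u|² + c |v|^{2 H₂/H₁})^{-H₁/2}`. -/
def hDensity (H₁ H₂ c u v : ℝ) : ℝ :=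
  1 / (|u| ^ 2 + c * |v| ^ (2 * H₂ / H₁)) ^ (H₁ / 2)

/-- `(1 - e^{i u x}) / (i u)`. -/
def incKernel (x u : ℝ) : ℂ :=
  (1 - Complex.exp (Complex.I * (u : ℂ) * (x : ℂ))) / (Complex.I * (u : ℂ))

/-- `ρ₁² = B(1/2, (H₁ - 1)/2)`. -/
def rho₁ (H₁ : ℝ) : ℝ := √(beta (1 / 2) ((H₁ - 1) / 2))

/-- `ρ₂² = (H₁/H₂) B(H₁/(2 H₂), (H₁ H₂ - H₁)/(2 H₂))`. -/
def rho₂ (H₁ H₂ : ℝ) : ℝ :=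
  √(H₁ / H₂ * beta (H₁ / (2 * H₂)) ((H₁ * H₂ - H₁) / (2 * H₂)))

variable {Ω : Type*} [MeasurableSpace Ω]

/- All integrands `φ` below satisfy `φ(-x) = conj φ(x)`, so that the stochastic integrals are real;
`Complex.re` only changes their type. -/

/-- The well-balanced limit. -/
def VBalanced (W : Set (ℝ × ℝ) → Ω → ℂ) (P : Measure Ω) (H₁ H₂ c x y : ℝ) (ω : Ω) : ℝ :=
  (stochasticIntegral W P (fun p : ℝ × ℝ => incKernel x p.1 * incKernel y p.2 *
    ((√(hDensity H₁ H₂ c p.1 p.2) : ℝ) : ℂ)) ω).re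

/-- The unbalanced limit `V₊`, for `H₁ < 1` and for `H₁ > 1`. -/
def VPlus (W : Set (ℝ × ℝ) → Ω → ℂ) (W₁ : Set ℝ → Ω → ℂ) (P : Measure Ω)
    (H₁ H₂ c x y : ℝ) (ω : Ω) : ℝ :=
  if H₁ < 1 then
    (stochasticIntegral W P (fun p : ℝ × ℝ => incKernel x p.1 * incKernel y p.2 *
      ((|p.1| ^ (-H₁ / 2) : ℝ) : ℂ)) ω).re
  else
    x * rho₁ H₁ * c ^ ((1 - H₁) / 4) *
      (stochasticIntegral W₁ P (fun v : ℝ => incKernel y v *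
        ((|v| ^ (-(H₁ * H₂ - H₂) / (2 * H₁)) : ℝ) : ℂ)) ω).re

/-- The unbalanced limit `V₋`, for `H₂ < 1` and for `H₂ > 1`. -/
def VMinus (W : Set (ℝ × ℝ) → Ω → ℂ) (W₁ : Set ℝ → Ω → ℂ) (P : Measure Ω)
    (H₁ H₂ c x y : ℝ) (ω : Ω) : ℝ :=
  if H₂ < 1 then
    c ^ (-H₁ / 4) *
      (stochasticIntegral W P (fun p : ℝ × ℝ => incKernel x p.1 * incKernel y p.2 *
        ((|p.2| ^ (-H₂ / 2) : ℝ) : ℂ)) ω).re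
  else
    y * rho₂ H₁ H₂ * c ^ (-H₁ / (4 * H₂)) *
      (stochasticIntegral W₁ P (fun u : ℝ => incKernel x u *
        ((|u| ^ (-(H₁ * H₂ - H₁) / (2 * H₂)) : ℝ) : ℂ)) ω).re

/-- The limit field `V_γ`: it is `V₊` for `γ > H₁/H₂`, `V₋` for `γ < H₁/H₂`, and the well-balanced
one for `γ = H₁/H₂`. -/
def VLimit (W : Set (ℝ × ℝ) → Ω → ℂ) (W₁ : Set ℝ → Ω → ℂ) (P : Measure Ω)
    (H₁ H₂ c γ : ℝ) : ℝ → ℝ → Ω → ℝ :=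
  if H₁ / H₂ < γ then VPlus W W₁ P H₁ H₂ c
  else if γ < H₁ / H₂ then VMinus W W₁ P H₁ H₂ c
  else VBalanced W P H₁ H₂ c

/-- The exponent `H₊(γ)`. -/
def expPlus (H₁ H₂ γ : ℝ) : ℝ :=
  if H₁ < 1 then (1 + γ + H₁) / 2
  else (γ * H₁ + γ * H₁ * H₂ - γ * H₂ + 2 * H₁) / (2 * H₁)

/-- The exponent `H₋(γ)`. -/
def expMinus (H₁ H₂ γ : ℝ) : ℝ :=
  if H₂ < 1 then (1 + γ + γ * H₂) / 2
  else (H₂ + H₁ * H₂ - H₁ + 2 * γ * H₂) / (2 * H₂)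

/-- The normalizing exponent `H(γ)`. -/
def expLimit (H₁ H₂ γ : ℝ) : ℝ :=
  if H₁ / H₂ < γ then expPlus H₁ H₂ γ
  else if γ < H₁ / H₂ then expMinus H₁ H₂ γ
  else (H₁ + H₂ + H₁ * H₂) / (2 * H₂)

end Limits

end RandomField

end

open RandomField

open RandomField

namespace RandomField

/-! ### Centered Gaussian vectors: laws, convergence and L² limits through covariances -/

section Gaussian

variable {Ω Ω' : Type*} [MeasurableSpace Ω] [MeasurableSpace Ω']

/-! All fields involved are centered Gaussian, so convergence and every structural claim reduce to
covariances. On the limit side the stochastic integral is an L² isometry; Hermitian symmetry of the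
integrand makes it real, with covariance the real part of ∫ φ_s conj φ_t
(`IsComplexGaussianNoise.gaussianField`). On the discrete side the covariance of two sums over
rectangles is an integral of products of Dirichlet sums against the spectral density
(`cov_partialSum`).

Now rescale the frequencies to u/n^α, v/n^β. Three facts enter: h(u/t, v/t^γ₀) = t^H₁ h(u,v) with γ₀
= H₁/H₂; g tends to 1 at the origin; and a Dirichlet sum of length Nx, divided by N, tends to
-k_x(u) at frequency u/N but to the constant x at frequencies of smaller order. Dominated
convergence (`tendsto_spectral_integral`, `tendsto_cov_partialSum`) then gives the limit, and each
regime amounts to a choice of α, β. At γ = γ₀ the natural scales α = 1, β = γ preserve h. For γ > γ₀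
they turn h into h(u,0) = |u|^(-H₁), which is admissible if H₁ < 1. If H₁ > 1 this is not integrable
at 0: the mass sits at u of order n^(-γ/γ₀), below 1/n, where the sum over t contributes only the
constant xx', and integrating h over u leaves a beta constant times a power of |v|. The case γ < γ₀
exchanges the two coordinates. The condition H₁H₂ < H₁ + H₂ makes the remaining power integrable at
0.

The unbalanced limits have as covariance a product of two fractional Brownian covariances with
exponents (p,q) (`IsSheet`): (1+H₁, 1) or (2, q) with q > 1 for V₊, and (1, 1+H₂) or (p, 2) with p <
2 for V₋. The variance C x^p y^q determines (p,q), so V₊ and aV₋ differ in law. An exponent 1 gives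
independent increments along that axis, an exponent 2 invariant ones.

The balanced limit has neither property in any direction. A shift multiplies the spectral integrand
of the covariance by cosines, and h > 0, so increments are not invariant
(`IsSpectralField.not_invariant`). If they were independent in some direction, a rectangle cut into
a grid adapted to that direction would have only neighbouring cells correlated, so its variance
would be at most 9 times the sum of the cell variances; by scaling that sum is an integral against
h(mu, kv), which tends to 0 (`IsSpectralField.not_independent`). -/

/-- The characteristic function of a centered Gaussian vector in terms of its covariances. -/
lemma charFun_of_centered_gaussian {P : Measure Ω} {k : ℕ} {X : Fin k → Ω → ℝ}
    (hX : HasGaussianLaw (fun ω i => X i ω) P) (h0 : ∀ i, ∫ ω, X i ω ∂P = 0)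
    (t : EuclideanSpace ℝ (Fin k)) :
    charFun (P.map (fun ω => WithLp.toLp 2 (fun i => X i ω))) t =
      Complex.exp (-((∑ i, ∑ j, t i * (t j * cov[X i, X j; P]) : ℝ) : ℂ) / 2) := by
  have := hX.isProbabilityMeasure
  have hL : ∀ i, MemLp (X i) 2 P := fun i => (hX.eval i).memLp_two
  have hin : ∀ ω, inner ℝ t (WithLp.toLp 2 (fun i => X i ω)) = ∑ i, t i * X i ω := by
    intro ω
    simp [PiLp.inner_apply, mul_comm]
  rw [HasGaussianLaw.charFun_map_eq t (hX.toLp_pi 2)]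
  simp_rw [hin]
  have h1 : ∫ ω, ∑ i, t i * X i ω ∂P = 0 := by
    rw [integral_finsetSum]
    · simp [integral_const_mul, h0]
    · intro i _
      exact ((hL i).integrable (by norm_num)).const_mul _
  have h2 : Var[fun ω => ∑ i, t i * X i ω; P] = ∑ i, ∑ j, t i * (t j * cov[X i, X j; P]) := by
    rw [variance_fun_sum' (fun i _ => (hL i).const_mul (t i))]
    simp only [covariance_const_mul_left, covariance_const_mul_right]
    exact Finset.sum_congr rfl fun i _ => Finset.sum_congr rfl fun j _ => mul_left_comm _ _ _
  rw [h1, h2]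
  congr 1
  simp
  ring

/-- Two centered Gaussian vectors with the same covariances have the same law. -/
lemma identDistrib_of_centered_gaussian {P : Measure Ω} {P' : Measure Ω'} {k : ℕ}
    {X : Fin k → Ω → ℝ} {Y : Fin k → Ω' → ℝ}
    (hX : HasGaussianLaw (fun ω i => X i ω) P) (hX0 : ∀ i, ∫ ω, X i ω ∂P = 0)
    (hY : HasGaussianLaw (fun ω i => Y i ω) P') (hY0 : ∀ i, ∫ ω, Y i ω ∂P' = 0)
    (hcov : ∀ i j, cov[X i, X j; P] = cov[Y i, Y j; P']) :
    IdentDistrib (fun ω i => X i ω) (fun ω i => Y i ω) P P' := by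
  have := hX.isProbabilityMeasure
  have := hY.isProbabilityMeasure
  have hmX := (hX.toLp_pi 2).aemeasurable
  have hmY := (hY.toLp_pi 2).aemeasurable
  have key : IdentDistrib (fun ω => WithLp.toLp 2 (fun i => X i ω))
      (fun ω => WithLp.toLp 2 (fun i => Y i ω)) P P' := by
    refine ⟨hmX, hmY, ?_⟩
    have := Measure.isProbabilityMeasure_map hmX
    have := Measure.isProbabilityMeasure_map hmY
    apply Measure.ext_of_charFun
    ext t
    rw [charFun_of_centered_gaussian hX hX0, charFun_of_centered_gaussian hY hY0]
    simp_rw [hcov]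
  exact key.comp (u := fun x : EuclideanSpace ℝ (Fin k) => WithLp.ofLp x) (by fun_prop)

/-- Centered Gaussian vectors converge in law if their covariances converge. -/
lemma tendstoInDistribution_of_centered_gaussian {P : Measure Ω} {P' : Measure Ω'}
    [IsProbabilityMeasure P] [IsProbabilityMeasure P'] {k : ℕ}
    {X : ℕ → Fin k → Ω → ℝ} {Y : Fin k → Ω' → ℝ}
    (hX : ∀ n, HasGaussianLaw (fun ω i => X n i ω) P) (hX0 : ∀ n i, ∫ ω, X n i ω ∂P = 0)
    (hY : HasGaussianLaw (fun ω i => Y i ω) P') (hY0 : ∀ i, ∫ ω, Y i ω ∂P' = 0)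
    (hcov : ∀ i j, Tendsto (fun n => cov[X n i, X n j; P]) atTop (𝓝 cov[Y i, Y j; P'])) :
    TendstoInDistribution (fun n ω i => X n i ω) atTop (fun ω i => Y i ω) (fun _ => P) P' := by
  have hmX := fun n => ((hX n).toLp_pi 2).aemeasurable
  have hmY := (hY.toLp_pi 2).aemeasurable
  have key : TendstoInDistribution (fun n ω => WithLp.toLp 2 (fun i => X n i ω)) atTop
      (fun ω => WithLp.toLp 2 (fun i => Y i ω)) (fun _ => P) P' := by
    refine ⟨hmX, hmY, ?_⟩
    apply ProbabilityMeasure.tendsto_of_tendsto_charFun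
    intro t
    simp only [ProbabilityMeasure.coe_mk]
    rw [charFun_of_centered_gaussian hY hY0]
    simp_rw [fun n => charFun_of_centered_gaussian (hX n) (hX0 n) t]
    refine (Complex.continuous_exp.tendsto _).comp (Tendsto.div_const (Tendsto.neg ?_) _)
    refine (Complex.continuous_ofReal.tendsto _).comp ?_
    refine tendsto_finsetSum _ fun i _ => tendsto_finsetSum _ fun j _ => ?_
    exact ((hcov i j).const_mul _).const_mul _
  exact key.continuous_comp (g := fun x : EuclideanSpace ℝ (Fin k) => WithLp.ofLp x)
    (by fun_prop)

/-- The variance of a centered variable is its squared L² norm, so the characteristic function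
depends continuously on the point of L². This lets Gaussianity pass to L² limits. -/
lemma charFun_map_lp {P : Measure Ω} (Y : Lp ℝ 2 P) (hY : HasGaussianLaw Y P)
    (h0 : ∫ ω, Y ω ∂P = 0) (t : ℝ) :
    charFun (P.map Y) t = Complex.exp (-((t ^ 2 * ‖Y‖ ^ 2 : ℝ) : ℂ) / 2) := by
  have := hY.isProbabilityMeasure
  rw [hY.map_eq_gaussianReal, charFun_gaussianReal, h0]
  have hv : Var[Y; P] = ‖Y‖ ^ 2 := by
    rw [variance_of_integral_eq_zero (Lp.memLp Y).aemeasurable h0,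
      ← real_inner_self_eq_norm_sq, L2.inner_def]
    simp [sq]
  have : 0 ≤ ‖Y‖ ^ 2 := by positivity
  rw [hv]
  simp [Real.coe_toNNReal _ this]
  congr 1
  ring

/-- An `L²` limit of centered Gaussian random variables is Gaussian. -/
lemma hasGaussianLaw_of_tendsto_lp {P : Measure Ω} [IsProbabilityMeasure P] {Y : ℕ → Lp ℝ 2 P}
    {Z : Lp ℝ 2 P} (hY : ∀ n, HasGaussianLaw (Y n) P) (h0 : ∀ n, ∫ ω, Y n ω ∂P = 0)
    (h : Tendsto Y atTop (𝓝 Z)) : HasGaussianLaw Z P := by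
  have hm : ∀ n, AEMeasurable (Y n) P := fun n => (Lp.memLp _).aemeasurable
  have hZ : AEMeasurable Z P := (Lp.memLp _).aemeasurable
  have h1 := (tendstoInMeasure_of_tendsto_Lp h).tendstoInDistribution hm
  have h2 := ProbabilityMeasure.tendsto_iff_tendsto_charFun.1 h1.tendsto
  have h3 : P.map Z = gaussianReal 0 (‖Z‖₊ ^ 2) := by
    have := Measure.isProbabilityMeasure_map hZ
    apply Measure.ext_of_charFun
    ext t
    have ha := h2 t
    simp only [ProbabilityMeasure.coe_mk] at ha
    refine tendsto_nhds_unique ha ?_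
    simp_rw [fun n => charFun_map_lp (Y n) (hY n) (h0 n) t]
    rw [charFun_gaussianReal]
    have : Tendsto (fun n => Complex.exp (-((t ^ 2 * ‖Y n‖ ^ 2 : ℝ) : ℂ) / 2)) atTop
        (𝓝 (Complex.exp (-((t ^ 2 * ‖Z‖ ^ 2 : ℝ) : ℂ) / 2))) := by
      refine (Complex.continuous_exp.tendsto _).comp (Tendsto.div_const (Tendsto.neg ?_) _)
      refine (Complex.continuous_ofReal.tendsto _).comp ?_
      exact (h.norm.pow 2).const_mul _
    convert this using 3
    simp
    ring
  exact ⟨by rw [h3]; infer_instance⟩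

/-- A linear map into `L²` with Gaussian values is a Gaussian process. -/
lemma isGaussianProcess_of_linear {P : Measure Ω} [IsProbabilityMeasure P] {F : Type*}
    [AddCommGroup F] [Module ℝ F] (Φ : F →ₗ[ℝ] Lp ℝ 2 P)
    (h : ∀ f, HasGaussianLaw (Φ f) P) : IsGaussianProcess (fun f ω => Φ f ω) P where
  hasGaussianLaw I := by
    have hm : AEMeasurable (fun ω => I.restrict (fun f => Φ f ω)) P :=
      aemeasurable_pi_iff.2 fun f => (Lp.memLp (Φ f)).aemeasurable
    classical
    -- A linear functional of finitely many values of Φ is again a value of Φ, hence Gaussian.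
    refine ⟨isGaussian_of_isGaussian_map fun L => ?_⟩
    have h1 : ∀ x : I → ℝ, L x = ∑ i, x i * L (Pi.single i 1) := by
      intro x
      conv_lhs => rw [← Finset.univ_sum_single x, map_sum]
      refine Finset.sum_congr rfl fun i _ => ?_
      rw [← smul_eq_mul, ← map_smul, ← Pi.single_smul, smul_eq_mul, mul_one]
    have h2 : (L ∘ fun ω => I.restrict (fun f => Φ f ω)) =ᵐ[P]
        Φ (∑ i : I, L (Pi.single i 1) • (i : F)) := by
      have h3 : Φ (∑ i : I, L (Pi.single i 1) • (i : F)) =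
          ∑ i : I, L (Pi.single i 1) • Φ (i : F) := by simp only [map_sum, map_smul]
      rw [h3]
      have h4 : ∀ᵐ ω ∂P, ∀ i : I, (L (Pi.single i 1) • Φ (i : F) : Lp ℝ 2 P) ω =
          L (Pi.single i 1) * Φ (i : F) ω :=
        ae_all_iff.2 fun i => by
          filter_upwards [Lp.coeFn_smul (L (Pi.single i 1)) (Φ (i : F))] with ω hω
          simp [hω]
      have h5 := Lp.coeFn_finsetSum (Finset.univ : Finset I)
        (fun i : I => L (Pi.single i 1) • Φ (i : F))
      filter_upwards [h4, h5] with ω h4 h5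
      rw [h5]
      rw [Function.comp_apply, h1, Finset.sum_apply]
      refine Finset.sum_congr rfl fun i _ => ?_
      rw [h4, mul_comm]
      rfl
    rw [AEMeasurable.map_map_of_aemeasurable (by fun_prop) hm, Measure.map_congr h2]
    exact (h _).isGaussian_map

end Gaussian

lemma covariance_congr_ae {Ω : Type*} [MeasurableSpace Ω] {P : Measure Ω} {X X' Y Y' : Ω → ℝ}
    (hX : X =ᵐ[P] X') (hY : Y =ᵐ[P] Y') : cov[X, Y; P] = cov[X', Y'; P] := by
  rw [covariance, covariance, integral_congr_ae hX, integral_congr_ae hY]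
  refine integral_congr_ae ?_
  filter_upwards [hX, hY] with ω h1 h2
  rw [h1, h2]

/-! ### The stochastic integral: isometry, Gaussianity, reality -/

section NoiseIntegral

variable {E Ω : Type*} [MeasureSpace E] [MeasurableSpace Ω] {W : Set E → Ω → ℂ} {P : Measure Ω}

lemma IsComplexGaussianNoise.memLp [Neg E] (hW : IsComplexGaussianNoise W P) (A : FinSet E) :
    MemLp (W A.1) 2 P :=
  (hW.gaussian.hasGaussianLaw_eval A).memLp_two

lemma IsComplexGaussianNoise.noiseLp_coe [Neg E] (hW : IsComplexGaussianNoise W P)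
    (A : FinSet E) : noiseLp W P A =ᵐ[P] W A.1 := by
  rw [noiseLp, dif_pos (hW.memLp A)]
  exact MemLp.coeFn_toLp _

/-- The inner product is conjugate linear in its first argument, so this is `covariance_eq` with the
two sets exchanged. -/
lemma IsComplexGaussianNoise.inner_noiseLp [Neg E] (hW : IsComplexGaussianNoise W P)
    (A B : FinSet E) :
    inner ℂ (noiseLp W P A) (noiseLp W P B) =
      inner ℂ (indicatorConstLp 2 A.2.1 A.2.2.ne (1 : ℂ) : Lp ℂ 2 (volume : Measure E))
        (indicatorConstLp 2 B.2.1 B.2.2.ne (1 : ℂ)) := by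
  rw [L2.inner_indicatorConstLp_one_indicatorConstLp_one A.2.1 B.2.1 A.2.2.ne B.2.2.ne, L2.inner_def, Set.inter_comm]
  refine Eq.trans (integral_congr_ae ?_) (hW.covariance_eq B A)
  filter_upwards [hW.noiseLp_coe A, hW.noiseLp_coe B] with ω h1 h2
  simp [h1, h2]

lemma IsComplexGaussianNoise.inner_simpleIntegral [Neg E] (hW : IsComplexGaussianNoise W P)
    (s t : FinSet E →₀ ℂ) :
    inner ℂ (simpleIntegral W P s) (simpleIntegral W P t) =
      inner ℂ (simpleLp E s) (simpleLp E t) := by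
  simp only [simpleIntegral, simpleLp, Finsupp.linearCombination_apply, Finsupp.sum, sum_inner,
    inner_sum, inner_smul_left, inner_smul_right, hW.inner_noiseLp]

lemma IsComplexGaussianNoise.norm_simpleIntegral [Neg E] (hW : IsComplexGaussianNoise W P)
    (s : FinSet E →₀ ℂ) : ‖simpleIntegral W P s‖ = ‖simpleLp E s‖ := by
  rw [@norm_eq_sqrt_re_inner ℂ, @norm_eq_sqrt_re_inner ℂ, hW.inner_simpleIntegral]

/-- Density makes the extension in `stochasticIntegralLp` unambiguous and lets every closed identity
be checked on simple functions only. -/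
lemma denseRange_simpleLp : DenseRange (simpleLp E) := by
  intro F
  have hcl : closure (Set.range (simpleLp E)) =
      ((LinearMap.range (simpleLp E)).topologicalClosure : Set (Lp ℂ 2 (volume : Measure E))) := by
    rw [Submodule.topologicalClosure_coe, LinearMap.coe_range]
  rw [hcl]
  refine Lp.induction (by norm_num) (fun F => F ∈ ((LinearMap.range (simpleLp E)).topologicalClosure :
    Set (Lp ℂ 2 (volume : Measure E)))) ?_ ?_ ?_ F
  · intro c s hs hμs
    apply Submodule.le_topologicalClosure
    refine ⟨Finsupp.single ⟨s, hs, hμs⟩ c, ?_⟩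
    rw [simpleLp, Finsupp.linearCombination_single, Lp.simpleFunc.coe_indicatorConst]
    apply Lp.ext
    filter_upwards [Lp.coeFn_smul c (indicatorConstLp 2 hs hμs.ne (1 : ℂ)),
      indicatorConstLp_coeFn (p := 2) (hs := hs) (hμs := hμs.ne) (c := (1 : ℂ)),
      indicatorConstLp_coeFn (p := 2) (hs := hs) (hμs := hμs.ne) (c := c)] with x h1 h2 h3
    rw [h1, Pi.smul_apply, h2, h3]
    by_cases hx : x ∈ s <;> simp [hx]
  · intro f g hf hg _ h1 h2
    exact Submodule.add_mem _ h1 h2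
  · exact Submodule.isClosed_topologicalClosure _

lemma IsComplexGaussianNoise.integralLp_simple [Neg E] (hW : IsComplexGaussianNoise W P)
    (s : FinSet E →₀ ℂ) :
    stochasticIntegralLp W P (simpleLp E s) = simpleIntegral W P s :=
  LinearMap.extendOfNorm_eq denseRange_simpleLp
    ⟨1, fun s => by rw [hW.norm_simpleIntegral, one_mul]⟩ s

lemma IsComplexGaussianNoise.norm_integralLp [Neg E] (hW : IsComplexGaussianNoise W P)
    (F : Lp ℂ 2 (volume : Measure E)) : ‖stochasticIntegralLp W P F‖ = ‖F‖ := by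
  refine denseRange_simpleLp.induction_on F (isClosed_eq (by fun_prop) (by fun_prop)) fun s => ?_
  rw [hW.integralLp_simple, hW.norm_simpleIntegral]

lemma IsComplexGaussianNoise.inner_integralLp [Neg E] (hW : IsComplexGaussianNoise W P)
    (F G : Lp ℂ 2 (volume : Measure E)) :
    inner ℂ (stochasticIntegralLp W P F) (stochasticIntegralLp W P G) = inner ℂ F G :=
  LinearIsometry.inner_map_map
    (⟨(stochasticIntegralLp W P).toLinearMap, hW.norm_integralLp⟩ :
      Lp ℂ 2 (volume : Measure E) →ₗᵢ[ℂ] Lp ℂ 2 P) F G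

lemma IsComplexGaussianNoise.integralLp_indicator [Neg E] (hW : IsComplexGaussianNoise W P)
    (A : FinSet E) :
    stochasticIntegralLp W P (indicatorConstLp 2 A.2.1 A.2.2.ne 1) = noiseLp W P A := by
  have := hW.integralLp_simple (Finsupp.single A 1)
  simpa [simpleLp, simpleIntegral, Finsupp.linearCombination_single] using this

/-- The mean is the inner product with the constant 1, hence continuous on L², and it vanishes on
simple functions. -/
lemma IsComplexGaussianNoise.integral_integralLp [Neg E] [IsProbabilityMeasure P]
    (hW : IsComplexGaussianNoise W P) (F : Lp ℂ 2 (volume : Measure E)) :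
    ∫ ω, stochasticIntegralLp W P F ω ∂P = 0 := by
  have h1 : ∀ G : Lp ℂ 2 P, ∫ ω, G ω ∂P =
      inner ℂ (indicatorConstLp 2 MeasurableSet.univ (measure_ne_top P _) (1 : ℂ)) G := by
    intro G
    rw [L2.inner_indicatorConstLp_one, Measure.restrict_univ]
  rw [h1]
  refine denseRange_simpleLp.induction_on F (isClosed_eq (by fun_prop) (by fun_prop)) fun s => ?_
  rw [hW.integralLp_simple, simpleIntegral, Finsupp.linearCombination_apply, Finsupp.sum, inner_sum]
  refine Finset.sum_eq_zero fun A _ => ?_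
  rw [inner_smul_right, ← h1, integral_congr_ae (hW.noiseLp_coe A), hW.mean_zero, mul_zero]

/-- The real part of the stochastic integral as a real linear map. -/
noncomputable def reIntegral (W : Set E → Ω → ℂ) (P : Measure Ω) :
    Lp ℂ 2 (volume : Measure E) →L[ℝ] Lp ℝ 2 P :=
  (Complex.reCLM.compLpL 2 P).comp ((stochasticIntegralLp W P).restrictScalars ℝ)

lemma reIntegral_coe (F : Lp ℂ 2 (volume : Measure E)) :
    reIntegral W P F =ᵐ[P] fun ω => (stochasticIntegralLp W P F ω).re :=
  ContinuousLinearMap.coeFn_compLpL _ _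

lemma IsComplexGaussianNoise.integral_reIntegral [Neg E] [IsProbabilityMeasure P]
    (hW : IsComplexGaussianNoise W P) (F : Lp ℂ 2 (volume : Measure E)) :
    ∫ ω, reIntegral W P F ω ∂P = 0 := by
  rw [integral_congr_ae (reIntegral_coe F)]
  have h := integral_re (𝕜 := ℂ) ((Lp.memLp (stochasticIntegralLp W P F)).integrable (by norm_num))
  rw [hW.integral_integralLp] at h
  simpa using h

/-- On a simple function the real part is a real linear functional of finitely many complex values
W(A); this is where the joint Gaussianity of real and imaginary parts is needed. The general case is
an L² limit. -/
lemma IsComplexGaussianNoise.hasGaussianLaw_reIntegral [Neg E] [IsProbabilityMeasure P]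
    (hW : IsComplexGaussianNoise W P) (F : Lp ℂ 2 (volume : Measure E)) :
    HasGaussianLaw (reIntegral W P F) P := by
  have hs : ∀ s, HasGaussianLaw (reIntegral W P (simpleLp E s)) P := by
    intro s
    let L : (s.support → ℂ) →L[ℝ] ℝ :=
      ∑ A : s.support, (Complex.reCLM.comp (ContinuousLinearMap.mul ℝ ℂ (s A))).comp
        (ContinuousLinearMap.proj A)
    refine ((hW.gaussian.hasGaussianLaw s.support).map L).congr ?_
    have h1 := reIntegral_coe (W := W) (P := P) (simpleLp E s)
    rw [hW.integralLp_simple, simpleIntegral, Finsupp.linearCombination_apply, Finsupp.sum] at h1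
    have h2 := Lp.coeFn_finsetSum s.support (fun A => s A • noiseLp W P A)
    have h3 : ∀ᵐ ω ∂P, ∀ A : s.support, (s A • noiseLp W P (A : FinSet E) : Lp ℂ 2 P) ω =
        s A * W (A : FinSet E).1 ω :=
      ae_all_iff.2 fun A => by
        filter_upwards [Lp.coeFn_smul (s A) (noiseLp W P (A : FinSet E)), hW.noiseLp_coe A]
          with ω h4 h5
        simp [h4, h5]
    filter_upwards [h1, h2, h3] with ω h1 h2 h3
    rw [h1, h2, Finset.sum_apply, ← Finset.sum_coe_sort]
    simp [L, h3, Finset.restrict_def]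
  obtain ⟨u, hu, hlim⟩ := mem_closure_iff_seq_limit.1 (denseRange_simpleLp F)
  choose s hsu using hu
  have h4 : Tendsto (fun n => reIntegral W P (u n)) atTop (𝓝 (reIntegral W P F)) :=
    ((reIntegral W P).continuous.tendsto _).comp hlim
  refine hasGaussianLaw_of_tendsto_lp (fun n => ?_) (fun n => hW.integral_reIntegral _) h4
  rw [← hsu n]
  exact hs _

/-- Reflection and conjugation `F(x) ↦ conj F(-x)`. -/
noncomputable def reflectConj [InvolutiveNeg E] [MeasurableNeg E] [(volume : Measure E).IsNegInvariant]
    (F : Lp ℂ 2 (volume : Measure E)) : Lp ℂ 2 (volume : Measure E) :=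
  (Complex.conjCLE : ℂ →L[ℝ] ℂ).compLpL 2 volume
    (Lp.compMeasurePreservingₗᵢ ℝ Neg.neg (Measure.measurePreserving_neg volume) F)

section Reflect

variable [InvolutiveNeg E] [MeasurableNeg E] [(volume : Measure E).IsNegInvariant]

lemma continuous_reflectConj : Continuous (reflectConj (E := E)) :=
  (ContinuousLinearMap.continuous _).comp (LinearIsometry.continuous _)

lemma reflectConj_coe (F : Lp ℂ 2 (volume : Measure E)) :
    reflectConj F =ᵐ[volume] fun x => starRingEnd ℂ (F (-x)) := by
  have h1 := ContinuousLinearMap.coeFn_compLpL (p := 2) (μ := (volume : Measure E))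
    (Complex.conjCLE : ℂ →L[ℝ] ℂ)
    (Lp.compMeasurePreservingₗᵢ ℝ Neg.neg (Measure.measurePreserving_neg volume) F)
  have h2 := Lp.coeFn_compMeasurePreserving F
    (Measure.measurePreserving_neg (volume : Measure E))
  filter_upwards [h1, h2] with x h1 h2
  rw [reflectConj, h1]
  exact congrArg (starRingEnd ℂ) h2

lemma reflectConj_add (F G : Lp ℂ 2 (volume : Measure E)) :
    reflectConj (F + G) = reflectConj F + reflectConj G := by
  simp [reflectConj]

/-- Both sides are additive and continuous, so it suffices to take c·1_A, where the identity is
W(-A) = conj W(A). -/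
lemma IsComplexGaussianNoise.integralLp_reflectConj [IsProbabilityMeasure P]
    (hW : IsComplexGaussianNoise W P) (F : Lp ℂ 2 (volume : Measure E)) :
    stochasticIntegralLp W P (reflectConj F) =
      (Complex.conjCLE : ℂ →L[ℝ] ℂ).compLpL 2 P (stochasticIntegralLp W P F) := by
  refine denseRange_simpleLp.induction_on F
    (isClosed_eq ((ContinuousLinearMap.continuous _).comp continuous_reflectConj)
      (by fun_prop)) fun s => ?_
  induction s using Finsupp.induction_linear with
  | zero => simp [reflectConj]
  | add s t hs ht => simp only [map_add, reflectConj_add, hs, ht]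
  | single A c =>
    have hA : MeasurableSet (Neg.neg ⁻¹' A.1 : Set E) := measurable_neg A.2.1
    have hvol : (volume : Measure E) (Neg.neg ⁻¹' A.1) = volume A.1 :=
      (Measure.measurePreserving_neg volume).measure_preimage A.2.1.nullMeasurableSet
    let B : FinSet E := ⟨Neg.neg ⁻¹' A.1, hA, by rw [hvol]; exact A.2.2⟩
    have h1 : reflectConj (simpleLp E (Finsupp.single A c)) =
        starRingEnd ℂ c • indicatorConstLp 2 B.2.1 B.2.2.ne (1 : ℂ) := by
      apply Lp.ext
      have hq := (Measure.measurePreserving_neg (volume : Measure E)).quasiMeasurePreserving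
      have e1 := hq.ae_eq_comp (Lp.coeFn_smul c
        (indicatorConstLp 2 A.2.1 A.2.2.ne (1 : ℂ) : Lp ℂ 2 (volume : Measure E)))
      have e2 := hq.ae_eq_comp (indicatorConstLp_coeFn (p := 2) (hs := A.2.1)
        (hμs := A.2.2.ne) (c := (1 : ℂ)))
      filter_upwards [reflectConj_coe (simpleLp E (Finsupp.single A c)), e1, e2,
        Lp.coeFn_smul (starRingEnd ℂ c)
        (indicatorConstLp 2 B.2.1 B.2.2.ne (1 : ℂ) : Lp ℂ 2 (volume : Measure E)),
        indicatorConstLp_coeFn (p := 2) (hs := B.2.1) (hμs := B.2.2.ne) (c := (1 : ℂ))]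
        with x e0 e1 e2 e3 e4
      rw [e0, e3, simpleLp, Finsupp.linearCombination_single, Pi.smul_apply, e4]
      simp only [Function.comp_apply, Pi.smul_apply] at e1 e2
      rw [e1, e2, smul_eq_mul, smul_eq_mul, map_mul]
      congr 1
      by_cases hx : -x ∈ A.1
      · have : x ∈ B.1 := hx
        simp [hx, this]
      · have : x ∉ B.1 := hx
        simp [hx, this]
    rw [h1, map_smul, hW.integralLp_indicator, simpleLp, Finsupp.linearCombination_single, map_smul,
      hW.integralLp_indicator]
    apply Lp.ext
    filter_upwards [Lp.coeFn_smul (starRingEnd ℂ c) (noiseLp W P B), hW.noiseLp_coe B,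
      hW.noiseLp_coe A, hW.hermitian A, Lp.coeFn_smul c (noiseLp W P A),
      ContinuousLinearMap.coeFn_compLpL (p := 2) (μ := P) (Complex.conjCLE : ℂ →L[ℝ] ℂ)
        (c • noiseLp W P A)] with ω e1 e2 e3 e4 e5 e6
    rw [e1, e6, e5, Pi.smul_apply, Pi.smul_apply, e2, e3]
    change starRingEnd ℂ c * W (Neg.neg ⁻¹' A.1) ω = starRingEnd ℂ (c * W A.1 ω)
    rw [e4, map_mul]

/-- A Hermitian integrand is fixed by reflection and conjugation, so its integral equals its own
conjugate. -/
lemma IsComplexGaussianNoise.integralLp_real [IsProbabilityMeasure P]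
    (hW : IsComplexGaussianNoise W P) {F : Lp ℂ 2 (volume : Measure E)}
    (hF : reflectConj F = F) :
    stochasticIntegralLp W P F =ᵐ[P] fun ω => (reIntegral W P F ω : ℂ) := by
  have h1 := hW.integralLp_reflectConj F
  rw [hF] at h1
  have h2 := ContinuousLinearMap.coeFn_compLpL (p := 2) (μ := P) (Complex.conjCLE : ℂ →L[ℝ] ℂ)
    (stochasticIntegralLp W P F)
  rw [← h1] at h2
  filter_upwards [h2, reIntegral_coe F] with ω h2 h3
  rw [h3]
  exact (Complex.conj_eq_iff_re.1 h2.symm).symm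

/-- Both integrals are real, so the product of their real parts is their Hermitian product and the
isometry applies. -/
lemma IsComplexGaussianNoise.cov_reIntegral [IsProbabilityMeasure P]
    (hW : IsComplexGaussianNoise W P) {F G : Lp ℂ 2 (volume : Measure E)}
    (hF : reflectConj F = F) (hG : reflectConj G = G) :
    cov[reIntegral W P F, reIntegral W P G; P] = (inner ℂ G F).re := by
  rw [covariance_eq_sub (Lp.memLp _) (Lp.memLp _), hW.integral_reIntegral, zero_mul, sub_zero,
    ← hW.inner_integralLp, L2.inner_def]
  have : ∫ ω, inner ℂ (stochasticIntegralLp W P G ω) (stochasticIntegralLp W P F ω) ∂P =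
      ((∫ ω, (reIntegral W P F * reIntegral W P G : Ω → ℝ) ω ∂P : ℝ) : ℂ) := by
    rw [← integral_complex_ofReal]
    refine integral_congr_ae ?_
    filter_upwards [hW.integralLp_real hF, hW.integralLp_real hG] with ω h1 h2
    simp [h1, h2]
  rw [this, Complex.ofReal_re]

/-- The fields `∫ φ_t dW` with `φ_t(-x) = conj φ_t(x)` are centered Gaussian, with covariances
`∫ φ_s conj φ_t`. -/
theorem IsComplexGaussianNoise.gaussianField [IsProbabilityMeasure P]
    (hW : IsComplexGaussianNoise W P) {T : Type*} {φ : T → E → ℂ}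
    (hφ : ∀ t, MemLp (φ t) 2 volume) (hsym : ∀ t x, φ t (-x) = starRingEnd ℂ (φ t x)) :
    IsGaussianProcess (fun t ω => (stochasticIntegral W P (φ t) ω).re) P ∧
    (∀ t, ∫ ω, (stochasticIntegral W P (φ t) ω).re ∂P = 0) ∧
    ∀ s t, cov[fun ω => (stochasticIntegral W P (φ s) ω).re,
      fun ω => (stochasticIntegral W P (φ t) ω).re; P] =
      (∫ x, φ s x * starRingEnd ℂ (φ t x)).re := by
  have h1 : ∀ t, (fun ω => (stochasticIntegral W P (φ t) ω).re) =ᵐ[P]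
      reIntegral W P ((hφ t).toLp (φ t)) := by
    intro t
    rw [stochasticIntegral, dif_pos (hφ t)]
    exact (reIntegral_coe _).symm
  have h2 : ∀ t, reflectConj ((hφ t).toLp (φ t)) = (hφ t).toLp (φ t) := by
    intro t
    apply Lp.ext
    have hq := (Measure.measurePreserving_neg (volume : Measure E)).quasiMeasurePreserving
    filter_upwards [reflectConj_coe ((hφ t).toLp (φ t)), (hφ t).coeFn_toLp,
      hq.ae_eq_comp (hφ t).coeFn_toLp] with x h3 h4 h5
    simp only [Function.comp_apply] at h5
    rw [h3, h4, h5, hsym, Complex.conj_conj]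
  refine ⟨?_, fun t => ?_, fun s t => ?_⟩
  · refine IsGaussianProcess.congr ?_ (fun t => (h1 t).symm)
    exact (isGaussianProcess_of_linear (reIntegral W P).toLinearMap
      hW.hasGaussianLaw_reIntegral).comp_right (fun t => (hφ t).toLp (φ t))
  · rw [integral_congr_ae (h1 t), hW.integral_reIntegral]
  · rw [covariance_congr_ae (h1 s) (h1 t), hW.cov_reIntegral (h2 s) (h2 t), L2.inner_def]
    congr 1
    refine integral_congr_ae ?_
    filter_upwards [(hφ s).coeFn_toLp, (hφ t).coeFn_toLp] with x h3 h4
    simp [h3, h4]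

end Reflect

end NoiseIntegral

/-! ### Existence of the Gaussian noises -/

section Existence

/-- Existence of an isonormal Gaussian process over a real Hilbert space. -/
lemma exists_isonormal (H : Type) [NormedAddCommGroup H] [InnerProductSpace ℝ H]
    [CompleteSpace H] :
    ∃ (Ω : Type) (_ : MeasurableSpace Ω) (P : Measure Ω) (_ : IsProbabilityMeasure P)
      (Φ : H →ₗᵢ[ℝ] Lp ℝ 2 P), (∀ f, HasGaussianLaw (Φ f) P) ∧ ∀ f, ∫ ω, Φ f ω ∂P = 0 := by
  obtain ⟨w, b, -⟩ := exists_hilbertBasis ℝ H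
  -- Independent standard Gaussians indexed by a Hilbert basis; Φ will send f to the L² sum of these
  -- variables weighted by the coordinates of f.
  let P : Measure (w → ℝ) := Measure.infinitePi fun _ => gaussianReal 0 1
  have hmap : ∀ i : w, P.map (fun ω => ω i) = gaussianReal 0 1 := fun i =>
    (measurePreserving_eval_infinitePi (fun _ : w => gaussianReal 0 1) i).map_eq
  have hg : ∀ i : w, HasGaussianLaw (fun ω : w → ℝ => ω i) P := fun i =>
    ⟨by rw [hmap]; infer_instance⟩
  have hind : iIndepFun (fun (i : w) (ω : w → ℝ) => ω i) P :=
    iIndepFun_infinitePi (P := fun _ : w => gaussianReal 0 1) (X := fun _ x => x)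
      (fun _ => measurable_id)
  have hL : ∀ i : w, MemLp (fun ω : w → ℝ => ω i) 2 P := fun i => (hg i).memLp_two
  have hmean : ∀ i : w, ∫ ω : w → ℝ, ω i ∂P = 0 := by
    intro i
    have := integral_map (μ := P) (φ := fun ω : w → ℝ => ω i) (hg i).aemeasurable
      (f := fun x : ℝ => x) (by fun_prop)
    rw [← this, hmap, integral_id_gaussianReal]
  have hvar : ∀ i : w, Var[fun ω : w → ℝ => ω i; P] = 1 := by
    intro i
    have := variance_map (μ := P) (Y := fun ω : w → ℝ => ω i) (X := fun x : ℝ => x)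
      (by fun_prop) (hg i).aemeasurable
    simp only [Function.comp_def] at this
    rw [← this, hmap]
    simp
  let ξ : w → Lp ℝ 2 P := fun i => (hL i).toLp _
  have hξ : Orthonormal ℝ ξ := by
    classical
    rw [orthonormal_iff_ite]
    intro i j
    have h1 : inner ℝ (ξ i) (ξ j) = ∫ ω : w → ℝ, ω j * ω i ∂P := by
      rw [L2.inner_def]
      refine integral_congr_ae ?_
      filter_upwards [(hL i).coeFn_toLp, (hL j).coeFn_toLp] with ω h1 h2
      simp [ξ, h1, h2]
    rw [h1]
    split_ifs with hij
    · subst hij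
      rw [← hvar i, variance_of_integral_eq_zero (hg i).aemeasurable (hmean i)]
      simp [sq]
    · rw [IndepFun.integral_fun_mul_eq_mul_integral (hind.indepFun (Ne.symm hij))
        (hL j).1 (hL i).1, hmean, zero_mul]
  let Φ : H →ₗᵢ[ℝ] Lp ℝ 2 P :=
    hξ.orthogonalFamily.linearIsometry.comp b.repr.toLinearIsometry
  have hsum : ∀ f, HasSum (fun i => (b.repr f i) • ξ i) (Φ f) := fun f =>
    hξ.orthogonalFamily.hasSum_linearIsometry (b.repr f)
  have hfin : ∀ f (s : Finset w), (∑ i ∈ s, (b.repr f i) • ξ i : Lp ℝ 2 P) =ᵐ[P]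
      fun ω => ∑ i : s, b.repr f i * ω i := by
    intro f s
    have h1 : ∀ᵐ ω ∂P, ∀ i : s, ((b.repr f i) • ξ i : Lp ℝ 2 P) ω = b.repr f i * ω i :=
      ae_all_iff.2 fun i => by
        filter_upwards [Lp.coeFn_smul (b.repr f i) (ξ i), (hL i).coeFn_toLp] with ω h1 h2
        rw [h1, Pi.smul_apply, h2, smul_eq_mul]
    filter_upwards [h1, Lp.coeFn_finsetSum s (fun i => (b.repr f i) • ξ i)] with ω h1 h2
    rw [h2, Finset.sum_apply, ← Finset.sum_coe_sort]
    exact Finset.sum_congr rfl fun i _ => h1 i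
  have hgauss : ∀ f (s : Finset w),
      HasGaussianLaw (∑ i ∈ s, (b.repr f i) • ξ i : Lp ℝ 2 P) P := by
    intro f s
    refine HasGaussianLaw.congr ?_ (hfin f s).symm
    refine iIndepFun.hasGaussianLaw_fun_sum (X := fun (i : s) (ω : w → ℝ) => b.repr f i * ω i)
      (fun i => (hg i).fun_smul _) ?_
    exact (hind.precomp (g := fun i : s => (i : w)) Subtype.val_injective).comp
      (fun i x => b.repr f i * x) (fun i => by fun_prop)
  have hmean' : ∀ f (s : Finset w),
      ∫ ω, (∑ i ∈ s, (b.repr f i) • ξ i : Lp ℝ 2 P) ω ∂P = 0 := by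
    intro f s
    rw [integral_congr_ae (hfin f s), integral_finsetSum]
    · simp [integral_const_mul, hmean]
    · intro i _
      exact ((hL i).integrable (by norm_num)).const_mul _
  refine ⟨w → ℝ, inferInstance, P, inferInstance, Φ, fun f => ?_, fun f => ?_⟩
  · have hcl : Φ f ∈ closure (Set.range fun s : Finset w => ∑ i ∈ s, (b.repr f i) • ξ i) :=
      mem_closure_of_tendsto (hsum f) (Eventually.of_forall fun s => ⟨s, rfl⟩)
    obtain ⟨u, hu, hlim⟩ := mem_closure_iff_seq_limit.1 hcl
    choose s hs using hu
    exact hasGaussianLaw_of_tendsto_lp (fun n => by rw [← hs n]; exact hgauss f _)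
      (fun n => by rw [← hs n]; exact hmean' f _) hlim
  · have h1 : ∀ G : Lp ℝ 2 P, ∫ ω, G ω ∂P =
        inner ℝ (indicatorConstLp 2 MeasurableSet.univ (measure_ne_top P _) (1 : ℝ)) G := by
      intro G
      rw [L2.inner_indicatorConstLp_one, Measure.restrict_univ]
    have h2 := (hsum f).mapL
      (innerSL ℝ (indicatorConstLp 2 MeasurableSet.univ (measure_ne_top P _) (1 : ℝ)))
    have h3 : Tendsto (fun s : Finset w => (0 : ℝ)) atTop (𝓝 (∫ ω, Φ f ω ∂P)) := by
      rw [h1]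
      refine Tendsto.congr (fun s => ?_) h2
      rw [← map_sum, innerSL_apply_apply, ← h1, hmean']
    exact tendsto_nhds_unique h3 tendsto_const_nhds

variable {E Ω : Type*} [MeasureSpace E] [MeasurableSpace Ω] {P : Measure Ω}

/-- A complex Hermitian noise built from a real Gaussian noise `N`. -/
lemma exists_complexNoise_of_real [InvolutiveNeg E] [MeasurableNeg E]
    [(volume : Measure E).IsNegInvariant] [IsProbabilityMeasure P] (N : FinSet E → Ω → ℝ)
    (hN : IsGaussianProcess N P) (h0 : ∀ A, ∫ ω, N A ω ∂P = 0)
    (hcov : ∀ A B, ∫ ω, N A ω * N B ω ∂P = volume.real (A.1 ∩ B.1)) :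
    ∃ W : Set E → Ω → ℂ, IsComplexGaussianNoise W P := by
  classical
  have hvol : ∀ A : Set E, MeasurableSet A →
      (volume : Measure E) (Neg.neg ⁻¹' A) = volume A := fun A hA =>
    (Measure.measurePreserving_neg volume).measure_preimage hA.nullMeasurableSet
  let nA : FinSet E → FinSet E := fun A =>
    ⟨Neg.neg ⁻¹' A.1, measurable_neg A.2.1, by rw [hvol _ A.2.1]; exact A.2.2⟩
  have hnn : ∀ A, nA (nA A) = A := fun A => Subtype.ext (by simp [nA])
  -- The even part of N under reflection becomes the real part and the odd part the imaginary part,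
  -- which is what W(-A) = conj W(A) demands.
  let V : FinSet E → Ω → ℂ := fun A ω =>
    ⟨2⁻¹ * (N A ω + N (nA A) ω), 2⁻¹ * (N A ω - N (nA A) ω)⟩
  let W : Set E → Ω → ℂ := fun A =>
    if h : MeasurableSet A ∧ (volume : Measure E) A < ∞ then V ⟨A, h⟩ else 0
  have hWV : ∀ A : FinSet E, W A.1 = V A := fun A => dif_pos A.2
  have hL : ∀ A, MemLp (N A) 2 P := fun A => (hN.hasGaussianLaw_eval A).memLp_two
  have hI : ∀ A, Integrable (N A) P := fun A => (hL A).integrable (by norm_num)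
  have hM : ∀ A B, Integrable (fun ω => N A ω * N B ω) P := fun A B =>
    (hL A).integrable_mul (hL B)
  have hVof : ∀ A ω, V A ω = ((2⁻¹ * (N A ω + N (nA A) ω) : ℝ) : ℂ) +
      ((2⁻¹ * (N A ω - N (nA A) ω) : ℝ) : ℂ) * Complex.I := fun A ω => by
    apply Complex.ext <;> simp [V]
  refine ⟨W, ?_, ?_, ?_, ?_⟩
  · have : (fun (A : FinSet E) ω => W A.1 ω) = V := by
      funext A
      exact hWV A
    rw [this]
    refine hN.of_isGaussianProcess fun A => ⟨{A, nA A}, ?_⟩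
    let a : ({A, nA A} : Finset (FinSet E)) := ⟨A, by simp⟩
    let b : ({A, nA A} : Finset (FinSet E)) := ⟨nA A, by simp⟩
    let pa : (({A, nA A} : Finset (FinSet E)) → ℝ) →L[ℝ] ℝ := ContinuousLinearMap.proj a
    let pb : (({A, nA A} : Finset (FinSet E)) → ℝ) →L[ℝ] ℝ := ContinuousLinearMap.proj b
    refine ⟨(Complex.ofRealCLM.comp ((2⁻¹ : ℝ) • (pa + pb))) +
      ((ContinuousLinearMap.mul ℝ ℂ Complex.I).comp
        (Complex.ofRealCLM.comp ((2⁻¹ : ℝ) • (pa - pb)))), fun ω => ?_⟩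
    rw [hVof]
    simp [pa, pb, a, b, Finset.restrict_def]
    ring
  · intro A
    rw [hWV]
    simp_rw [hVof]
    rw [integral_add, integral_mul_const, integral_complex_ofReal, integral_complex_ofReal,
      integral_const_mul, integral_const_mul, integral_add (hI _) (hI _),
      integral_sub (hI _) (hI _)]
    · simp [h0]
    · exact (((hI _).add (hI _)).const_mul _).ofReal
    · exact ((((hI _).sub (hI _)).const_mul _).ofReal).mul_const _
  · intro A B
    rw [hWV, hWV]
    have e1 : ∀ ω, V A ω * (starRingEnd ℂ) (V B ω) =
        ((2⁻¹ * (N A ω * N B ω + N (nA A) ω * N (nA B) ω) : ℝ) : ℂ) +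
        ((2⁻¹ * (N A ω * N (nA B) ω - N (nA A) ω * N B ω) : ℝ) : ℂ) * Complex.I := by
      intro ω
      apply Complex.ext <;> simp [V] <;> ring
    simp_rw [e1]
    have i1 : volume.real ((nA A).1 ∩ (nA B).1) = volume.real (A.1 ∩ B.1) := by
      rw [measureReal_def, measureReal_def, ← hvol _ (A.2.1.inter B.2.1)]
      rfl
    -- Reflection maps A ∩ (-B) to (-A) ∩ B; this cancels the imaginary part of the covariance.
    have i2 : volume.real (A.1 ∩ (nA B).1) = volume.real ((nA A).1 ∩ B.1) := by
      rw [measureReal_def, measureReal_def, ← hvol _ (A.2.1.inter (nA B).2.1), Set.preimage_inter]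
      congr 3
      exact congrArg Subtype.val (hnn B)
    rw [integral_add, integral_mul_const, integral_complex_ofReal, integral_complex_ofReal,
      integral_const_mul, integral_const_mul, integral_add (hM _ _) (hM _ _),
      integral_sub (hM _ _) (hM _ _), hcov, hcov, hcov, hcov, i1, i2]
    · push_cast
      ring
    · exact (((hM _ _).add (hM _ _)).const_mul _).ofReal
    · exact ((((hM _ _).sub (hM _ _)).const_mul _).ofReal).mul_const _
  · intro A
    have e1 : W (Neg.neg ⁻¹' A.1) = V (nA A) := hWV (nA A)
    rw [e1, hWV]
    refine Eventually.of_forall fun ω => ?_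
    apply Complex.ext
    · simp [V, hnn, add_comm]
    · simp [V, hnn]
      ring

/-- Existence of Gaussian noises on `ℝ²` and on `ℝ`. -/
theorem exists_noises :
    ∃ (Ω' : Type) (_ : MeasurableSpace Ω') (P' : Measure Ω') (_ : IsProbabilityMeasure P')
      (W : Set (ℝ × ℝ) → Ω' → ℂ) (W₁ : Set ℝ → Ω' → ℂ),
      IsComplexGaussianNoise W P' ∧ IsComplexGaussianNoise W₁ P' := by
  obtain ⟨Ω, mΩ, P, hP, Φ, hΦ, hΦ0⟩ := exists_isonormal (Lp ℝ 2 (volume : Measure (ℝ × ℝ)))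
  let N : FinSet (ℝ × ℝ) → Ω → ℝ := fun A => Φ (indicatorConstLp 2 A.2.1 A.2.2.ne 1)
  have hN : IsGaussianProcess N P :=
    (isGaussianProcess_of_linear Φ.toLinearMap hΦ).comp_right
      (fun A : FinSet (ℝ × ℝ) => indicatorConstLp 2 A.2.1 A.2.2.ne 1)
  have hcov : ∀ A B, ∫ ω, N A ω * N B ω ∂P = volume.real (A.1 ∩ B.1) := by
    intro A B
    have h1 := L2.real_inner_indicatorConstLp_one_indicatorConstLp_one (μ := (volume : Measure (ℝ × ℝ)))
      B.2.1 A.2.1 B.2.2.ne A.2.2.ne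
    rw [← Φ.inner_map_map, L2.inner_def] at h1
    rw [Set.inter_comm, ← h1]
    simp [N]
  -- Strips A × [0,1] have area |A|, so the planar noise restricted to them is a noise on the line.
  -- W and W₁ need not be independent, since each limit field uses only one of them.
  let strip : FinSet ℝ → FinSet (ℝ × ℝ) := fun A =>
    ⟨A.1 ×ˢ Set.Icc 0 1, A.2.1.prod measurableSet_Icc, by
      rw [Measure.volume_eq_prod, Measure.prod_prod]
      simpa using A.2.2⟩
  obtain ⟨W, hW⟩ := exists_complexNoise_of_real N hN (fun A => hΦ0 _) hcov
  obtain ⟨W₁, hW₁⟩ := exists_complexNoise_of_real (fun A => N (strip A)) (hN.comp_right strip)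
    (fun A => hΦ0 _) (fun A B => by
      rw [hcov]
      simp only [strip, ← Set.inter_prod, measureReal_def]
      rw [Measure.volume_eq_prod, Measure.prod_prod]
      simp)
  exact ⟨Ω, mΩ, P, hP, W, W₁, hW, hW₁⟩

end Existence

/-! ### The beta integral -/

section BetaIntegral

lemma integrable_comp_abs {f : ℝ → ℝ} (hf : IntegrableOn f (Set.Ioi 0)) :
    Integrable (fun x => f |x|) := by
  have h1 : IntegrableOn (fun x => f |x|) (Set.Ioi 0) :=
    hf.congr_fun (fun x hx => by rw [abs_of_pos hx]) measurableSet_Ioi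
  have h2 : IntegrableOn (fun x => f |x|) (Set.Iic 0) := by
    rw [← Measure.map_neg_eq_self (volume : Measure ℝ)]
    let m : MeasurableEmbedding fun x : ℝ => -x := (Homeomorph.neg ℝ).measurableEmbedding
    rw [m.integrableOn_map_iff]
    simp_rw [Function.comp_def, abs_neg, Set.neg_preimage, Set.neg_Iic, neg_zero]
    exact Iff.mpr integrableOn_Ici_iff_integrableOn_Ioi h1
  rw [← integrableOn_univ, ← Set.Iic_union_Ioi (a := (0 : ℝ))]
  exact h2.union h1

lemma integrableOn_rpow_mul_exp {a r : ℝ} (ha : 0 < a) (hr : 0 < r) :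
    IntegrableOn (fun t : ℝ => t ^ (a - 1) * Real.exp (-(r * t))) (Set.Ioi 0) := by
  have := integrableOn_rpow_mul_exp_neg_mul_rpow (p := 1) (s := a - 1) (b := r)
    (by linarith) one_pos hr
  simpa [Real.rpow_one, neg_mul] using this

/-- The integral `∫ (A + B |w|^q)^{-r} dw` in terms of the beta function. -/
lemma integral_add_mul_abs_rpow {A B q r : ℝ} (hA : 0 < A) (hB : 0 < B) (hq : 0 < q)
    (hr : 1 / q < r) :
    Integrable (fun w : ℝ => (A + B * |w| ^ q) ^ (-r)) ∧
    ∫ w : ℝ, (A + B * |w| ^ q) ^ (-r) =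
      2 / q * beta (1 / q) (r - 1 / q) * A ^ (1 / q - r) * B ^ (-(1 / q)) := by
  have hq' : 0 < 1 / q := by positivity
  have hr0 : 0 < r := hq'.trans hr
  have hΓ : 0 < Real.Gamma r := Real.Gamma_pos_of_pos hr0
  let μ : Measure ℝ := volume.restrict (Set.Ioi 0)
  -- Integrating F in s gives Γ(r)(A + B w^q)^(-r); integrating first in w and then in s gives two
  -- Gamma values. Comparing the two orders yields the beta function.
  let F : ℝ × ℝ → ℝ := fun p => p.1 ^ (r - 1) * Real.exp (-(A * p.1)) *
    Real.exp (-(B * p.1) * p.2 ^ q)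
  have hpos : ∀ᵐ s ∂μ, 0 < s := ae_restrict_mem measurableSet_Ioi
  have hFm : Measurable F := by fun_prop
  have hin : ∀ s : ℝ, 0 < s → ∫ w, F (s, w) ∂μ =
      B ^ (-(1 / q)) * Real.Gamma (1 / q + 1) *
        (s ^ (r - 1 / q - 1) * Real.exp (-(A * s))) := by
    intro s hs
    simp only [F]
    rw [integral_const_mul, integral_exp_neg_mul_rpow hq (by positivity), neg_div,
      Real.mul_rpow hB.le hs.le, show r - 1 / q - 1 = (r - 1) + (-(1 / q)) by ring,
      Real.rpow_add hs]
    ring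
  have hout : ∀ w : ℝ, 0 < w → ∫ s, F (s, w) ∂μ = Real.Gamma r * (A + B * w ^ q) ^ (-r) := by
    intro w hw
    have hw' : 0 < A + B * w ^ q := by positivity
    have : ∀ s, F (s, w) = s ^ (r - 1) * Real.exp (-((A + B * w ^ q) * s)) := by
      intro s
      simp only [F]
      rw [mul_assoc, ← Real.exp_add]
      congr 2
      ring
    simp_rw [this]
    rw [Real.integral_rpow_mul_exp_neg_mul_Ioi hr0 hw', one_div, Real.inv_rpow hw'.le,
      Real.rpow_neg hw'.le]
    ring
  have hI2 : Integrable (fun s => B ^ (-(1 / q)) * Real.Gamma (1 / q + 1) *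
        (s ^ (r - 1 / q - 1) * Real.exp (-(A * s)))) μ :=
    (integrableOn_rpow_mul_exp (by linarith) hA).const_mul _
  have hFi : Integrable F (μ.prod μ) := by
    rw [integrable_prod_iff hFm.aestronglyMeasurable]
    constructor
    · filter_upwards [hpos] with s hs
      have := (integrableOn_rpow_mul_exp_neg_mul_rpow (s := 0) (by norm_num) hq
        (show 0 < B * s by positivity)).const_mul (s ^ (r - 1) * Real.exp (-(A * s)))
      simpa [F] using! this
    · refine hI2.congr ?_
      filter_upwards [hpos] with s hs
      rw [← hin s hs]
      refine integral_congr_ae ?_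
      filter_upwards [hpos] with w hw
      rw [Real.norm_of_nonneg]
      simp only [F]
      positivity
  have h1 : ∫ w, Real.Gamma r * (A + B * w ^ q) ^ (-r) ∂μ =
      B ^ (-(1 / q)) * Real.Gamma (1 / q + 1) * ((1 / A) ^ (r - 1 / q) * Real.Gamma (r - 1 / q)) := by
    have e1 : ∫ w, Real.Gamma r * (A + B * w ^ q) ^ (-r) ∂μ = ∫ w, ∫ s, F (s, w) ∂μ ∂μ := by
      refine integral_congr_ae ?_
      filter_upwards [hpos] with w hw using (hout w hw).symm
    have e2 : ∫ s, ∫ w, F (s, w) ∂μ ∂μ = ∫ s, B ^ (-(1 / q)) * Real.Gamma (1 / q + 1) *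
        (s ^ (r - 1 / q - 1) * Real.exp (-(A * s))) ∂μ := by
      refine integral_congr_ae ?_
      filter_upwards [hpos] with s hs using hin s hs
    rw [e1, ← integral_integral_swap (f := fun s w => F (s, w)) hFi, e2, integral_const_mul,
      Real.integral_rpow_mul_exp_neg_mul_Ioi (by linarith) hA]
  have hI : IntegrableOn (fun w : ℝ => (A + B * w ^ q) ^ (-r)) (Set.Ioi 0) := by
    have h2 : Integrable (fun w => Real.Gamma r * (A + B * w ^ q) ^ (-r)) μ := by
      refine hFi.integral_prod_right.congr ?_
      filter_upwards [hpos] with w hw using hout w hw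
    refine (h2.const_mul (Real.Gamma r)⁻¹).congr (Eventually.of_forall fun w => ?_)
    simp only
    rw [← mul_assoc, inv_mul_cancel₀ hΓ.ne', one_mul]
  refine ⟨integrable_comp_abs hI, ?_⟩
  rw [integral_comp_abs (f := fun w => (A + B * w ^ q) ^ (-r))]
  rw [integral_const_mul] at h1
  have h3 : ∫ w in Set.Ioi 0, (A + B * w ^ q) ^ (-r) = (Real.Gamma r)⁻¹ *
      (B ^ (-(1 / q)) * Real.Gamma (1 / q + 1) *
        ((1 / A) ^ (r - 1 / q) * Real.Gamma (r - 1 / q))) := by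
    rw [← h1, ← mul_assoc, inv_mul_cancel₀ hΓ.ne', one_mul]
  rw [h3, Real.Gamma_add_one hq'.ne', beta, show 1 / q + (r - 1 / q) = r by ring, one_div A,
    Real.inv_rpow hA.le, ← Real.rpow_neg hA.le, neg_sub]
  ring

end BetaIntegral

/-! ### The homogeneous density h and its integrability -/

section Weights

/-- Integrable at 0 because α < 1, and at infinity because of (1 + v²)⁻¹, the decay of the squared
kernel. -/
lemma integrable_japanese_mul_rpow {α : ℝ} (h0 : 0 ≤ α) (h1 : α < 1) :
    Integrable (fun v : ℝ => (1 + v ^ 2)⁻¹ * |v| ^ (-α)) := by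
  have key : IntegrableOn (fun v : ℝ => (1 + v ^ 2)⁻¹ * v ^ (-α)) (Set.Ioi 0) := by
    rw [← Set.Ioc_union_Ioi_eq_Ioi zero_le_one]
    refine IntegrableOn.union ?_ ?_
    · have h2 : IntegrableOn (fun v : ℝ => v ^ (-α)) (Set.Ioc 0 1) :=
        (intervalIntegrable_iff_integrableOn_Ioc_of_le zero_le_one).1
          (intervalIntegral.intervalIntegrable_rpow' (by linarith))
      refine Integrable.mono' h2 (by fun_prop) ?_
      filter_upwards [ae_restrict_mem measurableSet_Ioc] with v hv
      have hv0 : 0 < v := hv.1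
      rw [Real.norm_of_nonneg (by positivity)]
      exact mul_le_of_le_one_left (by positivity) (inv_le_one_of_one_le₀ (by nlinarith))
    · refine Integrable.mono' (integrable_inv_one_add_sq.integrableOn) (by fun_prop) ?_
      filter_upwards [ae_restrict_mem measurableSet_Ioi] with v hv
      have hv0 : (1 : ℝ) < v := hv
      have hv1 : 0 < v := by linarith
      rw [Real.norm_of_nonneg (by positivity)]
      exact mul_le_of_le_one_right (by positivity)
        (Real.rpow_le_one_of_one_le_of_nonpos hv0.le (by linarith))
  have := integrable_comp_abs key
  simpa [sq_abs] using this

variable {H₁ H₂ c : ℝ}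

lemma measurable_hDensity : Measurable fun p : ℝ × ℝ => hDensity H₁ H₂ c p.1 p.2 := by
  unfold hDensity
  fun_prop

lemma hDensity_nonneg (hc : 0 < c) (u v : ℝ) : 0 ≤ hDensity H₁ H₂ c u v := by
  unfold hDensity
  positivity

lemma hDensity_neg_left (u v : ℝ) : hDensity H₁ H₂ c (-u) v = hDensity H₁ H₂ c u v := by
  simp [hDensity]

lemma hDensity_neg_right (u v : ℝ) : hDensity H₁ H₂ c u (-v) = hDensity H₁ H₂ c u v := by
  simp [hDensity]

lemma hDensity_eq_rpow (hc : 0 < c) (u v : ℝ) :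
    hDensity H₁ H₂ c u v = (|u| ^ 2 + c * |v| ^ (2 * H₂ / H₁)) ^ (-(H₁ / 2)) := by
  rw [hDensity, Real.rpow_neg (by positivity), one_div]

lemma hDensity_pos (hc : 0 < c) {u : ℝ} (hu : u ≠ 0) (v : ℝ) : 0 < hDensity H₁ H₂ c u v := by
  have := abs_pos.2 hu
  unfold hDensity
  positivity

/-- Discard the term in v. This is the majorant for H₁ < 1. -/
lemma hDensity_le_left (hc : 0 < c) (hH₁ : 0 < H₁) {u : ℝ} (hu : u ≠ 0) (v : ℝ) :
    hDensity H₁ H₂ c u v ≤ |u| ^ (-H₁) := by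
  have hu' := abs_pos.2 hu
  have h1 : |u| ^ H₁ ≤ (|u| ^ 2 + c * |v| ^ (2 * H₂ / H₁)) ^ (H₁ / 2) := by
    calc |u| ^ H₁ = (|u| ^ 2) ^ (H₁ / 2) := by
          rw [← Real.rpow_natCast, ← Real.rpow_mul hu'.le]
          congr 1
          push_cast
          ring
      _ ≤ _ := Real.rpow_le_rpow (by positivity) (le_add_of_nonneg_right (by positivity))
          (by positivity)
  rw [hDensity, Real.rpow_neg hu'.le, ← one_div]
  exact one_div_le_one_div_of_le (by positivity) h1

/-- Discard the term in u. This is the majorant for H₂ < 1. -/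
lemma hDensity_le_right (hc : 0 < c) (hH₁ : 0 < H₁) (u : ℝ) {v : ℝ} (hv : v ≠ 0) :
    hDensity H₁ H₂ c u v ≤ c ^ (-H₁ / 2) * |v| ^ (-H₂) := by
  have hv' := abs_pos.2 hv
  have h1 : c ^ (H₁ / 2) * |v| ^ H₂ ≤ (|u| ^ 2 + c * |v| ^ (2 * H₂ / H₁)) ^ (H₁ / 2) := by
    calc c ^ (H₁ / 2) * |v| ^ H₂ = (c * |v| ^ (2 * H₂ / H₁)) ^ (H₁ / 2) := by
          rw [Real.mul_rpow hc.le (by positivity), ← Real.rpow_mul hv'.le]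
          congr 2
          field_simp
      _ ≤ _ := Real.rpow_le_rpow (by positivity) (le_add_of_nonneg_left (by positivity))
          (by positivity)
  rw [hDensity, neg_div, Real.rpow_neg hc.le, Real.rpow_neg hv'.le, ← mul_inv, ← one_div]
  exact one_div_le_one_div_of_le (by positivity) h1

/-- Integration of `h` in its first variable. -/
lemma integral_hDensity_left (hc : 0 < c) (hH₁ : 1 < H₁) {v : ℝ} (hv : v ≠ 0) :
    Integrable (fun u => hDensity H₁ H₂ c u v) ∧
    ∫ u, hDensity H₁ H₂ c u v =
      rho₁ H₁ ^ 2 * c ^ ((1 - H₁) / 2) * |v| ^ (-((H₁ * H₂ - H₂) / H₁)) := by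
  have hv' := abs_pos.2 hv
  have hA : 0 < c * |v| ^ (2 * H₂ / H₁) := by positivity
  have h := integral_add_mul_abs_rpow (q := 2) (r := H₁ / 2) hA one_pos two_pos (by linarith)
  have e : ∀ u, hDensity H₁ H₂ c u v =
      (c * |v| ^ (2 * H₂ / H₁) + 1 * |u| ^ (2 : ℝ)) ^ (-(H₁ / 2)) := by
    intro u
    rw [hDensity_eq_rpow hc, one_mul, add_comm, Real.rpow_two]
  simp_rw [e]
  refine ⟨h.1, ?_⟩
  rw [h.2, rho₁, Real.sq_sqrt (beta_pos (by norm_num) (by linarith)).le, Real.one_rpow,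
    Real.mul_rpow hc.le (by positivity), ← Real.rpow_mul hv'.le,
    show H₁ / 2 - 1 / 2 = (H₁ - 1) / 2 by ring, show 1 / 2 - H₁ / 2 = (1 - H₁) / 2 by ring]
  have : 2 * H₂ / H₁ * ((1 - H₁) / 2) = -((H₁ * H₂ - H₂) / H₁) := by
    field_simp
    ring
  rw [this]
  ring

/-- Integration of `h` in its second variable. -/
lemma integral_hDensity_right (hc : 0 < c) (hH₁ : 0 < H₁) (hH₂ : 1 < H₂) {u : ℝ} (hu : u ≠ 0) :
    Integrable (fun v => hDensity H₁ H₂ c u v) ∧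
    ∫ v, hDensity H₁ H₂ c u v =
      rho₂ H₁ H₂ ^ 2 * c ^ (-H₁ / (2 * H₂)) * |u| ^ (-((H₁ * H₂ - H₁) / H₂)) := by
  have hu' := abs_pos.2 hu
  have hA : 0 < |u| ^ 2 := by positivity
  have hH₂0 : 0 < H₂ := by linarith
  have e0 : 1 / (2 * H₂ / H₁) = H₁ / (2 * H₂) := by field_simp
  have e1 : H₁ / 2 - H₁ / (2 * H₂) = (H₁ * H₂ - H₁) / (2 * H₂) := by field_simp
  have hp : 0 < H₁ * H₂ - H₁ := by nlinarith
  have h := integral_add_mul_abs_rpow (q := 2 * H₂ / H₁) (r := H₁ / 2) hA hc (by positivity)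
    (by rw [e0, ← sub_pos, e1]; positivity)
  simp_rw [hDensity_eq_rpow hc]
  refine ⟨h.1, ?_⟩
  have hβ : 0 < H₁ / H₂ * beta (H₁ / (2 * H₂)) ((H₁ * H₂ - H₁) / (2 * H₂)) :=
    mul_pos (by positivity) (beta_pos (by positivity) (by positivity))
  rw [h.2, e0, e1, rho₂, Real.sq_sqrt hβ.le,
    ← Real.rpow_natCast, ← Real.rpow_mul hu'.le]
  have e2 : ((2 : ℕ) : ℝ) * (H₁ / (2 * H₂) - H₁ / 2) = -((H₁ * H₂ - H₁) / H₂) := by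
    push_cast
    field_simp
    ring
  have e3 : 2 / (2 * H₂ / H₁) = H₁ / H₂ := by field_simp
  rw [e2, e3, neg_div]
  ring

/-- A weight that is integrable against `((1 + u²)(1 + v²))⁻¹`. -/
def IsWeight (w : ℝ × ℝ → ℝ) : Prop :=
  Measurable w ∧ (∀ p, 0 ≤ w p) ∧
    Integrable (fun p : ℝ × ℝ => (1 + p.1 ^ 2)⁻¹ * (1 + p.2 ^ 2)⁻¹ * w p)

/-- No decay in u is required: for H₁ > 1 the density is itself integrable in u and leaves |v| to
the power -(H₁H₂ - H₂)/H₁, where (H₁H₂ - H₂)/H₁ < 1 means exactly H₁H₂ < H₁ + H₂. -/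
lemma integrable_hDensity_of_left (hc : 0 < c) (hH₁ : 1 < H₁) (hH : H₁ ≤ H₂)
    (hHH : H₁ * H₂ < H₁ + H₂) :
    Integrable (fun p : ℝ × ℝ => (1 + p.2 ^ 2)⁻¹ * hDensity H₁ H₂ c p.1 p.2) := by
  have h0 : ∀ᵐ v : ℝ, v ≠ 0 := by simp [ae_iff, measure_singleton]
  have hm : Measurable (fun p : ℝ × ℝ => (1 + p.2 ^ 2)⁻¹ * hDensity H₁ H₂ c p.1 p.2) :=
    Measurable.mul (by fun_prop) measurable_hDensity
  rw [Measure.volume_eq_prod, integrable_prod_iff' hm.aestronglyMeasurable]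
  constructor
  · filter_upwards [h0] with v hv
    exact (integral_hDensity_left hc hH₁ hv).1.const_mul _
  · have hα : 0 ≤ (H₁ * H₂ - H₂) / H₁ := div_nonneg (by nlinarith) (by linarith)
    have hα' : (H₁ * H₂ - H₂) / H₁ < 1 := by rw [div_lt_one (by linarith)]; linarith
    refine ((integrable_japanese_mul_rpow hα hα').const_mul
      (rho₁ H₁ ^ 2 * c ^ ((1 - H₁) / 2))).congr ?_
    filter_upwards [h0] with v hv
    have e : ∀ u : ℝ, ‖(1 + v ^ 2)⁻¹ * hDensity H₁ H₂ c u v‖ =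
        (1 + v ^ 2)⁻¹ * hDensity H₁ H₂ c u v := fun u =>
      Real.norm_of_nonneg (mul_nonneg (by positivity) (hDensity_nonneg hc _ _))
    simp_rw [e]
    rw [integral_const_mul, (integral_hDensity_left hc hH₁ hv).2]
    ring

lemma integrable_hDensity_of_right (hc : 0 < c) (hH₁ : 0 < H₁) (hH₂ : 1 < H₂)
    (hHH : H₁ * H₂ < H₁ + H₂) :
    Integrable (fun p : ℝ × ℝ => (1 + p.1 ^ 2)⁻¹ * hDensity H₁ H₂ c p.1 p.2) := by
  have h0 : ∀ᵐ v : ℝ, v ≠ 0 := by simp [ae_iff, measure_singleton]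
  have hm : Measurable (fun p : ℝ × ℝ => (1 + p.1 ^ 2)⁻¹ * hDensity H₁ H₂ c p.1 p.2) :=
    Measurable.mul (by fun_prop) measurable_hDensity
  rw [Measure.volume_eq_prod, integrable_prod_iff hm.aestronglyMeasurable]
  constructor
  · filter_upwards [h0] with u hu
    exact (integral_hDensity_right hc hH₁ hH₂ hu).1.const_mul _
  · have hα : 0 ≤ (H₁ * H₂ - H₁) / H₂ := div_nonneg (by nlinarith) (by linarith)
    have hα' : (H₁ * H₂ - H₁) / H₂ < 1 := by rw [div_lt_one (by linarith)]; linarith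
    refine ((integrable_japanese_mul_rpow hα hα').const_mul
      (rho₂ H₁ H₂ ^ 2 * c ^ (-H₁ / (2 * H₂)))).congr ?_
    filter_upwards [h0] with u hu
    have e : ∀ v : ℝ, ‖(1 + u ^ 2)⁻¹ * hDensity H₁ H₂ c u v‖ =
        (1 + u ^ 2)⁻¹ * hDensity H₁ H₂ c u v := fun v =>
      Real.norm_of_nonneg (mul_nonneg (by positivity) (hDensity_nonneg hc _ _))
    simp_rw [e]
    rw [integral_const_mul, (integral_hDensity_right hc hH₁ hH₂ hu).2]
    ring

lemma isWeight_left {α : ℝ} (h0 : 0 ≤ α) (h1 : α < 1) :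
    IsWeight (fun p : ℝ × ℝ => |p.1| ^ (-α)) := by
  refine ⟨by fun_prop, fun p => by positivity, ?_⟩
  refine ((integrable_japanese_mul_rpow h0 h1).mul_prod integrable_inv_one_add_sq).congr
    (Eventually.of_forall fun p => ?_)
  simp only
  ring

lemma isWeight_right {α : ℝ} (h0 : 0 ≤ α) (h1 : α < 1) :
    IsWeight (fun p : ℝ × ℝ => |p.2| ^ (-α)) := by
  refine ⟨by fun_prop, fun p => by positivity, ?_⟩
  refine (integrable_inv_one_add_sq.mul_prod (integrable_japanese_mul_rpow h0 h1)).congr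
    (Eventually.of_forall fun p => ?_)
  simp only
  ring

lemma ae_fst_ne_zero : ∀ᵐ p : ℝ × ℝ, p.1 ≠ 0 := by
  have h0 : ∀ᵐ v : ℝ, v ≠ 0 := by simp [ae_iff, measure_singleton]
  exact Measure.quasiMeasurePreserving_fst.ae h0

lemma ae_snd_ne_zero : ∀ᵐ p : ℝ × ℝ, p.2 ≠ 0 := by
  have h0 : ∀ᵐ v : ℝ, v ≠ 0 := by simp [ae_iff, measure_singleton]
  exact Measure.quasiMeasurePreserving_snd.ae h0

/-- For H₁ < 1 the majorant |u|^(-H₁) suffices. For H₁ > 1 it is not integrable at u = 0, and h has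
to be integrated over u before anything is discarded. -/
lemma isWeight_hDensity (hc : 0 < c) (hH₁ : 0 < H₁) (hH : H₁ ≤ H₂) (hH₁_ne : H₁ ≠ 1)
    (hHH : H₁ * H₂ < H₁ + H₂) : IsWeight (fun p : ℝ × ℝ => hDensity H₁ H₂ c p.1 p.2) := by
  have hm : Measurable (fun p : ℝ × ℝ => (1 + p.1 ^ 2)⁻¹ * (1 + p.2 ^ 2)⁻¹ *
    hDensity H₁ H₂ c p.1 p.2) := Measurable.mul (by fun_prop) measurable_hDensity
  refine ⟨measurable_hDensity, fun p => hDensity_nonneg hc _ _, ?_⟩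
  rcases lt_or_gt_of_ne hH₁_ne with h | h
  · refine (isWeight_left hH₁.le h).2.2.mono' hm.aestronglyMeasurable ?_
    filter_upwards [ae_fst_ne_zero] with p hp
    have h3 := hDensity_nonneg (H₁ := H₁) (H₂ := H₂) hc p.1 p.2
    rw [Real.norm_of_nonneg (by positivity)]
    exact mul_le_mul_of_nonneg_left (hDensity_le_left hc hH₁ hp _) (by positivity)
  · refine (integrable_hDensity_of_left hc h hH hHH).mono' hm.aestronglyMeasurable ?_
    refine Eventually.of_forall fun p => ?_
    have h3 := hDensity_nonneg (H₁ := H₁) (H₂ := H₂) hc p.1 p.2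
    rw [Real.norm_of_nonneg (by positivity)]
    refine mul_le_mul_of_nonneg_right ?_ h3
    exact mul_le_of_le_one_left (by positivity) (inv_le_one_of_one_le₀ (by nlinarith [sq_nonneg p.1]))

end Weights

/-! ### The kernel k_x and its products -/

section Kernel

/-- At u = 0 both sides are 0 by the convention for division by zero, not the limit -x; only a null
set is affected. -/
lemma incKernel_eq (x u : ℝ) :
    incKernel x u = ⟨-Real.sin (x * u) / u, -(1 - Real.cos (x * u)) / u⟩ := by
  have h : Complex.exp (Complex.I * (u : ℂ) * (x : ℂ)) =
      ⟨Real.cos (x * u), Real.sin (x * u)⟩ := by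
    rw [show Complex.I * (u : ℂ) * (x : ℂ) = ((x * u : ℝ) : ℂ) * Complex.I by push_cast; ring]
    exact Complex.ext (Complex.exp_ofReal_mul_I_re _) (Complex.exp_ofReal_mul_I_im _)
  rw [incKernel, h]
  rcases eq_or_ne u 0 with rfl | hu
  · apply Complex.ext <;> simp
  · rw [div_eq_iff (mul_ne_zero Complex.I_ne_zero (Complex.ofReal_ne_zero.2 hu))]
    apply Complex.ext <;> simp <;> field_simp <;> ring

lemma measurable_incKernel (x : ℝ) : Measurable (incKernel x) := by
  unfold incKernel
  fun_prop

lemma incKernel_neg (x u : ℝ) : incKernel x (-u) = starRingEnd ℂ (incKernel x u) := by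
  rw [incKernel_eq, incKernel_eq]
  apply Complex.ext <;> simp [div_neg, neg_div]

/-- The squared modulus `|k_x(u)|²`. -/
noncomputable def incSq (x u : ℝ) : ℝ := (2 - 2 * Real.cos (x * u)) / u ^ 2

lemma measurable_incSq (x : ℝ) : Measurable (incSq x) := by
  unfold incSq
  fun_prop

lemma incSq_nonneg (x u : ℝ) : 0 ≤ incSq x u :=
  div_nonneg (by linarith [Real.cos_le_one (x * u)]) (sq_nonneg u)

@[simp]
lemma incSq_neg_left (x u : ℝ) : incSq (-x) u = incSq x u := by simp [incSq]

@[simp]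
lemma incSq_zero (u : ℝ) : incSq 0 u = 0 := by simp [incSq]

/-- Sum of the low-frequency bound |k_x|² ≤ x² and the high-frequency bound u²|k_x|² ≤ 4. -/
lemma incSq_le (x u : ℝ) : incSq x u ≤ (x ^ 2 + 4) * (1 + u ^ 2)⁻¹ := by
  rw [← div_eq_mul_inv, le_div_iff₀ (by positivity)]
  rcases eq_or_ne u 0 with rfl | hu
  · simp [incSq]
    positivity
  · have hu2 : 0 < u ^ 2 := by positivity
    rw [incSq, div_mul_eq_mul_div, div_le_iff₀ hu2]
    nlinarith [Real.one_sub_sq_div_two_le_cos (x := x * u), Real.neg_one_le_cos (x * u), hu2]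

lemma incSq_pos {x u : ℝ} (hu : 0 < u) (hx : 0 < x) (hux : u * x < 2 * Real.pi) :
    0 < incSq x u := by
  refine div_pos ?_ (by positivity)
  have h : Real.cos (x * u) ≠ 1 := by
    intro h
    have := (Real.cos_eq_one_iff_of_lt_of_lt (by nlinarith [Real.pi_pos, mul_pos hx hu])
      (by linarith)).1 h
    exact (mul_pos hx hu).ne' this
  have := lt_of_le_of_ne (Real.cos_le_one (x * u)) h
  linarith

/-- Scaling of the squared kernel. -/
lemma incSq_mul {a : ℝ} (ha : a ≠ 0) (x u : ℝ) : incSq (a * x) u = a ^ 2 * incSq x (a * u) := by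
  rcases eq_or_ne u 0 with rfl | hu
  · simp [incSq]
  · rw [incSq, incSq]
    field_simp

/-- The product `k_x(u) conj k_{x'}(u)`. -/
noncomputable def incCross (x x' u : ℝ) : ℂ := incKernel x u * starRingEnd ℂ (incKernel x' u)

/-- The real part of `k_x(u) conj k_{x'}(u)`. -/
noncomputable def incRe (x x' u : ℝ) : ℝ := 2⁻¹ * (incSq x u + incSq x' u - incSq (x - x') u)

/-- Polarization, since |k_x - k_{x'}| = |k_{x-x'}|. This gives every limit covariance the form
½(σ(x) + σ(x') - σ(x - x')) in each coordinate. -/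
lemma re_incCross (x x' u : ℝ) : (incCross x x' u).re = incRe x x' u := by
  rw [incCross, incKernel_eq, incKernel_eq, incRe, incSq, incSq, incSq, sub_mul, Real.cos_sub]
  rcases eq_or_ne u 0 with rfl | hu
  · simp
  · simp
    field_simp
    ring

lemma norm_incKernel_sq (x u : ℝ) : ‖incKernel x u‖ ^ 2 = incSq x u := by
  have h := re_incCross x x u
  rw [incCross, Complex.mul_conj, Complex.ofReal_re, Complex.normSq_eq_norm_sq] at h
  rw [h, incRe]
  simp
  ring

lemma incCross_neg (x x' u : ℝ) : incCross x x' (-u) = starRingEnd ℂ (incCross x x' u) := by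
  simp [incCross, incKernel_neg]

lemma measurable_incCross (x x' : ℝ) : Measurable (incCross x x') :=
  (measurable_incKernel x).mul (Complex.continuous_conj.measurable.comp (measurable_incKernel x'))

lemma norm_incCross_le (x x' u : ℝ) :
    ‖incCross x x' u‖ ≤ (x ^ 2 + x' ^ 2 + 4) * (1 + u ^ 2)⁻¹ := by
  rw [incCross, norm_mul, RCLike.norm_conj]
  have h1 := incSq_le x u
  have h2 := incSq_le x' u
  rw [← norm_incKernel_sq] at h1 h2
  have h3 : 0 ≤ (1 + u ^ 2)⁻¹ := by positivity
  nlinarith [sq_nonneg (‖incKernel x u‖ - ‖incKernel x' u‖), mul_nonneg (sq_nonneg x) h3,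
    mul_nonneg (sq_nonneg x') h3]

lemma measurable_incRe (x x' : ℝ) : Measurable (incRe x x') := by
  unfold incRe
  have := measurable_incSq
  fun_prop

lemma abs_incRe_le (x x' u : ℝ) : |incRe x x' u| ≤ (x ^ 2 + x' ^ 2 + 4) * (1 + u ^ 2)⁻¹ := by
  rw [← re_incCross]
  exact (Complex.abs_re_le_norm _).trans (norm_incCross_le x x' u)

end Kernel

/-! ### Dirichlet sums and their two scaling limits -/

section Dirichlet

/-- The sum `∑_{t=1}^m e^{itθ}`. -/
noncomputable def dirichlet (m : ℤ) (θ : ℝ) : ℂ :=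
  ∑ t ∈ Finset.Icc (1 : ℤ) m, Complex.exp (Complex.I * ((t * θ : ℝ) : ℂ))

lemma continuous_dirichlet (m : ℤ) : Continuous (dirichlet m) := by
  unfold dirichlet
  fun_prop

lemma norm_dirichlet_le {m : ℤ} (hm : 0 ≤ m) (θ : ℝ) : ‖dirichlet m θ‖ ≤ m := by
  refine (norm_sum_le _ _).trans ?_
  simp_rw [Complex.norm_exp_I_mul_ofReal]
  have : ((m.toNat : ℤ) : ℝ) = m := by rw [Int.toNat_of_nonneg hm]
  simp only [Finset.sum_const, Int.card_Icc, add_sub_cancel_right, nsmul_eq_mul, mul_one]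
  rw [← this]
  exact le_rfl

/-- Telescoping of the geometric sum. -/
lemma mul_dirichlet {m : ℤ} (hm : 0 ≤ m) (θ : ℝ) :
    (Complex.exp (Complex.I * θ) - 1) * dirichlet m θ =
      Complex.exp (Complex.I * θ) * (Complex.exp (Complex.I * ((m * θ : ℝ) : ℂ)) - 1) := by
  lift m to ℕ using hm
  induction m with
  | zero => simp [dirichlet]
  | succ k ih =>
    have h1 : Finset.Icc (1 : ℤ) ((k + 1 : ℕ) : ℤ) =
        insert ((k + 1 : ℕ) : ℤ) (Finset.Icc (1 : ℤ) (k : ℤ)) := by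
      ext t
      simp only [Finset.mem_Icc, Finset.mem_insert]
      push_cast
      omega
    have h2 : dirichlet ((k + 1 : ℕ) : ℤ) θ =
        Complex.exp (Complex.I * ((((k + 1 : ℕ) : ℤ) * θ : ℝ) : ℂ)) + dirichlet (k : ℤ) θ := by
      rw [dirichlet, h1, Finset.sum_insert (by simp), dirichlet]
    have h3 : Complex.exp (Complex.I * ((((k + 1 : ℕ) : ℤ) * θ : ℝ) : ℂ)) =
        Complex.exp (Complex.I * θ) * Complex.exp (Complex.I * ((((k : ℕ) : ℤ) * θ : ℝ) : ℂ)) := by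
      rw [← Complex.exp_add]
      congr 1
      push_cast
      ring
    rw [h2, mul_add, ih, h3]
    ring

/-- Jordan's inequality gives |e^{iθ} - 1| ≥ 2|θ|/π on [-π, π], and the numerator of the geometric
sum is at most 2. -/
lemma norm_dirichlet_le_div {m : ℤ} (hm : 0 ≤ m) {θ : ℝ} (hθ : θ ≠ 0) (hπ : |θ| ≤ Real.pi) :
    ‖dirichlet m θ‖ ≤ Real.pi / |θ| := by
  have h0 : 0 < |θ| := abs_pos.2 hθ
  have h1 : 2 / Real.pi * |θ| ≤ ‖Complex.exp (Complex.I * θ) - 1‖ := by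
    rw [Complex.norm_exp_I_mul_ofReal_sub_one, Real.norm_eq_abs, abs_mul, abs_two]
    have h2 := Real.mul_le_sin (x := |θ| / 2) (by positivity) (by linarith)
    have h3 : Real.sin (|θ| / 2) ≤ |Real.sin (θ / 2)| := by
      rcases abs_choice θ with h | h <;> rw [h]
      · exact le_abs_self _
      · rw [neg_div, Real.sin_neg]
        exact neg_le_abs _
    calc 2 / Real.pi * |θ| = 2 * (2 / Real.pi * (|θ| / 2)) := by ring
      _ ≤ _ := by linarith
  have h4 : ‖Complex.exp (Complex.I * θ) - 1‖ * ‖dirichlet m θ‖ ≤ 2 := by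
    rw [← norm_mul, mul_dirichlet hm, norm_mul, Complex.norm_exp_I_mul_ofReal, one_mul]
    refine (norm_sub_le _ _).trans ?_
    rw [Complex.norm_exp_I_mul_ofReal, norm_one]
    norm_num
  rw [le_div_iff₀ h0]
  have h5 : 2 / Real.pi * |θ| * ‖dirichlet m θ‖ ≤ 2 :=
    (mul_le_mul_of_nonneg_right h1 (norm_nonneg _)).trans h4
  have hpi := Real.pi_pos
  rw [div_mul_eq_mul_div, div_mul_eq_mul_div, div_le_iff₀ hpi] at h5
  linarith

/-- Each of the m terms satisfies |e^{itθ} - 1| ≤ t|θ| ≤ m|θ|. -/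
lemma norm_dirichlet_sub_le {m : ℤ} (hm : 0 ≤ m) (θ : ℝ) :
    ‖dirichlet m θ - m‖ ≤ m * (m * |θ|) := by
  have hcard : (((Finset.Icc (1 : ℤ) m).card : ℕ) : ℝ) = m := by
    rw [Int.card_Icc, add_sub_cancel_right]
    exact_mod_cast Int.toNat_of_nonneg hm
  have h1 : dirichlet m θ - m =
      ∑ t ∈ Finset.Icc (1 : ℤ) m, (Complex.exp (Complex.I * ((t * θ : ℝ) : ℂ)) - 1) := by
    rw [Finset.sum_sub_distrib, dirichlet, Finset.sum_const, nsmul_eq_mul, mul_one]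
    congr 1
    exact_mod_cast hcard.symm
  rw [h1]
  refine (norm_sum_le _ _).trans ?_
  refine (Finset.sum_le_card_nsmul _ _ (m * |θ|) fun t ht => ?_).trans ?_
  · refine (Real.norm_exp_I_mul_ofReal_sub_one_le).trans ?_
    rw [Finset.mem_Icc] at ht
    have h2 : (1 : ℝ) ≤ t := by exact_mod_cast ht.1
    have h3 : (t : ℝ) ≤ m := by exact_mod_cast ht.2
    rw [Real.norm_eq_abs, abs_mul, abs_of_nonneg (by linarith : (0 : ℝ) ≤ t)]
    exact mul_le_mul_of_nonneg_right h3 (abs_nonneg _)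
  · rw [nsmul_eq_mul, hcard]

lemma tendsto_floor_div {N : ℕ → ℝ} (hN : Tendsto N atTop atTop) (x : ℝ) :
    Tendsto (fun n => (⌊N n * x⌋ : ℝ) / N n) atTop (𝓝 x) := by
  have h1 : Tendsto (fun n => x - (N n)⁻¹) atTop (𝓝 x) := by
    simpa using tendsto_const_nhds.sub (tendsto_inv_atTop_zero.comp hN)
  refine tendsto_of_tendsto_of_tendsto_of_le_of_le' h1 tendsto_const_nhds ?_ ?_
  · filter_upwards [hN.eventually_gt_atTop 0] with n hn
    rw [le_div_iff₀ hn, sub_mul, inv_mul_cancel₀ hn.ne']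
    linarith [Int.lt_floor_add_one (N n * x)]
  · filter_upwards [hN.eventually_gt_atTop 0] with n hn
    rw [div_le_iff₀ hn]
    linarith [Int.floor_le (N n * x)]

/-- Convergence of the normalized Dirichlet sums to the kernel. -/
lemma tendsto_dirichlet_kernel {N : ℕ → ℝ} (hN : Tendsto N atTop atTop) {x u : ℝ} (hx : 0 < x)
    (hu : u ≠ 0) :
    Tendsto (fun n => ((N n : ℝ) : ℂ)⁻¹ * dirichlet ⌊N n * x⌋ (u / N n)) atTop
      (𝓝 (-incKernel x u)) := by
  have hθ : Tendsto (fun n => u / N n) atTop (𝓝 0) := tendsto_const_nhds.div_atTop hN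
  have hIu : Complex.I * (u : ℂ) ≠ 0 :=
    mul_ne_zero Complex.I_ne_zero (Complex.ofReal_ne_zero.2 hu)
  -- N(e^{iu/N} - 1) → iu is the derivative of z ↦ e^{iz} at 0.
  have hden : Tendsto (fun n => (N n : ℂ) * (Complex.exp (Complex.I * ((u / N n : ℝ) : ℂ)) - 1))
      atTop (𝓝 (Complex.I * u)) := by
    have hd : HasDerivAt (fun z : ℂ => Complex.exp (Complex.I * z)) Complex.I 0 := by
      simpa using ((hasDerivAt_id (0 : ℂ)).const_mul Complex.I).cexp
    have hd' := hd.tendsto_slope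
    have hθ' : Tendsto (fun n => ((u / N n : ℝ) : ℂ)) atTop (𝓝[≠] 0) := by
      refine tendsto_nhdsWithin_iff.2 ⟨?_, ?_⟩
      · have h0 := (Complex.continuous_ofReal.tendsto 0).comp hθ
        rw [Complex.ofReal_zero] at h0
        exact h0
      · filter_upwards [hN.eventually_gt_atTop 0] with n hn
        simpa using ⟨hu, hn.ne'⟩
    refine ((hd'.comp hθ').mul_const (u : ℂ)).congr' ?_
    filter_upwards [hN.eventually_gt_atTop 0] with n hn
    have hn' : (N n : ℂ) ≠ 0 := Complex.ofReal_ne_zero.2 hn.ne'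
    have hu' : (u : ℂ) ≠ 0 := Complex.ofReal_ne_zero.2 hu
    simp only [Function.comp_apply, slope_def_field, sub_zero, mul_zero, Complex.exp_zero]
    push_cast
    field_simp
  have hnum : Tendsto (fun n => Complex.exp (Complex.I * ((u / N n : ℝ) : ℂ)) *
      (Complex.exp (Complex.I * ((⌊N n * x⌋ * (u / N n) : ℝ) : ℂ)) - 1)) atTop
      (𝓝 (1 * (Complex.exp (Complex.I * ((x * u : ℝ) : ℂ)) - 1))) := by
    refine Tendsto.mul ?_ (Tendsto.sub ?_ tendsto_const_nhds)
    · have : Tendsto (fun n => Complex.exp (Complex.I * ((u / N n : ℝ) : ℂ))) atTop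
          (𝓝 (Complex.exp (Complex.I * ((0 : ℝ) : ℂ)))) :=
        ((by fun_prop : Continuous fun t : ℝ => Complex.exp (Complex.I * (t : ℂ))).tendsto 0).comp hθ
      simpa using this
    · refine ((by fun_prop : Continuous fun t : ℝ => Complex.exp (Complex.I * (t : ℂ))).tendsto
        (x * u)).comp ?_
      refine ((tendsto_floor_div hN x).mul_const u).congr fun n => ?_
      ring
  have hlim := hnum.div hden hIu
  have hval : 1 * (Complex.exp (Complex.I * ((x * u : ℝ) : ℂ)) - 1) / (Complex.I * u) =
      -incKernel x u := by
    rw [incKernel, one_mul, ← neg_div, neg_sub]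
    congr 3
    push_cast
    ring
  rw [hval] at hlim
  refine hlim.congr' ?_
  filter_upwards [hN.eventually_gt_atTop 0, hden.eventually_ne hIu] with n hn hne
  have hm : 0 ≤ ⌊N n * x⌋ := Int.floor_nonneg.2 (by positivity)
  rw [Pi.div_apply, ← mul_dirichlet hm]
  have h1 := (mul_ne_zero_iff.1 hne)
  have h2 := h1.1
  have h3 := h1.2
  field_simp

/-- Convergence of the normalized Dirichlet sums at low frequencies. -/
lemma tendsto_dirichlet_low {N θ : ℕ → ℝ} (hN : Tendsto N atTop atTop)
    (hθ : Tendsto (fun n => N n * θ n) atTop (𝓝 0)) {x : ℝ} (hx : 0 < x) :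
    Tendsto (fun n => ((N n : ℝ) : ℂ)⁻¹ * dirichlet ⌊N n * x⌋ (θ n)) atTop (𝓝 (x : ℂ)) := by
  have h1 : Tendsto (fun n => ((N n : ℝ) : ℂ)⁻¹ * (⌊N n * x⌋ : ℂ)) atTop (𝓝 (x : ℂ)) := by
    refine ((Complex.continuous_ofReal.tendsto x).comp (tendsto_floor_div hN x)).congr fun n => ?_
    simp [div_eq_inv_mul]
  have h2 : Tendsto (fun n => ((N n : ℝ) : ℂ)⁻¹ * (dirichlet ⌊N n * x⌋ (θ n) - (⌊N n * x⌋ : ℂ)))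
      atTop (𝓝 0) := by
    have h3 : Tendsto (fun n => x ^ 2 * |N n * θ n|) atTop (𝓝 0) := by
      simpa using hθ.abs.const_mul (x ^ 2)
    refine squeeze_zero_norm' ?_ h3
    filter_upwards [hN.eventually_gt_atTop 0] with n hn
    have hm : 0 ≤ ⌊N n * x⌋ := Int.floor_nonneg.2 (by positivity)
    have hm' : (0 : ℝ) ≤ ⌊N n * x⌋ := by exact_mod_cast hm
    have hfl : (⌊N n * x⌋ : ℝ) ≤ N n * x := Int.floor_le _
    rw [norm_mul, norm_inv, Complex.norm_real, Real.norm_of_nonneg hn.le]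
    calc (N n)⁻¹ * ‖dirichlet ⌊N n * x⌋ (θ n) - (⌊N n * x⌋ : ℂ)‖
        ≤ (N n)⁻¹ * ((N n * x) * ((N n * x) * |θ n|)) := by
          refine mul_le_mul_of_nonneg_left ((norm_dirichlet_sub_le hm _).trans ?_) (by positivity)
          gcongr
      _ = x ^ 2 * |N n * θ n| := by
          rw [abs_mul, abs_of_pos hn]
          field_simp
  have := h1.add h2
  rw [add_zero] at this
  refine this.congr fun n => ?_
  ring

/-- The normalized product of two Dirichlet sums. -/
noncomputable def dirichletCross (N x x' θ : ℝ) : ℂ :=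
  ((N : ℂ)⁻¹ * dirichlet ⌊N * x⌋ θ) * starRingEnd ℂ ((N : ℂ)⁻¹ * dirichlet ⌊N * x'⌋ θ)

lemma continuous_dirichletCross (N x x' : ℝ) : Continuous (dirichletCross N x x') := by
  unfold dirichletCross
  have := continuous_dirichlet
  fun_prop

lemma norm_dirichlet_normalized_le {N x : ℝ} (hN : 0 < N) (hx : 0 < x) (θ : ℝ) :
    ‖(N : ℂ)⁻¹ * dirichlet ⌊N * x⌋ θ‖ ≤ x := by
  have hm : 0 ≤ ⌊N * x⌋ := Int.floor_nonneg.2 (by positivity)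
  rw [norm_mul, norm_inv, Complex.norm_real, Real.norm_of_nonneg hN.le, inv_mul_le_iff₀ hN]
  exact (norm_dirichlet_le hm θ).trans (Int.floor_le _)

lemma norm_dirichletCross_le {N x x' : ℝ} (hN : 0 < N) (hx : 0 < x) (hx' : 0 < x') (θ : ℝ) :
    ‖dirichletCross N x x' θ‖ ≤ x * x' := by
  rw [dirichletCross, norm_mul, RCLike.norm_conj]
  exact mul_le_mul (norm_dirichlet_normalized_le hN hx θ) (norm_dirichlet_normalized_le hN hx' θ)
    (norm_nonneg _) hx.le

/-- The trivial bound xx' handles small u and the bound π/|θ| large u. The majorant is free of N,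
and the restriction on u is precisely that the rescaled frequency stays in [-π, π]. -/
lemma norm_dirichletCross_le_japanese {N x x' u : ℝ} (hN : 0 < N) (hx : 0 < x) (hx' : 0 < x')
    (hu : |u / N| ≤ Real.pi) :
    ‖dirichletCross N x x' (u / N)‖ ≤ (x * x' + Real.pi ^ 2) * (1 + u ^ 2)⁻¹ := by
  rw [← div_eq_mul_inv, le_div_iff₀ (by positivity), mul_add, mul_one]
  refine add_le_add (norm_dirichletCross_le hN hx hx' _) ?_
  rcases eq_or_ne u 0 with rfl | hu0
  · simp
    positivity
  · have hb : ∀ y : ℝ, 0 < y → ‖(N : ℂ)⁻¹ * dirichlet ⌊N * y⌋ (u / N)‖ ≤ Real.pi / |u| := by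
      intro y hy
      have hm : 0 ≤ ⌊N * y⌋ := Int.floor_nonneg.2 (by positivity)
      rw [norm_mul, norm_inv, Complex.norm_real, Real.norm_of_nonneg hN.le, inv_mul_le_iff₀ hN]
      refine (norm_dirichlet_le_div hm (by positivity) hu).trans (le_of_eq ?_)
      rw [abs_div, abs_of_pos hN]
      field_simp
    have hu1 : 0 < |u| := abs_pos.2 hu0
    rw [dirichletCross, norm_mul, RCLike.norm_conj]
    calc _ ≤ Real.pi / |u| * (Real.pi / |u|) * u ^ 2 := by
          gcongr
          · exact hb x hx
          · exact hb x' hx'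
      _ = Real.pi ^ 2 := by
          rw [← sq_abs u]
          field_simp

/-- The normalized sums tend to -k_x and -k_{x'}; the signs cancel in the product. -/
lemma tendsto_dirichletCross_kernel {N : ℕ → ℝ} (hN : Tendsto N atTop atTop) {x x' u : ℝ}
    (hx : 0 < x) (hx' : 0 < x') (hu : u ≠ 0) :
    Tendsto (fun n => dirichletCross (N n) x x' (u / N n)) atTop (𝓝 (incCross x x' u)) := by
  have := (tendsto_dirichlet_kernel hN hx hu).mul
    ((Complex.continuous_conj.tendsto _).comp (tendsto_dirichlet_kernel hN hx' hu))
  rw [map_neg, neg_mul_neg] at this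
  exact this

lemma tendsto_dirichletCross_low {N θ : ℕ → ℝ} (hN : Tendsto N atTop atTop)
    (hθ : Tendsto (fun n => N n * θ n) atTop (𝓝 0)) {x x' : ℝ} (hx : 0 < x) (hx' : 0 < x') :
    Tendsto (fun n => dirichletCross (N n) x x' (θ n)) atTop (𝓝 ((x * x' : ℝ) : ℂ)) := by
  have := (tendsto_dirichlet_low hN hθ hx).mul
    ((Complex.continuous_conj.tendsto _).comp (tendsto_dirichlet_low hN hθ hx'))
  rw [Complex.conj_ofReal, ← Complex.ofReal_mul] at this
  exact this

end Dirichlet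

/-! ### Change of scale and homogeneity of h -/

section Rescaling

lemma map_div_volume {a b : ℝ} (ha : 0 < a) (hb : 0 < b) :
    Measure.map (fun p : ℝ × ℝ => (p.1 / a, p.2 / b)) volume =
      ENNReal.ofReal (a * b) • (volume : Measure (ℝ × ℝ)) := by
  have h := Measure.map_prod_map (volume : Measure ℝ) (volume : Measure ℝ)
    (f := fun u : ℝ => a⁻¹ * u) (g := fun v : ℝ => b⁻¹ * v) (by fun_prop) (by fun_prop)
  have e : (fun p : ℝ × ℝ => (p.1 / a, p.2 / b)) =
      Prod.map (fun u : ℝ => a⁻¹ * u) (fun v : ℝ => b⁻¹ * v) := by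
    ext p <;> simp [div_eq_inv_mul]
  rw [e, Measure.volume_eq_prod, ← h, Real.map_volume_mul_left (by positivity),
    Real.map_volume_mul_left (by positivity), Measure.prod_smul_left, Measure.prod_smul_right,
    smul_smul, inv_inv, inv_inv, abs_of_pos ha, abs_of_pos hb, ENNReal.ofReal_mul ha.le]

lemma measurableEmbedding_div {a b : ℝ} (ha : 0 < a) (hb : 0 < b) :
    MeasurableEmbedding (fun p : ℝ × ℝ => (p.1 / a, p.2 / b)) := by
  have e : (fun p : ℝ × ℝ => (p.1 / a, p.2 / b)) =
      ((Homeomorph.mulRight₀ a⁻¹ (by positivity)).prodCongr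
        (Homeomorph.mulRight₀ b⁻¹ (by positivity))) := by
    ext p <;> simp [div_eq_mul_inv]
  rw [e]
  exact Homeomorph.measurableEmbedding _

lemma integral_comp_div {G : Type*} [NormedAddCommGroup G] [NormedSpace ℝ G] {a b : ℝ}
    (ha : 0 < a) (hb : 0 < b) (F : ℝ × ℝ → G) :
    ∫ p : ℝ × ℝ, F p = (a * b)⁻¹ • ∫ p : ℝ × ℝ, F (p.1 / a, p.2 / b) := by
  have h := (measurableEmbedding_div ha hb).integral_map (μ := volume) F
  rw [← h, map_div_volume ha hb, integral_smul_measure,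
    ENNReal.toReal_ofReal (by positivity), smul_smul, inv_mul_cancel₀ (by positivity), one_smul]

lemma aestronglyMeasurable_comp_div {G : Type*} [TopologicalSpace G] {a b : ℝ}
    (ha : 0 < a) (hb : 0 < b) {F : ℝ × ℝ → G} (hF : AEStronglyMeasurable F) :
    AEStronglyMeasurable (fun p : ℝ × ℝ => F (p.1 / a, p.2 / b)) := by
  refine hF.comp_quasiMeasurePreserving (f := fun p : ℝ × ℝ => (p.1 / a, p.2 / b)) ⟨by fun_prop, ?_⟩
  rw [map_div_volume ha hb]
  exact Measure.smul_absolutelyContinuous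

variable {H₁ H₂ c : ℝ}

/-- Homogeneity of `h`. -/
lemma hDensity_scale (hH₁ : 0 < H₁) (hH₂ : 0 < H₂) (hc : 0 < c) {t : ℝ} (ht : 0 < t) (u v : ℝ) :
    hDensity H₁ H₂ c (u / t) (v / t ^ (H₁ / H₂)) = t ^ H₁ * hDensity H₁ H₂ c u v := by
  have e1 : (t ^ (H₁ / H₂)) ^ (2 * H₂ / H₁) = t ^ 2 := by
    rw [← Real.rpow_mul ht.le, ← Real.rpow_natCast]
    congr 1
    push_cast
    field_simp
  have e2 : (t ^ 2) ^ (H₁ / 2) = t ^ H₁ := by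
    rw [← Real.rpow_natCast, ← Real.rpow_mul ht.le]
    congr 1
    push_cast
    ring
  have e3 : |u / t| ^ 2 + c * |v / t ^ (H₁ / H₂)| ^ (2 * H₂ / H₁) =
      (|u| ^ 2 + c * |v| ^ (2 * H₂ / H₁)) / t ^ 2 := by
    rw [abs_div, abs_div, abs_of_pos ht, abs_of_pos (Real.rpow_pos_of_pos ht _), div_pow,
      Real.div_rpow (abs_nonneg _) (by positivity), e1]
    ring
  rw [hDensity, hDensity, e3, Real.div_rpow (by positivity) (by positivity), e2]
  rw [one_div_div, mul_one_div]

lemma continuousAt_hDensity (hH₁ : 0 < H₁) (hH₂ : 0 < H₂) (hc : 0 < c) {p : ℝ × ℝ}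
    (hp : p ≠ 0) : ContinuousAt (fun p : ℝ × ℝ => hDensity H₁ H₂ c p.1 p.2) p := by
  have h1 : Continuous fun p : ℝ × ℝ => |p.1| ^ 2 + c * |p.2| ^ (2 * H₂ / H₁) := by
    refine (by fun_prop : Continuous fun p : ℝ × ℝ => |p.1| ^ 2).add (continuous_const.mul ?_)
    exact (by fun_prop : Continuous fun p : ℝ × ℝ => |p.2|).rpow_const
      fun _ => Or.inr (by positivity)
  have h2 : 0 < |p.1| ^ 2 + c * |p.2| ^ (2 * H₂ / H₁) := by
    rcases eq_or_ne p.1 0 with h | h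
    · have h3 : 0 < |p.2| := abs_pos.2 fun h' => hp (Prod.ext h h')
      positivity
    · have h3 : 0 < |p.1| := abs_pos.2 h
      positivity
  unfold hDensity
  exact continuousAt_const.div (h1.continuousAt.rpow_const (Or.inl h2.ne'))
    (Real.rpow_pos_of_pos h2 _).ne'

/-- The restrictions of h to the axes are the limiting densities of the unbalanced regimes with H₁ <
1 or H₂ < 1. -/
lemma hDensity_zero_right (hH₁ : 0 < H₁) (hH₂ : 0 < H₂) (u : ℝ) :
    hDensity H₁ H₂ c u 0 = |u| ^ (-H₁) := by
  have e : (|u| ^ 2) ^ (H₁ / 2) = |u| ^ H₁ := by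
    rw [← Real.rpow_natCast, ← Real.rpow_mul (abs_nonneg _)]
    congr 1
    push_cast
    ring
  rw [hDensity, abs_zero, Real.zero_rpow (by positivity), mul_zero, add_zero, e,
    Real.rpow_neg (abs_nonneg _), one_div]

lemma hDensity_zero_left (hH₁ : 0 < H₁) (hc : 0 < c) (v : ℝ) :
    hDensity H₁ H₂ c 0 v = c ^ (-H₁ / 2) * |v| ^ (-H₂) := by
  have e : (|v| ^ (2 * H₂ / H₁)) ^ (H₁ / 2) = |v| ^ H₂ := by
    rw [← Real.rpow_mul (abs_nonneg _)]
    congr 1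
    field_simp
  rw [hDensity, abs_zero, zero_pow two_ne_zero, zero_add, Real.mul_rpow hc.le (by positivity), e,
    neg_div, Real.rpow_neg (abs_nonneg _), Real.rpow_neg hc.le, one_div, mul_inv]

end Rescaling

/-! ### Dominated convergence for spectral integrals -/

section SpectralConvergence

variable {H₁ H₂ c : ℝ} {g : ℝ → ℝ → ℝ}

/-- Dominated convergence for rescaled spectral integrals. -/
theorem tendsto_spectral_integral
    (hg_bdd : ∃ M : ℝ, ∀ x ∈ Set.Icc (-Real.pi) Real.pi, ∀ y ∈ Set.Icc (-Real.pi) Real.pi,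
      |g x y| ≤ M)
    (hg_cont : ContinuousAt (fun p : ℝ × ℝ => g p.1 p.2) (0, 0)) (hg_zero : g 0 0 = 1)
    (hint : IntegrableOn (fun p : ℝ × ℝ => g p.1 p.2 * hDensity H₁ H₂ c p.1 p.2) freqSquare)
    {a b σ : ℕ → ℝ} (ha : Tendsto a atTop atTop) (hb : Tendsto b atTop atTop)
    {A B : ℕ → ℝ → ℂ} (hA : ∀ n, Continuous (A n)) (hB : ∀ n, Continuous (B n))
    {h : ℕ → ℝ × ℝ → ℝ} {hlim hbar : ℝ × ℝ → ℝ} {Alim Blim : ℝ → ℂ} {Abar Bbar : ℝ → ℝ}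
    (hscale : ∀ᶠ n in atTop, ∀ u v,
      σ n * (a n * b n)⁻¹ * hDensity H₁ H₂ c (u / a n) (v / b n) = h n (u, v))
    (hAbar : ∀ᶠ n in atTop, ∀ u, |u / a n| ≤ Real.pi → ‖A n (u / a n)‖ ≤ Abar u)
    (hBbar : ∀ᶠ n in atTop, ∀ v, |v / b n| ≤ Real.pi → ‖B n (v / b n)‖ ≤ Bbar v)
    (hAlim : ∀ u, u ≠ 0 → Tendsto (fun n => A n (u / a n)) atTop (𝓝 (Alim u)))
    (hBlim : ∀ v, v ≠ 0 → Tendsto (fun n => B n (v / b n)) atTop (𝓝 (Blim v)))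
    (hhbar : ∀ᶠ n in atTop, ∀ u v, u ≠ 0 → v ≠ 0 → |h n (u, v)| ≤ hbar (u, v))
    (hhlim : ∀ u v, u ≠ 0 → v ≠ 0 → Tendsto (fun n => h n (u, v)) atTop (𝓝 (hlim (u, v))))
    (hbar_nonneg : ∀ p, 0 ≤ hbar p) (hA0 : ∀ u, 0 ≤ Abar u) (hB0 : ∀ v, 0 ≤ Bbar v)
    (hbound : Integrable (fun p : ℝ × ℝ => Abar p.1 * Bbar p.2 * hbar p)) :
    Tendsto (fun n => ((σ n : ℝ) : ℂ) * ∫ p in freqSquare,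
        A n p.1 * B n p.2 * ((g p.1 p.2 * hDensity H₁ H₂ c p.1 p.2 : ℝ) : ℂ)) atTop
      (𝓝 (∫ p : ℝ × ℝ, Alim p.1 * Blim p.2 * ((hlim p : ℝ) : ℂ))) := by
  obtain ⟨M, hM⟩ := hg_bdd
  have hM0 : 0 ≤ M := (abs_nonneg _).trans
    (hM 0 ⟨by linarith [Real.pi_pos], Real.pi_pos.le⟩ 0 ⟨by linarith [Real.pi_pos], Real.pi_pos.le⟩)
  have hsq : MeasurableSet freqSquare := measurableSet_Icc.prod measurableSet_Icc
  -- Extension by zero turns the rescaled integrals over growing squares into integrals over the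
  -- plane. Measurability comes from the integrability of the spectral density, as none is assumed
  -- for g.
  let f : ℝ × ℝ → ℂ := freqSquare.indicator
    fun p => ((g p.1 p.2 * hDensity H₁ H₂ c p.1 p.2 : ℝ) : ℂ)
  have hf : AEStronglyMeasurable f := by
    refine (aestronglyMeasurable_indicator_iff hsq).2 ?_
    exact Complex.continuous_ofReal.comp_aestronglyMeasurable hint.aestronglyMeasurable
  have hmem : ∀ n (p : ℝ × ℝ), (p.1 / a n, p.2 / b n) ∈ freqSquare ↔
      |p.1 / a n| ≤ Real.pi ∧ |p.2 / b n| ≤ Real.pi := by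
    intro n p
    simp only [freqSquare, Set.mem_prod, Set.mem_Icc, abs_le]
  let F : ℕ → ℝ × ℝ → ℂ := fun n p => ((σ n * (a n * b n)⁻¹ : ℝ) : ℂ) *
    (A n (p.1 / a n) * B n (p.2 / b n) * f (p.1 / a n, p.2 / b n))
  have hFeq : ∀ᶠ n in atTop, ((σ n : ℝ) : ℂ) * (∫ p in freqSquare,
      A n p.1 * B n p.2 * ((g p.1 p.2 * hDensity H₁ H₂ c p.1 p.2 : ℝ) : ℂ)) = ∫ p, F n p := by
    filter_upwards [ha.eventually_gt_atTop 0, hb.eventually_gt_atTop 0] with n han hbn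
    rw [← integral_indicator hsq, integral_comp_div han hbn]
    simp only [F]
    rw [integral_const_mul, Complex.ofReal_mul, mul_assoc, Complex.real_smul]
    congr 3
    funext p
    by_cases hp : (p.1 / a n, p.2 / b n) ∈ freqSquare
    · simp [f, hp]
    · simp [f, hp]
  have hFval : ∀ᶠ n in atTop, ∀ p : ℝ × ℝ, (p.1 / a n, p.2 / b n) ∈ freqSquare →
      F n p = A n (p.1 / a n) * B n (p.2 / b n) * ((h n p : ℝ) : ℂ) *
        ((g (p.1 / a n) (p.2 / b n) : ℝ) : ℂ) := by
    filter_upwards [hscale] with n hn p hp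
    simp only [F, f, Set.indicator_of_mem hp]
    rw [← hn p.1 p.2]
    push_cast
    ring
  refine Tendsto.congr' (EventuallyEq.symm hFeq) ?_
  refine tendsto_integral_filter_of_dominated_convergence
    (fun p => M * (Abar p.1 * Bbar p.2 * hbar p)) ?_ ?_ (hbound.const_mul M) ?_
  · filter_upwards [ha.eventually_gt_atTop 0, hb.eventually_gt_atTop 0] with n han hbn
    refine AEStronglyMeasurable.const_mul (AEStronglyMeasurable.mul ?_
      (aestronglyMeasurable_comp_div han hbn hf)) _
    have hA' := hA n
    have hB' := hB n
    exact Continuous.aestronglyMeasurable (by fun_prop)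
  · filter_upwards [hFval, hAbar, hBbar, hhbar] with n h1 h2 h3 h4
    filter_upwards [ae_fst_ne_zero, ae_snd_ne_zero] with p hp1 hp2
    by_cases hp : (p.1 / a n, p.2 / b n) ∈ freqSquare
    · rw [h1 p hp, norm_mul, norm_mul, norm_mul, Complex.norm_real, Complex.norm_real]
      have hp' := (hmem n p).1 hp
      have hg' : ‖g (p.1 / a n) (p.2 / b n)‖ ≤ M := hM _ hp.1 _ hp.2
      calc _ ≤ Abar p.1 * Bbar p.2 * hbar p * M := by
            refine mul_le_mul (mul_le_mul (mul_le_mul (h2 _ hp'.1) (h3 _ hp'.2) (norm_nonneg _)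
              (hA0 _)) (h4 _ _ hp1 hp2) (norm_nonneg _) (mul_nonneg (hA0 _) (hB0 _))) hg'
              (norm_nonneg _) (mul_nonneg (mul_nonneg (hA0 _) (hB0 _)) (hbar_nonneg _))
        _ = _ := by ring
    · simp only [F, f, Set.indicator_of_notMem hp, mul_zero, norm_zero]
      exact mul_nonneg hM0 (mul_nonneg (mul_nonneg (hA0 _) (hB0 _)) (hbar_nonneg _))
  · filter_upwards [ae_fst_ne_zero, ae_snd_ne_zero] with p hp1 hp2
    -- For a fixed (u,v) the rescaled frequency tends to the origin: it is eventually in the square,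
    -- and g there tends to g(0,0) = 1.
    have ha0 : Tendsto (fun n => p.1 / a n) atTop (𝓝 0) := tendsto_const_nhds.div_atTop ha
    have hb0 : Tendsto (fun n => p.2 / b n) atTop (𝓝 0) := tendsto_const_nhds.div_atTop hb
    have hab0 : Tendsto (fun n => (p.1 / a n, p.2 / b n)) atTop (𝓝 (0, 0)) := ha0.prodMk_nhds hb0
    have hg1 : Tendsto (fun n => ((g (p.1 / a n) (p.2 / b n) : ℝ) : ℂ)) atTop (𝓝 1) := by
      have h5 := (Complex.continuous_ofReal.tendsto _).comp (hg_cont.tendsto.comp hab0)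
      rw [hg_zero, Complex.ofReal_one] at h5
      exact h5
    have hin : ∀ᶠ n in atTop, (p.1 / a n, p.2 / b n) ∈ freqSquare := by
      have e1 := (ha0.abs).eventually_le_const (u := Real.pi) (by simpa using Real.pi_pos)
      have e2 := (hb0.abs).eventually_le_const (u := Real.pi) (by simpa using Real.pi_pos)
      filter_upwards [e1, e2] with n e1 e2
      exact (hmem n p).2 ⟨e1, e2⟩
    have h6 := (((hAlim _ hp1).mul (hBlim _ hp2)).mul
      ((Complex.continuous_ofReal.tendsto _).comp (hhlim _ _ hp1 hp2))).mul hg1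
    rw [mul_one] at h6
    refine h6.congr' ?_
    filter_upwards [hFval, hin] with n h1 h2
    rw [h1 p h2]
    rfl

end SpectralConvergence

/-! ### Covariances of partial sums -/

section Covariance

variable {Ω : Type*} [MeasurableSpace Ω] {P : Measure Ω} {X : ℤ → ℤ → Ω → ℝ} {f : ℝ → ℝ → ℝ}

/-- The characters factor over t, t', s, s', so the fourfold sum of covariances becomes a product of
four Dirichlet sums under the integral. -/
lemma cov_sum_eq [IsProbabilityMeasure P] (hL : ∀ t s, MemLp (X t s) 2 P)
    (hX : HasSpectralDensity X P f) (m l m' l' : ℤ) :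
    ((cov[fun ω => ∑ t ∈ Finset.Icc 1 m, ∑ s ∈ Finset.Icc 1 l, X t s ω,
      fun ω => ∑ t ∈ Finset.Icc 1 m', ∑ s ∈ Finset.Icc 1 l', X t s ω; P] : ℝ) : ℂ) =
    ∫ p in freqSquare, (dirichlet m p.1 * starRingEnd ℂ (dirichlet m' p.1)) *
      (dirichlet l p.2 * starRingEnd ℂ (dirichlet l' p.2)) * (f p.1 p.2 : ℂ) := by
  simp_rw [← Finset.sum_product']
  rw [covariance_fun_sum_fun_sum' (X := fun p : ℤ × ℤ => X p.1 p.2)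
    (Y := fun p : ℤ × ℤ => X p.1 p.2) (fun p _ => hL _ _) (fun p _ => hL _ _)]
  push_cast
  simp_rw [hX.covariance_eq]
  have hI : ∀ p q : ℤ × ℤ, Integrable (fun z : ℝ × ℝ =>
      Complex.exp (Complex.I * (((p.1 - q.1 : ℤ) : ℂ) * (z.1 : ℂ) +
        ((p.2 - q.2 : ℤ) : ℂ) * (z.2 : ℂ))) * (f z.1 z.2 : ℂ)) (volume.restrict freqSquare) := by
    intro p q
    refine Integrable.bdd_mul (c := 1) hX.integrable.ofReal
      (Continuous.aestronglyMeasurable (by fun_prop)) (Eventually.of_forall fun z => ?_)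
    rw [show (((p.1 - q.1 : ℤ) : ℂ) * (z.1 : ℂ) + ((p.2 - q.2 : ℤ) : ℂ) * (z.2 : ℂ)) =
      (((p.1 - q.1 : ℤ) * z.1 + (p.2 - q.2 : ℤ) * z.2 : ℝ) : ℂ) by push_cast; ring,
      Complex.norm_exp_I_mul_ofReal]
  simp_rw [← Finset.sum_product']
  rw [← integral_finsetSum _ fun p _ => hI p.1 p.2]
  refine integral_congr_ae (Eventually.of_forall fun z => ?_)
  simp only
  rw [← Finset.sum_mul]
  congr 1
  have hconj : ∀ k θ, starRingEnd ℂ (dirichlet k θ) =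
      ∑ t ∈ Finset.Icc (1 : ℤ) k, Complex.exp (-(Complex.I * ((t * θ : ℝ) : ℂ))) := by
    intro k θ
    rw [dirichlet, map_sum]
    refine Finset.sum_congr rfl fun t _ => ?_
    rw [← Complex.exp_conj, map_mul, Complex.conj_I, Complex.conj_ofReal, neg_mul]
  rw [hconj, hconj, dirichlet, dirichlet,
    show ∀ a b c d : ℂ, a * b * (c * d) = (a * c) * (b * d) by intros; ring,
    Finset.sum_mul_sum, Finset.sum_mul_sum, ← Finset.sum_product', ← Finset.sum_product',
    Finset.sum_mul_sum, ← Finset.sum_product']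
  refine Finset.sum_congr rfl fun p _ => ?_
  rw [← Complex.exp_add, ← Complex.exp_add, ← Complex.exp_add]
  congr 1
  push_cast
  ring

/-- Covariances of the normalized partial sums as spectral integrals. -/
lemma cov_partialSum [IsProbabilityMeasure P] (hL : ∀ t s, MemLp (X t s) 2 P)
    (hX : HasSpectralDensity X P f) {γ : ℝ} {n : ℕ} (hn : 0 < n) (H x y x' y' : ℝ) :
    ((cov[fun ω => (n : ℝ) ^ (-H) * partialSum X γ n x y ω,
      fun ω => (n : ℝ) ^ (-H) * partialSum X γ n x' y' ω; P] : ℝ) : ℂ) =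
    ((((n : ℝ) ^ (-H)) ^ 2 * ((n : ℝ) ^ 2 * ((n : ℝ) ^ γ) ^ 2) : ℝ) : ℂ) *
    ∫ p in freqSquare, dirichletCross n x x' p.1 * dirichletCross ((n : ℝ) ^ γ) y y' p.2 *
      (f p.1 p.2 : ℂ) := by
  have hn' : (0 : ℝ) < n := by exact_mod_cast hn
  have hγ : (0 : ℝ) < (n : ℝ) ^ γ := Real.rpow_pos_of_pos hn' _
  have h1 := cov_sum_eq hL hX ⌊(n : ℝ) * x⌋ ⌊(n : ℝ) ^ γ * y⌋ ⌊(n : ℝ) * x'⌋ ⌊(n : ℝ) ^ γ * y'⌋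
  have e1 : (n : ℂ) ≠ 0 := by exact_mod_cast hn.ne'
  have e2 : (((n : ℝ) ^ γ : ℝ) : ℂ) ≠ 0 := Complex.ofReal_ne_zero.2 hγ.ne'
  have h2 : (∫ p in freqSquare, (dirichlet ⌊(n : ℝ) * x⌋ p.1 *
        starRingEnd ℂ (dirichlet ⌊(n : ℝ) * x'⌋ p.1)) *
      (dirichlet ⌊(n : ℝ) ^ γ * y⌋ p.2 * starRingEnd ℂ (dirichlet ⌊(n : ℝ) ^ γ * y'⌋ p.2)) *
        (f p.1 p.2 : ℂ)) =
      (((n : ℝ) ^ 2 * ((n : ℝ) ^ γ) ^ 2 : ℝ) : ℂ) * ∫ p in freqSquare,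
        dirichletCross n x x' p.1 * dirichletCross ((n : ℝ) ^ γ) y y' p.2 * (f p.1 p.2 : ℂ) := by
    rw [← integral_const_mul]
    refine integral_congr_ae (Eventually.of_forall fun p => ?_)
    simp only [dirichletCross]
    simp only [map_mul, map_inv₀, Complex.conj_ofReal, Complex.ofReal_mul, Complex.ofReal_pow,
      Complex.ofReal_natCast, Complex.conj_natCast]
    field_simp
  unfold partialSum
  rw [covariance_const_mul_left, covariance_const_mul_right, Complex.ofReal_mul,
    Complex.ofReal_mul, h1, h2]
  push_cast
  ring

end Covariance

/-- `V` is a centered Gaussian field with covariance function `K`. -/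
structure IsCenteredGaussianField {Ω : Type*} [MeasurableSpace Ω] (V : ℝ → ℝ → Ω → ℝ)
    (P : Measure Ω) (K : ℝ × ℝ → ℝ × ℝ → ℝ) : Prop where
  gaussian : IsGaussianProcess (fun (p : ℝ × ℝ) ω => V p.1 p.2 ω) P
  mean_zero : ∀ p : ℝ × ℝ, ∫ ω, V p.1 p.2 ω ∂P = 0
  covariance_eq : ∀ p q : ℝ × ℝ, cov[V p.1 p.2, V q.1 q.2; P] = K p q

/-- The factor may depend on the point, as needed for the degenerate limits, which are x or y times
a one-parameter field. -/
lemma IsCenteredGaussianField.const_mul {Ω : Type*} [MeasurableSpace Ω] {P : Measure Ω} {V : ℝ → ℝ → Ω → ℝ} {K : ℝ × ℝ → ℝ × ℝ → ℝ}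
    (hV : IsCenteredGaussianField V P K) (a : ℝ × ℝ → ℝ) :
    IsCenteredGaussianField (fun x y ω => a (x, y) * V x y ω) P
      (fun p q => a p * a q * K p q) where
  gaussian := hV.gaussian.smul a
  mean_zero p := by rw [integral_const_mul, hV.mean_zero, mul_zero]
  covariance_eq p q := by
    rw [covariance_const_mul_left, covariance_const_mul_right, hV.covariance_eq]
    ring

/-! ### Reduction to real kernels by symmetry -/

section Symmetrization

lemma integrable_incCross_mul {w : ℝ × ℝ → ℝ} (hw : IsWeight w) (x x' y y' : ℝ) :
    Integrable (fun p : ℝ × ℝ => incCross x x' p.1 * incCross y y' p.2 * ((w p : ℝ) : ℂ)) := by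
  refine (hw.2.2.const_mul ((x ^ 2 + x' ^ 2 + 4) * (y ^ 2 + y' ^ 2 + 4))).mono' ?_ ?_
  · refine Measurable.aestronglyMeasurable (Measurable.mul (Measurable.mul ?_ ?_) ?_)
    · exact (measurable_incCross x x').comp measurable_fst
    · exact (measurable_incCross y y').comp measurable_snd
    · exact Complex.measurable_ofReal.comp hw.1
  · refine Eventually.of_forall fun p => ?_
    rw [norm_mul, norm_mul, Complex.norm_real, Real.norm_of_nonneg (hw.2.1 p)]
    have h1 := norm_incCross_le x x' p.1
    have h2 := norm_incCross_le y y' p.2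
    calc _ ≤ ((x ^ 2 + x' ^ 2 + 4) * (1 + p.1 ^ 2)⁻¹) * ((y ^ 2 + y' ^ 2 + 4) * (1 + p.2 ^ 2)⁻¹) *
          w p := mul_le_mul_of_nonneg_right (mul_le_mul h1 h2 (norm_nonneg _) (by positivity))
            (hw.2.1 p)
      _ = _ := by ring

lemma integrable_incRe_mul {w : ℝ × ℝ → ℝ} (hw : IsWeight w) (x x' y y' : ℝ) :
    Integrable (fun p : ℝ × ℝ => incRe x x' p.1 * incRe y y' p.2 * w p) := by
  refine (hw.2.2.const_mul ((x ^ 2 + x' ^ 2 + 4) * (y ^ 2 + y' ^ 2 + 4))).mono' ?_ ?_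
  · refine Measurable.aestronglyMeasurable (Measurable.mul (Measurable.mul ?_ ?_) hw.1)
    · exact (measurable_incRe x x').comp measurable_fst
    · exact (measurable_incRe y y').comp measurable_snd
  · refine Eventually.of_forall fun p => ?_
    rw [norm_mul, norm_mul, Real.norm_of_nonneg (hw.2.1 p), Real.norm_eq_abs, Real.norm_eq_abs]
    have h1 := abs_incRe_le x x' p.1
    have h2 := abs_incRe_le y y' p.2
    calc _ ≤ ((x ^ 2 + x' ^ 2 + 4) * (1 + p.1 ^ 2)⁻¹) * ((y ^ 2 + y' ^ 2 + 4) * (1 + p.2 ^ 2)⁻¹) *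
          w p := mul_le_mul_of_nonneg_right (mul_le_mul h1 h2 (abs_nonneg _) (by positivity))
            (hw.2.1 p)
      _ = _ := by ring

lemma integral_comp_neg_fst (F : ℝ × ℝ → ℝ) :
    ∫ p : ℝ × ℝ, F (-p.1, p.2) = ∫ p : ℝ × ℝ, F p := by
  have h : MeasurePreserving (Prod.map Neg.neg id : ℝ × ℝ → ℝ × ℝ) :=
    (Measure.measurePreserving_neg (volume : Measure ℝ)).prod (MeasurePreserving.id volume)
  have hm : MeasurableEmbedding (Prod.map Neg.neg id : ℝ × ℝ → ℝ × ℝ) :=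
    ((Homeomorph.neg ℝ).prodCongr (Homeomorph.refl ℝ)).measurableEmbedding
  exact h.integral_comp hm F

/-- For weights that are even in `u`, only the real parts of the kernels contribute. -/
lemma re_integral_incCross {w : ℝ × ℝ → ℝ} (hw : IsWeight w) (hsym : ∀ u v, w (-u, v) = w (u, v))
    (x x' y y' : ℝ) :
    (∫ p : ℝ × ℝ, incCross x x' p.1 * incCross y y' p.2 * ((w p : ℝ) : ℂ)).re =
      ∫ p : ℝ × ℝ, incRe x x' p.1 * incRe y y' p.2 * w p := by
  have hI := integrable_incCross_mul hw x x' y y'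
  have h1 : (∫ p : ℝ × ℝ, incCross x x' p.1 * incCross y y' p.2 * ((w p : ℝ) : ℂ)).re =
      ∫ p : ℝ × ℝ, (incCross x x' p.1 * incCross y y' p.2 * ((w p : ℝ) : ℂ)).re :=
    (integral_re (𝕜 := ℂ) hI).symm
  have hre : ∀ p : ℝ × ℝ, (incCross x x' p.1 * incCross y y' p.2 * ((w p : ℝ) : ℂ)).re =
      incRe x x' p.1 * incRe y y' p.2 * w p -
        (incCross x x' p.1).im * (incCross y y' p.2).im * w p := by
    intro p
    rw [Complex.re_mul_ofReal, Complex.mul_re, re_incCross, re_incCross]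
    ring
  have hI2 : Integrable fun p : ℝ × ℝ =>
      (incCross x x' p.1).im * (incCross y y' p.2).im * w p := by
    refine ((integrable_incRe_mul hw x x' y y').sub hI.re).congr (Eventually.of_forall fun p => ?_)
    have h := hre p
    simp only [Pi.sub_apply]
    change _ - Complex.re _ = _
    rw [h]
    ring
  -- Reflecting u alone conjugates only the first factor, so the product of imaginary parts is odd
  -- in u.
  have hodd : ∫ p : ℝ × ℝ, (incCross x x' p.1).im * (incCross y y' p.2).im * w p = 0 := by
    have h2 := integral_comp_neg_fst
      fun p : ℝ × ℝ => (incCross x x' p.1).im * (incCross y y' p.2).im * w p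
    simp only [incCross_neg, Complex.conj_im, hsym, neg_mul, Prod.mk.eta] at h2
    rw [integral_neg] at h2
    linarith
  rw [h1]
  simp_rw [hre]
  rw [integral_sub (integrable_incRe_mul hw x x' y y') hI2, hodd, sub_zero]

lemma integrable_incCross_mul_rpow {α : ℝ} (h0 : 0 ≤ α) (h1 : α < 1) (x x' : ℝ) :
    Integrable (fun u : ℝ => incCross x x' u * ((|u| ^ (-α) : ℝ) : ℂ)) := by
  refine ((integrable_japanese_mul_rpow h0 h1).const_mul (x ^ 2 + x' ^ 2 + 4)).mono' ?_ ?_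
  · exact ((measurable_incCross x x').mul
      (Complex.measurable_ofReal.comp (by fun_prop))).aestronglyMeasurable
  · refine Eventually.of_forall fun u => ?_
    have hw : 0 ≤ |u| ^ (-α) := by positivity
    rw [norm_mul, Complex.norm_real, Real.norm_of_nonneg hw, ← mul_assoc]
    exact mul_le_mul_of_nonneg_right (norm_incCross_le x x' u) hw

lemma re_integral_incCross_rpow {α : ℝ} (h0 : 0 ≤ α) (h1 : α < 1) (x x' : ℝ) :
    (∫ u : ℝ, incCross x x' u * ((|u| ^ (-α) : ℝ) : ℂ)).re =
      ∫ u : ℝ, incRe x x' u * |u| ^ (-α) := by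
  refine (integral_re (𝕜 := ℂ) (integrable_incCross_mul_rpow h0 h1 x x')).symm.trans ?_
  refine integral_congr_ae (Eventually.of_forall fun u => ?_)
  change (incCross x x' u * ((|u| ^ (-α) : ℝ) : ℂ)).re = _
  rw [Complex.re_mul_ofReal, re_incCross]

end Symmetrization

/-! ### Fractional Brownian covariances from power weights -/

section PowerCovariance

/-- The covariance `½(|x|^p + |x'|^p - |x - x'|^p)` of fractional Brownian motion. -/
noncomputable def powCov (p x x' : ℝ) : ℝ := 2⁻¹ * (|x| ^ p + |x'| ^ p - |x - x'| ^ p)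

/-- Exponent 2 is the degenerate case, the covariance of x ↦ xZ for a single Gaussian variable Z. It
brings the limits that are linear in one coordinate under the same form. -/
lemma powCov_two (x x' : ℝ) : powCov 2 x x' = x * x' := by
  simp only [powCov, Real.rpow_two, sq_abs]
  ring

/-- The constant `∫ (2 - 2 cos u) u⁻² |u|^{-α} du`. -/
noncomputable def powConst (α : ℝ) : ℝ := ∫ u : ℝ, incSq 1 u * |u| ^ (-α)

lemma integrable_incSq_mul_rpow {α : ℝ} (h0 : 0 ≤ α) (h1 : α < 1) (x : ℝ) :
    Integrable (fun u : ℝ => incSq x u * |u| ^ (-α)) := by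
  refine ((integrable_japanese_mul_rpow h0 h1).const_mul (x ^ 2 + 4)).mono' ?_ ?_
  · exact ((measurable_incSq x).mul (by fun_prop)).aestronglyMeasurable
  · refine Eventually.of_forall fun u => ?_
    have hw : 0 ≤ |u| ^ (-α) := by positivity
    rw [Real.norm_of_nonneg (mul_nonneg (incSq_nonneg x u) hw), ← mul_assoc]
    exact mul_le_mul_of_nonneg_right (incSq_le x u) hw

lemma powConst_pos {α : ℝ} (h0 : 0 ≤ α) (h1 : α < 1) : 0 < powConst α := by
  refine (integral_pos_iff_support_of_nonneg (fun u => mul_nonneg (incSq_nonneg 1 u) (by positivity))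
    (integrable_incSq_mul_rpow h0 h1 1)).2 ?_
  refine lt_of_lt_of_le ?_ (measure_mono (s := Set.Ioo 0 1) fun u hu => ?_)
  · simp
  · have h3 : 0 < incSq 1 u := incSq_pos hu.1 one_pos (by linarith [hu.2, Real.pi_gt_three])
    have h4 := abs_pos.2 hu.1.ne'
    exact (by positivity : 0 < incSq 1 u * |u| ^ (-α)).ne'

/-- Substitute xu for u: the kernel contributes x², the weight |x|^α, and the Jacobian removes one
power. -/
lemma integral_incSq_mul_rpow {α : ℝ} (h0 : 0 ≤ α) (x : ℝ) :
    ∫ u : ℝ, incSq x u * |u| ^ (-α) = powConst α * |x| ^ (1 + α) := by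
  rcases eq_or_ne x 0 with rfl | hx
  · rw [abs_zero, Real.zero_rpow (by positivity)]
    simp
  · have hx' := abs_pos.2 hx
    have h2 := Measure.integral_comp_mul_left (fun u => incSq 1 u * |u| ^ (-α)) x
    have h3 : ∀ u : ℝ, incSq x u * |u| ^ (-α) =
        |x| ^ (2 + α) * (incSq 1 (x * u) * |x * u| ^ (-α)) := by
      intro u
      have h4 := incSq_mul hx 1 u
      rw [mul_one] at h4
      rw [h4, abs_mul, Real.mul_rpow (abs_nonneg _) (abs_nonneg _), Real.rpow_add hx',
        Real.rpow_two, sq_abs, Real.rpow_neg hx'.le]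
      field_simp
    simp_rw [h3]
    rw [integral_const_mul, h2, smul_eq_mul, ← powConst, abs_inv, ← mul_assoc, mul_comm]
    congr 1
    rw [show 2 + α = (1 + α) + 1 by ring, Real.rpow_add hx', Real.rpow_one]
    field_simp

lemma integral_incRe_mul_rpow {α : ℝ} (h0 : 0 ≤ α) (h1 : α < 1) (x x' : ℝ) :
    ∫ u : ℝ, incRe x x' u * |u| ^ (-α) = powConst α * powCov (1 + α) x x' := by
  have h2 := integrable_incSq_mul_rpow h0 h1
  have h3 : ∀ u : ℝ, incRe x x' u * |u| ^ (-α) = 2⁻¹ * (incSq x u * |u| ^ (-α) +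
      incSq x' u * |u| ^ (-α) - incSq (x - x') u * |u| ^ (-α)) := by
    intro u
    rw [incRe]
    ring
  simp_rw [h3]
  rw [integral_const_mul, integral_sub (by exact (h2 x).add (h2 x')) (h2 _), integral_add (h2 x) (h2 x'),
    integral_incSq_mul_rpow h0, integral_incSq_mul_rpow h0, integral_incSq_mul_rpow h0, powCov]
  ring

lemma integral_incRe (x x' : ℝ) : ∫ u : ℝ, incRe x x' u = powConst 0 * powCov 1 x x' := by
  simpa using integral_incRe_mul_rpow le_rfl one_pos x x'

lemma integral_incRe_mul_rpow_left {α : ℝ} (h0 : 0 ≤ α) (h1 : α < 1) (x x' y y' : ℝ) :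
    ∫ p : ℝ × ℝ, incRe x x' p.1 * incRe y y' p.2 * |p.1| ^ (-α) =
      powConst α * powConst 0 * (powCov (1 + α) x x' * powCov 1 y y') := by
  have h := integral_prod_mul (μ := (volume : Measure ℝ)) (ν := (volume : Measure ℝ))
    (fun u => incRe x x' u * |u| ^ (-α)) (incRe y y')
  rw [integral_incRe_mul_rpow h0 h1, integral_incRe] at h
  rw [show powConst α * powConst 0 * (powCov (1 + α) x x' * powCov 1 y y') =
    powConst α * powCov (1 + α) x x' * (powConst 0 * powCov 1 y y') by ring, ← h]
  refine integral_congr_ae (Eventually.of_forall fun p => ?_)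
  ring

lemma integral_incRe_mul_rpow_right {α : ℝ} (h0 : 0 ≤ α) (h1 : α < 1) (x x' y y' : ℝ) :
    ∫ p : ℝ × ℝ, incRe x x' p.1 * incRe y y' p.2 * |p.2| ^ (-α) =
      powConst 0 * powConst α * (powCov 1 x x' * powCov (1 + α) y y') := by
  have h := integral_prod_mul (μ := (volume : Measure ℝ)) (ν := (volume : Measure ℝ))
    (incRe x x') (fun u => incRe y y' u * |u| ^ (-α))
  rw [integral_incRe_mul_rpow h0 h1, integral_incRe] at h
  rw [show powConst 0 * powConst α * (powCov 1 x x' * powCov (1 + α) y y') =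
    powConst 0 * powCov 1 x x' * (powConst α * powCov (1 + α) y y') by ring, ← h]
  refine integral_congr_ae (Eventually.of_forall fun p => ?_)
  simp only
  ring

end PowerCovariance

/-! ### Covariances of the limit fields -/

section Fields

variable {Ω : Type*} [MeasurableSpace Ω] {P : Measure Ω} [IsProbabilityMeasure P]
  {W : Set (ℝ × ℝ) → Ω → ℂ} {W₁ : Set ℝ → Ω → ℂ} {H₁ H₂ c : ℝ}

/-- Stochastic integrals of `k_x(u) k_y(v) r(u,v)` with respect to a noise on the plane. -/
theorem IsComplexGaussianNoise.planeField (hW : IsComplexGaussianNoise W P) {r w : ℝ × ℝ → ℝ}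
    (hr : Measurable r) (hrw : ∀ p, r p ^ 2 = w p) (hw : IsWeight w) (hrneg : ∀ p, r (-p) = r p)
    (hsym : ∀ u v, w (-u, v) = w (u, v)) :
    IsCenteredGaussianField (fun x y ω => (stochasticIntegral W P
        (fun p : ℝ × ℝ => incKernel x p.1 * incKernel y p.2 * ((r p : ℝ) : ℂ)) ω).re) P
      (fun p q => ∫ z : ℝ × ℝ, incRe p.1 q.1 z.1 * incRe p.2 q.2 z.2 * w z) := by
  let φ : ℝ × ℝ → ℝ × ℝ → ℂ := fun t p => incKernel t.1 p.1 * incKernel t.2 p.2 * ((r p : ℝ) : ℂ)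
  have hcross : ∀ s t p, φ s p * starRingEnd ℂ (φ t p) =
      incCross s.1 t.1 p.1 * incCross s.2 t.2 p.2 * ((w p : ℝ) : ℂ) := by
    intro s t p
    simp only [φ, incCross, map_mul, Complex.conj_ofReal, ← hrw]
    push_cast
    ring
  have hφ : ∀ t, MemLp (φ t) 2 volume := by
    intro t
    have hm : AEStronglyMeasurable (φ t) :=
      ((((measurable_incKernel _).comp measurable_fst).mul
        ((measurable_incKernel _).comp measurable_snd)).mul
          (Complex.measurable_ofReal.comp hr)).aestronglyMeasurable
    refine (memLp_two_iff_integrable_sq_norm hm).2 ?_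
    refine (integrable_incCross_mul hw t.1 t.1 t.2 t.2).norm.congr (Eventually.of_forall fun p => ?_)
    simp only
    rw [← hcross, norm_mul, RCLike.norm_conj, sq]
  have hφsym : ∀ t p, φ t (-p) = starRingEnd ℂ (φ t p) := by
    intro t p
    simp only [φ, Prod.fst_neg, Prod.snd_neg, incKernel_neg, hrneg, map_mul, Complex.conj_ofReal]
  obtain ⟨h1, h2, h3⟩ := hW.gaussianField hφ hφsym
  refine ⟨h1, h2, fun p q => (h3 p q).trans ?_⟩
  simp_rw [hcross]
  exact re_integral_incCross hw hsym _ _ _ _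

/-- Stochastic integrals of `k_x(u) |u|^{-α/2}` with respect to a noise on the line. -/
theorem IsComplexGaussianNoise.lineField (hW₁ : IsComplexGaussianNoise W₁ P) {α β : ℝ}
    (h0 : 0 ≤ α) (h1 : α < 1) (hβ : β = -α / 2) {T : Type*} (ξ : T → ℝ) :
    IsGaussianProcess (fun t ω => (stochasticIntegral W₁ P
      (fun u : ℝ => incKernel (ξ t) u * ((|u| ^ β : ℝ) : ℂ)) ω).re) P ∧
    (∀ t, ∫ ω, (stochasticIntegral W₁ P
      (fun u : ℝ => incKernel (ξ t) u * ((|u| ^ β : ℝ) : ℂ)) ω).re ∂P = 0) ∧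
    ∀ s t, cov[fun ω => (stochasticIntegral W₁ P
        (fun u : ℝ => incKernel (ξ s) u * ((|u| ^ β : ℝ) : ℂ)) ω).re,
      fun ω => (stochasticIntegral W₁ P
        (fun u : ℝ => incKernel (ξ t) u * ((|u| ^ β : ℝ) : ℂ)) ω).re; P] =
      ∫ u : ℝ, incRe (ξ s) (ξ t) u * |u| ^ (-α) := by
  let φ : T → ℝ → ℂ := fun t u => incKernel (ξ t) u * ((|u| ^ β : ℝ) : ℂ)
  have hsq : ∀ u : ℝ, (|u| ^ β) ^ 2 = |u| ^ (-α) := by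
    intro u
    rw [← Real.rpow_natCast, ← Real.rpow_mul (abs_nonneg _), hβ]
    congr 1
    push_cast
    ring
  have hcross : ∀ s t u, φ s u * starRingEnd ℂ (φ t u) =
      incCross (ξ s) (ξ t) u * ((|u| ^ (-α) : ℝ) : ℂ) := by
    intro s t u
    simp only [φ, incCross, map_mul, Complex.conj_ofReal, ← hsq]
    push_cast
    ring
  have hφ : ∀ t, MemLp (φ t) 2 volume := by
    intro t
    have hm : AEStronglyMeasurable (φ t) :=
      ((measurable_incKernel _).mul
          (Complex.measurable_ofReal.comp (by fun_prop))).aestronglyMeasurable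
    refine (memLp_two_iff_integrable_sq_norm hm).2 ?_
    refine (integrable_incCross_mul_rpow h0 h1 (ξ t) (ξ t)).norm.congr
      (Eventually.of_forall fun p => ?_)
    simp only
    rw [← hcross, norm_mul, RCLike.norm_conj, sq]
  have hφsym : ∀ t p, φ t (-p) = starRingEnd ℂ (φ t p) := by
    intro t p
    simp only [φ, incKernel_neg, abs_neg, map_mul, Complex.conj_ofReal]
  obtain ⟨e1, e2, e3⟩ := hW₁.gaussianField hφ hφsym
  refine ⟨e1, e2, fun p q => (e3 p q).trans ?_⟩
  simp_rw [hcross]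
  exact re_integral_incCross_rpow h0 h1 _ _

lemma rpow_half_sq {a : ℝ} (ha : 0 ≤ a) (s : ℝ) : (a ^ (s / 2)) ^ 2 = a ^ s := by
  rw [← Real.rpow_natCast, ← Real.rpow_mul ha]
  congr 1
  push_cast
  ring

theorem VBalanced_field (hW : IsComplexGaussianNoise W P) (hc : 0 < c) (hH₁ : 0 < H₁)
    (hH : H₁ ≤ H₂) (hH₁_ne : H₁ ≠ 1) (hHH : H₁ * H₂ < H₁ + H₂) :
    IsCenteredGaussianField (VBalanced W P H₁ H₂ c) P
      (fun p q => ∫ z : ℝ × ℝ, incRe p.1 q.1 z.1 * incRe p.2 q.2 z.2 *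
        hDensity H₁ H₂ c z.1 z.2) := by
  refine hW.planeField (r := fun p => √(hDensity H₁ H₂ c p.1 p.2))
    (w := fun p => hDensity H₁ H₂ c p.1 p.2) (measurable_hDensity.sqrt) ?_
    (isWeight_hDensity hc hH₁ hH hH₁_ne hHH) ?_ ?_
  · exact fun p => Real.sq_sqrt (hDensity_nonneg hc _ _)
  · intro p
    simp only [Prod.fst_neg, Prod.snd_neg, hDensity_neg_left, hDensity_neg_right]
  · intro u v
    simp only [hDensity_neg_left]

theorem VPlus_field_of_lt (hW : IsComplexGaussianNoise W P) (hH₁ : 0 < H₁) (h1 : H₁ < 1) :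
    IsCenteredGaussianField (VPlus W W₁ P H₁ H₂ c) P
      (fun p q => ∫ z : ℝ × ℝ, incRe p.1 q.1 z.1 * incRe p.2 q.2 z.2 * |z.1| ^ (-H₁)) := by
  have h := hW.planeField (r := fun p => |p.1| ^ (-H₁ / 2))
    (w := fun p => |p.1| ^ (-H₁)) (by fun_prop) (fun p => rpow_half_sq (abs_nonneg _) _)
    (isWeight_left hH₁.le h1) (fun p => by simp) (fun u v => by simp)
  convert h using 1
  funext x y ω
  rw [VPlus, if_pos h1]

/-- The field is x times an integral over the line, so its covariance is xx' times a one-parameter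
covariance. The weight is the power of |v| left after h is integrated over u. -/
theorem VPlus_field_of_gt (hW₁ : IsComplexGaussianNoise W₁ P) (hc : 0 < c) (h1 : 1 < H₁)
    (hH : H₁ ≤ H₂) (hHH : H₁ * H₂ < H₁ + H₂) :
    IsCenteredGaussianField (VPlus W W₁ P H₁ H₂ c) P
      (fun p q => rho₁ H₁ ^ 2 * c ^ ((1 - H₁) / 2) * (p.1 * q.1) *
        ∫ v : ℝ, incRe p.2 q.2 v * |v| ^ (-((H₁ * H₂ - H₂) / H₁))) := by
  have hH₁ : 0 < H₁ := by linarith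
  have hα0 : 0 ≤ (H₁ * H₂ - H₂) / H₁ := div_nonneg (by nlinarith) hH₁.le
  have hα1 : (H₁ * H₂ - H₂) / H₁ < 1 := by rw [div_lt_one hH₁]; linarith
  obtain ⟨e1, e2, e3⟩ := hW₁.lineField (β := -(H₁ * H₂ - H₂) / (2 * H₁)) hα0 hα1
    (by field_simp) (fun p : ℝ × ℝ => p.2)
  have hF : IsCenteredGaussianField (fun _ y ω => (stochasticIntegral W₁ P
      (fun v : ℝ => incKernel y v * ((|v| ^ (-(H₁ * H₂ - H₂) / (2 * H₁)) : ℝ) : ℂ)) ω).re) P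
      (fun p q => ∫ v : ℝ, incRe p.2 q.2 v * |v| ^ (-((H₁ * H₂ - H₂) / H₁))) := ⟨e1, e2, e3⟩
  have h := hF.const_mul (fun p => p.1 * rho₁ H₁ * c ^ ((1 - H₁) / 4))
  have hsq : ∀ p q : ℝ × ℝ, p.1 * rho₁ H₁ * c ^ ((1 - H₁) / 4) *
      (q.1 * rho₁ H₁ * c ^ ((1 - H₁) / 4)) =
      rho₁ H₁ ^ 2 * c ^ ((1 - H₁) / 2) * (p.1 * q.1) := by
    intro p q
    rw [← rpow_half_sq hc.le ((1 - H₁) / 2), show (1 - H₁) / 2 / 2 = (1 - H₁) / 4 by ring]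
    ring
  simp only [hsq] at h
  convert h using 1
  funext x y ω
  rw [VPlus, if_neg h1.not_gt]

theorem VMinus_field_of_lt (hW : IsComplexGaussianNoise W P) (hc : 0 < c) (hH₂ : 0 < H₂)
    (h1 : H₂ < 1) :
    IsCenteredGaussianField (VMinus W W₁ P H₁ H₂ c) P
      (fun p q => c ^ (-H₁ / 2) *
        ∫ z : ℝ × ℝ, incRe p.1 q.1 z.1 * incRe p.2 q.2 z.2 * |z.2| ^ (-H₂)) := by
  have h := (hW.planeField (r := fun p => |p.2| ^ (-H₂ / 2))
    (w := fun p => |p.2| ^ (-H₂)) (by fun_prop) (fun p => rpow_half_sq (abs_nonneg _) _)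
    (isWeight_right hH₂.le h1) (fun p => by simp) (fun u v => by simp)).const_mul
      (fun _ => c ^ (-H₁ / 4))
  have hsq : c ^ (-H₁ / 4) * c ^ (-H₁ / 4) = c ^ (-H₁ / 2) := by
    rw [← Real.rpow_add hc]
    ring_nf
  simp only [hsq] at h
  convert h using 1
  funext x y ω
  rw [VMinus, if_pos h1]

theorem VMinus_field_of_gt (hW₁ : IsComplexGaussianNoise W₁ P) (hc : 0 < c) (hH₁ : 0 < H₁)
    (h1 : 1 < H₂) (hHH : H₁ * H₂ < H₁ + H₂) :
    IsCenteredGaussianField (VMinus W W₁ P H₁ H₂ c) P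
      (fun p q => rho₂ H₁ H₂ ^ 2 * c ^ (-H₁ / (2 * H₂)) * (p.2 * q.2) *
        ∫ u : ℝ, incRe p.1 q.1 u * |u| ^ (-((H₁ * H₂ - H₁) / H₂))) := by
  have hH₂ : 0 < H₂ := by linarith
  have hα0 : 0 ≤ (H₁ * H₂ - H₁) / H₂ := div_nonneg (by nlinarith) hH₂.le
  have hα1 : (H₁ * H₂ - H₁) / H₂ < 1 := by rw [div_lt_one hH₂]; linarith
  obtain ⟨e1, e2, e3⟩ := hW₁.lineField (β := -(H₁ * H₂ - H₁) / (2 * H₂)) hα0 hα1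
    (by field_simp) (fun p : ℝ × ℝ => p.1)
  have hF : IsCenteredGaussianField (fun x _ ω => (stochasticIntegral W₁ P
      (fun u : ℝ => incKernel x u * ((|u| ^ (-(H₁ * H₂ - H₁) / (2 * H₂)) : ℝ) : ℂ)) ω).re) P
      (fun p q => ∫ u : ℝ, incRe p.1 q.1 u * |u| ^ (-((H₁ * H₂ - H₁) / H₂))) := ⟨e1, e2, e3⟩
  have h := hF.const_mul (fun p => p.2 * rho₂ H₁ H₂ * c ^ (-H₁ / (4 * H₂)))
  have hsq : ∀ p q : ℝ × ℝ, p.2 * rho₂ H₁ H₂ * c ^ (-H₁ / (4 * H₂)) *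
      (q.2 * rho₂ H₁ H₂ * c ^ (-H₁ / (4 * H₂))) =
      rho₂ H₁ H₂ ^ 2 * c ^ (-H₁ / (2 * H₂)) * (p.2 * q.2) := by
    intro p q
    rw [← rpow_half_sq hc.le (-H₁ / (2 * H₂)),
      show -H₁ / (2 * H₂) / 2 = -H₁ / (4 * H₂) by field_simp; norm_num]
    ring
  simp only [hsq] at h
  convert h using 1
  funext x y ω
  rw [VMinus, if_neg h1.not_gt]

end Fields

/-! ### Convergence of the covariances in the five regimes -/

section Convergence

variable {Ω : Type*} [MeasurableSpace Ω] {P : Measure Ω} [IsProbabilityMeasure P]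
  {X : ℤ → ℤ → Ω → ℝ} {g : ℝ → ℝ → ℝ} {H₁ H₂ c : ℝ}

lemma hasGaussianLaw_pi {T Ω : Type*} [Fintype T] [MeasurableSpace Ω] {P : Measure Ω}
    {Y : T → Ω → ℝ} (hY : IsGaussianProcess Y P) : HasGaussianLaw (fun ω t => Y t ω) P := by
  let L : (↥(Finset.univ : Finset T) → ℝ) →L[ℝ] (T → ℝ) :=
    ContinuousLinearMap.pi fun t => ContinuousLinearMap.proj ⟨t, Finset.mem_univ t⟩
  have e : (fun ω t => Y t ω) = L ∘ fun ω => Finset.univ.restrict fun t => Y t ω := by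
    funext ω t
    simp [L, Finset.restrict_def]
  rw [e]
  exact (hY.hasGaussianLaw Finset.univ).map L

lemma partialSum_eq_sum_product {Ω : Type*} {X : ℤ → ℤ → Ω → ℝ} (γ : ℝ) (n : ℕ) (x y : ℝ) (ω : Ω) :
    partialSum X γ n x y ω =
      ∑ z ∈ Finset.Icc (1 : ℤ) ⌊(n : ℝ) * x⌋ ×ˢ Finset.Icc (1 : ℤ) ⌊(n : ℝ) ^ γ * y⌋,
        X z.1 z.2 ω := by
  rw [partialSum, Finset.sum_product]

lemma hasGaussianLaw_partialSum {Ω : Type*} [MeasurableSpace Ω] {P : Measure Ω}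
    {X : ℤ → ℤ → Ω → ℝ} (hX : IsGaussianProcess (fun (p : ℤ × ℤ) ω => X p.1 p.2 ω) P)
    (a γ : ℝ) (n : ℕ) {k : ℕ} (p : Fin k → ℝ × ℝ) :
    HasGaussianLaw (fun ω i => a * partialSum X γ n (p i).1 (p i).2 ω) P := by
  refine hasGaussianLaw_pi (hX.of_isGaussianProcess fun i =>
    ⟨Finset.Icc (1 : ℤ) ⌊(n : ℝ) * (p i).1⌋ ×ˢ Finset.Icc (1 : ℤ) ⌊(n : ℝ) ^ γ * (p i).2⌋,
      a • ∑ z, ContinuousLinearMap.proj z, fun ω => ?_⟩)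
  rw [partialSum_eq_sum_product, ← Finset.sum_coe_sort]
  simp [Finset.restrict_def]

lemma integral_partialSum (hL : ∀ t s, MemLp (X t s) 2 P)
    (hX_mean : ∀ t s : ℤ, ∫ ω, X t s ω ∂P = 0) (γ : ℝ) (n : ℕ) (x y : ℝ) :
    ∫ ω, partialSum X γ n x y ω ∂P = 0 := by
  simp_rw [partialSum_eq_sum_product]
  rw [integral_finsetSum _ fun z _ => (hL z.1 z.2).integrable one_le_two]
  exact Finset.sum_eq_zero fun z _ => hX_mean z.1 z.2

/-- Convergence of the covariances implies convergence of finite-dimensional distributions. -/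
theorem fddTendsto_of_covariance {Ω' : Type*} [MeasurableSpace Ω'] {P' : Measure Ω'}
    [IsProbabilityMeasure P'] (hX : IsGaussianProcess (fun (p : ℤ × ℤ) ω => X p.1 p.2 ω) P)
    (hX_mean : ∀ t s : ℤ, ∫ ω, X t s ω ∂P = 0) {V : ℝ → ℝ → Ω' → ℝ}
    {K : ℝ × ℝ → ℝ × ℝ → ℝ} (hV : IsCenteredGaussianField V P' K) {H γ : ℝ}
    (hcov : ∀ x y x' y' : ℝ, 0 < x → 0 < y → 0 < x' → 0 < y' →
      Tendsto (fun n : ℕ => cov[fun ω => (n : ℝ) ^ (-H) * partialSum X γ n x y ω,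
        fun ω => (n : ℝ) ^ (-H) * partialSum X γ n x' y' ω; P]) atTop
        (𝓝 (K (x, y) (x', y')))) :
    FddTendsto (fun n x y ω => (n : ℝ) ^ (-H) * partialSum X γ n x y ω) P V P' := by
  intro k p hp
  have hL : ∀ t s, MemLp (X t s) 2 P := fun t s => (hX.hasGaussianLaw_eval (t, s)).memLp_two
  refine tendstoInDistribution_of_centered_gaussian
    (X := fun (n : ℕ) i ω => (n : ℝ) ^ (-H) * partialSum X γ n (p i).1 (p i).2 ω)
    (Y := fun i ω => V (p i).1 (p i).2 ω)
    (fun n => hasGaussianLaw_partialSum hX _ γ n p) (fun n i => ?_) ?_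
    (fun i => hV.mean_zero (p i)) (fun i j => ?_)
  · rw [integral_const_mul, integral_partialSum hL hX_mean, mul_zero]
  · exact hasGaussianLaw_pi (hV.gaussian.comp_right p)
  · have h := hcov _ _ _ _ (hp i).1 (hp i).2 (hp j).1 (hp j).2
    have e := hV.covariance_eq (p i) (p j)
    change Tendsto _ _ (𝓝 (cov[V (p i).1 (p i).2, V (p j).1 (p j).2; P']))
    rw [e]
    exact h

/-- The limit of the covariances of partial sums, in terms of the frequency scales `n^α`, `n^β` and
the homogeneity scale `n^μ` of the spectral density. -/
theorem tendsto_cov_partialSum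
    (hc : 0 < c) (hH₁ : 0 < H₁) (hH₂ : 0 < H₂)
    (hg_bdd : ∃ M : ℝ, ∀ x ∈ Set.Icc (-Real.pi) Real.pi, ∀ y ∈ Set.Icc (-Real.pi) Real.pi,
      |g x y| ≤ M)
    (hg_cont : ContinuousAt (fun p : ℝ × ℝ => g p.1 p.2) (0, 0)) (hg_zero : g 0 0 = 1)
    (hL : ∀ t s, MemLp (X t s) 2 P)
    (hX : HasSpectralDensity X P (fun x y => g x y * hDensity H₁ H₂ c x y))
    {α β μ H γ : ℝ} (hα : 0 < α) (hβ : 0 < β) (hexp : 2 * H = 2 + 2 * γ - α - β + μ * H₁)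
    {x y x' y' : ℝ} {hlim hbar : ℝ × ℝ → ℝ} {Alim Blim : ℝ → ℂ} {Abar Bbar : ℝ → ℝ}
    (hAbar : ∀ᶠ n : ℕ in atTop, ∀ u : ℝ, |u / (n : ℝ) ^ α| ≤ Real.pi →
      ‖dirichletCross n x x' (u / (n : ℝ) ^ α)‖ ≤ Abar u)
    (hBbar : ∀ᶠ n : ℕ in atTop, ∀ v : ℝ, |v / (n : ℝ) ^ β| ≤ Real.pi →
      ‖dirichletCross ((n : ℝ) ^ γ) y y' (v / (n : ℝ) ^ β)‖ ≤ Bbar v)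
    (hAlim : ∀ u : ℝ, u ≠ 0 → Tendsto (fun n : ℕ => dirichletCross n x x' (u / (n : ℝ) ^ α)) atTop
      (𝓝 (Alim u)))
    (hBlim : ∀ v : ℝ, v ≠ 0 → Tendsto (fun n : ℕ =>
      dirichletCross ((n : ℝ) ^ γ) y y' (v / (n : ℝ) ^ β)) atTop (𝓝 (Blim v)))
    (hhbar : ∀ᶠ n : ℕ in atTop, ∀ u v : ℝ, u ≠ 0 → v ≠ 0 → hDensity H₁ H₂ c
      ((n : ℝ) ^ (μ - α) * u) ((n : ℝ) ^ (μ * (H₁ / H₂) - β) * v) ≤ hbar (u, v))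
    (hhlim : ∀ u v : ℝ, u ≠ 0 → v ≠ 0 → Tendsto (fun n : ℕ => hDensity H₁ H₂ c
      ((n : ℝ) ^ (μ - α) * u) ((n : ℝ) ^ (μ * (H₁ / H₂) - β) * v)) atTop (𝓝 (hlim (u, v))))
    (hbar_nonneg : ∀ p, 0 ≤ hbar p) (hA0 : ∀ u, 0 ≤ Abar u) (hB0 : ∀ v, 0 ≤ Bbar v)
    (hbound : Integrable (fun p : ℝ × ℝ => Abar p.1 * Bbar p.2 * hbar p)) :
    Tendsto (fun n : ℕ => cov[fun ω => (n : ℝ) ^ (-H) * partialSum X γ n x y ω,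
      fun ω => (n : ℝ) ^ (-H) * partialSum X γ n x' y' ω; P]) atTop
      (𝓝 (∫ p : ℝ × ℝ, Alim p.1 * Blim p.2 * ((hlim p : ℝ) : ℂ)).re) := by
  have hpow : ∀ s : ℝ, 0 < s → Tendsto (fun n : ℕ => (n : ℝ) ^ s) atTop atTop := fun s hs =>
    (tendsto_rpow_atTop hs).comp tendsto_natCast_atTop_atTop
  have key := tendsto_spectral_integral (H₁ := H₁) (H₂ := H₂) (c := c) hg_bdd hg_cont hg_zero
    hX.integrable (σ := fun n => ((n : ℝ) ^ (-H)) ^ 2 * ((n : ℝ) ^ 2 * ((n : ℝ) ^ γ) ^ 2))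
    (hpow α hα) (hpow β hβ) (A := fun n => dirichletCross n x x')
    (B := fun n => dirichletCross ((n : ℝ) ^ γ) y y') (fun n => continuous_dirichletCross _ _ _)
    (fun n => continuous_dirichletCross _ _ _)
    (h := fun n p => hDensity H₁ H₂ c ((n : ℝ) ^ (μ - α) * p.1)
      ((n : ℝ) ^ (μ * (H₁ / H₂) - β) * p.2)) ?_ hAbar hBbar hAlim hBlim ?_ hhlim hbar_nonneg
    hA0 hB0 hbound
  · have h1 := (Complex.continuous_re.tendsto _).comp key
    refine h1.congr' ?_
    filter_upwards [eventually_gt_atTop 0] with n hn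
    have := congrArg Complex.re (cov_partialSum hL hX (γ := γ) hn H x y x' y')
    rw [Complex.ofReal_re] at this
    exact this.symm
  · filter_upwards [eventually_gt_atTop 0] with n hn u v
    have hn' : (0 : ℝ) < n := by exact_mod_cast hn
    -- Homogeneity with t = n^μ; the parameter μ is free, to be chosen so that the rescaled h
    -- converges.
    have h1 := hDensity_scale (H₁ := H₁) (H₂ := H₂) hH₁ hH₂ hc (Real.rpow_pos_of_pos hn' μ)
      ((n : ℝ) ^ (μ - α) * u) ((n : ℝ) ^ (μ * (H₁ / H₂) - β) * v)
    have e1 : (n : ℝ) ^ (μ - α) * u / (n : ℝ) ^ μ = u / (n : ℝ) ^ α := by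
      rw [Real.rpow_sub hn']
      field_simp
    have e2 : (n : ℝ) ^ (μ * (H₁ / H₂) - β) * v / ((n : ℝ) ^ μ) ^ (H₁ / H₂) = v / (n : ℝ) ^ β := by
      rw [← Real.rpow_mul hn'.le, Real.rpow_sub hn']
      field_simp
    rw [e1, e2] at h1
    rw [h1, ← mul_assoc]
    -- Balance of powers of n: normalization -2H, Dirichlet sums 2 + 2γ, Jacobian -α - β,
    -- homogeneity μH₁. By `hexp` they sum to zero.
    have e3 : ((n : ℝ) ^ (-H)) ^ 2 * ((n : ℝ) ^ 2 * ((n : ℝ) ^ γ) ^ 2) *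
        ((n : ℝ) ^ α * (n : ℝ) ^ β)⁻¹ * ((n : ℝ) ^ μ) ^ H₁ = 1 := by
      rw [mul_inv, ← Real.rpow_neg hn'.le α, ← Real.rpow_neg hn'.le β, ← Real.rpow_mul hn'.le μ,
        ← Real.rpow_two, ← Real.rpow_two, ← Real.rpow_two, ← Real.rpow_mul hn'.le,
        ← Real.rpow_mul hn'.le, ← Real.rpow_add hn', ← Real.rpow_add hn', ← Real.rpow_add hn',
        ← Real.rpow_add hn', ← Real.rpow_add hn']
      rw [show -H * 2 + (2 + γ * 2) + (-α + -β) + μ * H₁ = 0 by linarith, Real.rpow_zero]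
    rw [e3, one_mul]
  · filter_upwards [hhbar] with n hn u v hu hv
    rw [abs_of_nonneg (hDensity_nonneg hc _ _)]
    exact hn u v hu hv

lemma tendsto_natCast_rpow {s : ℝ} (hs : 0 < s) :
    Tendsto (fun n : ℕ => (n : ℝ) ^ s) atTop atTop :=
  (tendsto_rpow_atTop hs).comp tendsto_natCast_atTop_atTop

lemma tendsto_natCast_rpow_zero {s : ℝ} (hs : s < 0) :
    Tendsto (fun n : ℕ => (n : ℝ) ^ s) atTop (𝓝 0) := by
  have h := (tendsto_rpow_neg_atTop (neg_pos.2 hs)).comp (tendsto_natCast_atTop_atTop (R := ℝ))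
  simpa only [neg_neg, Function.comp_def] using h

lemma dirichletCross_bound {γ x x' : ℝ} (hγ : 0 < γ) (hx : 0 < x) (hx' : 0 < x') :
    ∀ᶠ n : ℕ in atTop, ∀ u : ℝ, |u / (n : ℝ) ^ γ| ≤ Real.pi →
      ‖dirichletCross ((n : ℝ) ^ γ) x x' (u / (n : ℝ) ^ γ)‖ ≤
        (x * x' + Real.pi ^ 2) * (1 + u ^ 2)⁻¹ := by
  filter_upwards [(tendsto_natCast_rpow hγ).eventually_gt_atTop 0] with n hn u hu
  exact norm_dirichletCross_le_japanese hn hx hx' hu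

lemma dirichletCross_low_bound {γ β x x' : ℝ} (hγ : 0 < γ) (hx : 0 < x) (hx' : 0 < x') :
    ∀ᶠ n : ℕ in atTop, ∀ u : ℝ, |u / (n : ℝ) ^ β| ≤ Real.pi →
      ‖dirichletCross ((n : ℝ) ^ γ) x x' (u / (n : ℝ) ^ β)‖ ≤ x * x' := by
  filter_upwards [(tendsto_natCast_rpow hγ).eventually_gt_atTop 0] with n hn u _
  exact norm_dirichletCross_le hn hx hx' _

/-- A sum of about n^γ terms does not resolve frequencies of order n^(-β) with β > γ: every
exponential in it is asymptotically 1. -/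
lemma dirichletCross_low_tendsto {γ β x x' : ℝ} (hγ : 0 < γ) (hβ : γ < β) (hx : 0 < x)
    (hx' : 0 < x') (u : ℝ) :
    Tendsto (fun n : ℕ => dirichletCross ((n : ℝ) ^ γ) x x' (u / (n : ℝ) ^ β)) atTop
      (𝓝 ((x * x' : ℝ) : ℂ)) := by
  refine tendsto_dirichletCross_low (tendsto_natCast_rpow hγ) ?_ hx hx'
  have h := (tendsto_natCast_rpow_zero (sub_neg.2 hβ)).mul_const u
  rw [zero_mul] at h
  refine h.congr' ?_
  filter_upwards [eventually_gt_atTop 0] with n hn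
  have hn' : (0 : ℝ) < n := by exact_mod_cast hn
  rw [Real.rpow_sub hn']
  ring

lemma integrable_japanese_weight {w : ℝ × ℝ → ℝ} (hw : IsWeight w) (a b : ℝ) :
    Integrable (fun p : ℝ × ℝ => a * (1 + p.1 ^ 2)⁻¹ * (b * (1 + p.2 ^ 2)⁻¹) * w p) := by
  refine (hw.2.2.const_mul (a * b)).congr (Eventually.of_forall fun p => ?_)
  ring

variable (hc : 0 < c) (hH₁ : 0 < H₁) (hH : H₁ ≤ H₂)
  (hg_bdd : ∃ M : ℝ, ∀ x ∈ Set.Icc (-Real.pi) Real.pi, ∀ y ∈ Set.Icc (-Real.pi) Real.pi,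
    |g x y| ≤ M)
  (hg_cont : ContinuousAt (fun p : ℝ × ℝ => g p.1 p.2) (0, 0)) (hg_zero : g 0 0 = 1)
  (hL : ∀ t s, MemLp (X t s) 2 P)
  (hX : HasSpectralDensity X P (fun x y => g x y * hDensity H₁ H₂ c x y))
  {x y x' y' : ℝ} (hx : 0 < x) (hy : 0 < y) (hx' : 0 < x') (hy' : 0 < y')

include hc hH₁ hH hg_bdd hg_cont hg_zero hL hX hx hy hx' hy'

/-- With α = μ = 1 and β = γ₀ both arguments of h keep coefficient 1, so h is its own limit and
majorant. -/
theorem tendsto_cov_balanced (hH₁_ne : H₁ ≠ 1) (hHH : H₁ * H₂ < H₁ + H₂) :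
    Tendsto (fun n : ℕ => cov[
      fun ω => (n : ℝ) ^ (-((H₁ + H₂ + H₁ * H₂) / (2 * H₂))) * partialSum X (H₁ / H₂) n x y ω,
      fun ω => (n : ℝ) ^ (-((H₁ + H₂ + H₁ * H₂) / (2 * H₂))) * partialSum X (H₁ / H₂) n x' y' ω; P])
      atTop
      (𝓝 (∫ z : ℝ × ℝ, incRe x x' z.1 * incRe y y' z.2 * hDensity H₁ H₂ c z.1 z.2)) := by
  have hH₂ : 0 < H₂ := hH₁.trans_le hH
  have hγ : 0 < H₁ / H₂ := by positivity
  have hw := isWeight_hDensity hc hH₁ hH hH₁_ne hHH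
  rw [← re_integral_incCross hw (fun u v => hDensity_neg_left u v)]
  have hA := dirichletCross_bound one_pos hx hx'
  simp only [Real.rpow_one] at hA
  refine tendsto_cov_partialSum hc hH₁ hH₂ hg_bdd hg_cont hg_zero hL hX (α := 1) (β := H₁ / H₂)
    (μ := 1) one_pos hγ (by field_simp; ring)
    (Abar := fun u => (x * x' + Real.pi ^ 2) * (1 + u ^ 2)⁻¹)
    (Bbar := fun v => (y * y' + Real.pi ^ 2) * (1 + v ^ 2)⁻¹)
    (hbar := fun p => hDensity H₁ H₂ c p.1 p.2) (by simpa only [Real.rpow_one] using hA)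
    (dirichletCross_bound hγ hy hy')
    (fun u hu => ?_) (fun v hv => tendsto_dirichletCross_kernel (tendsto_natCast_rpow hγ) hy hy' hv)
    (Eventually.of_forall fun n u v _ _ => ?_) (fun u v _ _ => ?_) hw.2.1 (fun u => by positivity)
    (fun v => by positivity) (integrable_japanese_weight hw _ _)
  · simp only [Real.rpow_one]
    exact tendsto_dirichletCross_kernel tendsto_natCast_atTop_atTop hx hx' hu
  · simp
  · simp

/-- On the natural scales with μ = 1, v enters h with the coefficient n^(γ₀-γ) → 0, so h(u, ·) tends
to h(u,0) = |u|^(-H₁), which is also the majorant. -/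
theorem tendsto_cov_plus_of_lt {γ : ℝ} (hγ : H₁ / H₂ < γ) (h1 : H₁ < 1) :
    Tendsto (fun n : ℕ => cov[
      fun ω => (n : ℝ) ^ (-((1 + γ + H₁) / 2)) * partialSum X γ n x y ω,
      fun ω => (n : ℝ) ^ (-((1 + γ + H₁) / 2)) * partialSum X γ n x' y' ω; P]) atTop
      (𝓝 (∫ z : ℝ × ℝ, incRe x x' z.1 * incRe y y' z.2 * |z.1| ^ (-H₁))) := by
  have hH₂ : 0 < H₂ := hH₁.trans_le hH
  have hγ0 : 0 < γ := lt_trans (by positivity) hγ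
  have hw := isWeight_left hH₁.le h1
  rw [← re_integral_incCross hw (fun u v => by simp)]
  have hA := dirichletCross_bound one_pos hx hx'
  simp only [Real.rpow_one] at hA
  refine tendsto_cov_partialSum hc hH₁ hH₂ hg_bdd hg_cont hg_zero hL hX (α := 1) (β := γ)
    (μ := 1) one_pos hγ0 (by ring)
    (Abar := fun u => (x * x' + Real.pi ^ 2) * (1 + u ^ 2)⁻¹)
    (Bbar := fun v => (y * y' + Real.pi ^ 2) * (1 + v ^ 2)⁻¹)
    (hbar := fun p => |p.1| ^ (-H₁)) (by simpa only [Real.rpow_one] using hA)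
    (dirichletCross_bound hγ0 hy hy')
    (fun u hu => ?_) (fun v hv => tendsto_dirichletCross_kernel (tendsto_natCast_rpow hγ0) hy hy' hv)
    (Eventually.of_forall fun n u v hu _ => ?_) (fun u v hu _ => ?_) hw.2.1 (fun u => by positivity)
    (fun v => by positivity) (integrable_japanese_weight hw _ _)
  · simp only [Real.rpow_one]
    exact tendsto_dirichletCross_kernel tendsto_natCast_atTop_atTop hx hx' hu
  · rw [sub_self, Real.rpow_zero, one_mul]
    exact hDensity_le_left hc hH₁ hu _
  · simp only [sub_self, Real.rpow_zero, one_mul]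
    rw [← hDensity_zero_right (c := c) hH₁ hH₂]
    have h2 : Tendsto (fun n : ℕ => (u, (n : ℝ) ^ (H₁ / H₂ - γ) * v)) atTop (𝓝 (u, 0)) := by
      have := (tendsto_natCast_rpow_zero (sub_neg.2 hγ)).mul_const v
      rw [zero_mul] at this
      exact tendsto_const_nhds.prodMk_nhds this
    have h3 := (continuousAt_hDensity hH₁ hH₂ hc (p := (u, 0)) (by simp [hu])).tendsto.comp h2
    simpa only [Function.comp_def] using h3

/-- Now μ = γ/γ₀ < 1 fixes the argument v and gives u the coefficient n^(μ-1) → 0, so the limiting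
density is h(0,v). -/
theorem tendsto_cov_minus_of_lt {γ : ℝ} (hγ0 : 0 < γ) (hγ : γ < H₁ / H₂) (h1 : H₂ < 1) :
    Tendsto (fun n : ℕ => cov[
      fun ω => (n : ℝ) ^ (-((1 + γ + γ * H₂) / 2)) * partialSum X γ n x y ω,
      fun ω => (n : ℝ) ^ (-((1 + γ + γ * H₂) / 2)) * partialSum X γ n x' y' ω; P]) atTop
      (𝓝 (c ^ (-H₁ / 2) *
        ∫ z : ℝ × ℝ, incRe x x' z.1 * incRe y y' z.2 * |z.2| ^ (-H₂))) := by
  have hH₂ : 0 < H₂ := hH₁.trans_le hH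
  have hc' : 0 ≤ c ^ (-H₁ / 2) := by positivity
  have hw := isWeight_right hH₂.le h1
  have hw' : IsWeight (fun p : ℝ × ℝ => c ^ (-H₁ / 2) * |p.2| ^ (-H₂)) :=
    ⟨hw.1.const_mul _, fun p => mul_nonneg hc' (hw.2.1 p),
      (hw.2.2.const_mul (c ^ (-H₁ / 2))).congr (Eventually.of_forall fun p => by ring)⟩
  have e : c ^ (-H₁ / 2) * ∫ z : ℝ × ℝ, incRe x x' z.1 * incRe y y' z.2 * |z.2| ^ (-H₂) =
      ∫ z : ℝ × ℝ, incRe x x' z.1 * incRe y y' z.2 * (c ^ (-H₁ / 2) * |z.2| ^ (-H₂)) := by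
    rw [← integral_const_mul]
    refine integral_congr_ae (Eventually.of_forall fun p => ?_)
    simp only
    ring
  rw [e, ← re_integral_incCross hw' (fun u v => by simp)]
  have hA := dirichletCross_bound one_pos hx hx'
  simp only [Real.rpow_one] at hA
  have hμ : γ * H₂ / H₁ - 1 < 0 := by
    rw [sub_neg, div_lt_one hH₁]
    rwa [lt_div_iff₀ hH₂] at hγ
  refine tendsto_cov_partialSum hc hH₁ hH₂ hg_bdd hg_cont hg_zero hL hX (α := 1) (β := γ)
    (μ := γ * H₂ / H₁) one_pos hγ0 (by field_simp; ring)
    (Abar := fun u => (x * x' + Real.pi ^ 2) * (1 + u ^ 2)⁻¹)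
    (Bbar := fun v => (y * y' + Real.pi ^ 2) * (1 + v ^ 2)⁻¹)
    (hbar := fun p => c ^ (-H₁ / 2) * |p.2| ^ (-H₂)) (by simpa only [Real.rpow_one] using hA)
    (dirichletCross_bound hγ0 hy hy')
    (fun u hu => ?_) (fun v hv => tendsto_dirichletCross_kernel (tendsto_natCast_rpow hγ0) hy hy' hv)
    (Eventually.of_forall fun n u v _ hv => ?_) (fun u v _ hv => ?_) hw'.2.1
    (fun u => by positivity) (fun v => by positivity) (integrable_japanese_weight hw' _ _)
  · simp only [Real.rpow_one]
    exact tendsto_dirichletCross_kernel tendsto_natCast_atTop_atTop hx hx' hu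
  · rw [show γ * H₂ / H₁ * (H₁ / H₂) - γ = 0 by field_simp; ring, Real.rpow_zero, one_mul]
    exact hDensity_le_right hc hH₁ _ hv
  · simp only [show γ * H₂ / H₁ * (H₁ / H₂) - γ = 0 by field_simp; ring, Real.rpow_zero, one_mul]
    rw [← hDensity_zero_left hH₁ hc]
    have h2 : Tendsto (fun n : ℕ => ((n : ℝ) ^ (γ * H₂ / H₁ - 1) * u, v)) atTop (𝓝 (0, v)) := by
      have := (tendsto_natCast_rpow_zero hμ).mul_const u
      rw [zero_mul] at this
      exact this.prodMk_nhds tendsto_const_nhds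
    have h3 := (continuousAt_hDensity hH₁ hH₂ hc (p := (0, v)) (by simp [hv])).tendsto.comp h2
    simpa only [Function.comp_def] using h3

/-- The frequencies u live on the scale n^(-γ/γ₀), much smaller than 1/n, and v on n^(-γ). This
scaling leaves h unchanged while the sum over t contributes only xx'; integrability in u comes from
h alone. -/
theorem tendsto_cov_plus_of_gt {γ : ℝ} (hγ : H₁ / H₂ < γ) (h1 : 1 < H₁)
    (hHH : H₁ * H₂ < H₁ + H₂) :
    Tendsto (fun n : ℕ => cov[
      fun ω => (n : ℝ) ^ (-((γ * H₁ + γ * H₁ * H₂ - γ * H₂ + 2 * H₁) / (2 * H₁))) *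
        partialSum X γ n x y ω,
      fun ω => (n : ℝ) ^ (-((γ * H₁ + γ * H₁ * H₂ - γ * H₂ + 2 * H₁) / (2 * H₁))) *
        partialSum X γ n x' y' ω; P]) atTop
      (𝓝 (rho₁ H₁ ^ 2 * c ^ ((1 - H₁) / 2) * (x * x') *
        ∫ v : ℝ, incRe y y' v * |v| ^ (-((H₁ * H₂ - H₂) / H₁)))) := by
  have hH₂ : 0 < H₂ := hH₁.trans_le hH
  have hγ0 : 0 < γ := lt_trans (by positivity) hγ
  have hα : 1 < γ * H₂ / H₁ := by
    rw [one_lt_div hH₁]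
    rwa [div_lt_iff₀ hH₂] at hγ
  have hα0 : 0 ≤ (H₁ * H₂ - H₂) / H₁ := div_nonneg (by nlinarith) hH₁.le
  have hα1 : (H₁ * H₂ - H₂) / H₁ < 1 := by rw [div_lt_one hH₁]; linarith
  have hbound : Integrable (fun p : ℝ × ℝ =>
      x * x' * ((y * y' + Real.pi ^ 2) * (1 + p.2 ^ 2)⁻¹) * hDensity H₁ H₂ c p.1 p.2) :=
    ((integrable_hDensity_of_left hc h1 hH hHH).const_mul (x * x' * (y * y' + Real.pi ^ 2))).congr
      (Eventually.of_forall fun p => by ring)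
  have hlow := dirichletCross_low_bound (β := γ * H₂ / H₁) one_pos hx hx'
  have hlow' := dirichletCross_low_tendsto one_pos hα hx hx'
  simp only [Real.rpow_one] at hlow hlow'
  have key := tendsto_cov_partialSum hc hH₁ hH₂ hg_bdd hg_cont hg_zero hL hX (α := γ * H₂ / H₁)
    (β := γ) (μ := γ * H₂ / H₁) (H := (γ * H₁ + γ * H₁ * H₂ - γ * H₂ + 2 * H₁) / (2 * H₁)) (γ := γ)
    (by linarith) hγ0 (by field_simp; ring)
    (Abar := fun u => x * x')
    (Bbar := fun v => (y * y' + Real.pi ^ 2) * (1 + v ^ 2)⁻¹)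
    (hbar := fun p => hDensity H₁ H₂ c p.1 p.2) (hlim := fun p => hDensity H₁ H₂ c p.1 p.2)
    hlow (dirichletCross_bound hγ0 hy hy')
    (fun u _ => hlow' u)
    (fun v hv => tendsto_dirichletCross_kernel (tendsto_natCast_rpow hγ0) hy hy' hv)
    (Eventually.of_forall fun n u v _ _ => ?_) (fun u v _ _ => ?_)
    (fun p => hDensity_nonneg hc _ _) (fun u => by positivity) (fun v => by positivity) hbound
  · have hint : Integrable (fun p : ℝ × ℝ => ((x * x' : ℝ) : ℂ) * incCross y y' p.2 *
        ((hDensity H₁ H₂ c p.1 p.2 : ℝ) : ℂ)) := by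
      refine ((integrable_hDensity_of_left hc h1 hH hHH).const_mul
        (x * x' * (y ^ 2 + y' ^ 2 + 4))).mono' ?_ (Eventually.of_forall fun p => ?_)
      · exact ((((measurable_incCross y y').comp measurable_snd).const_mul _).mul
          (Complex.measurable_ofReal.comp measurable_hDensity)).aestronglyMeasurable
      · rw [norm_mul, norm_mul, Complex.norm_real, Complex.norm_real,
          Real.norm_of_nonneg (hDensity_nonneg hc _ _), Real.norm_of_nonneg (by positivity)]
        calc _ ≤ x * x' * ((y ^ 2 + y' ^ 2 + 4) * (1 + p.2 ^ 2)⁻¹) * hDensity H₁ H₂ c p.1 p.2 :=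
              mul_le_mul_of_nonneg_right (mul_le_mul_of_nonneg_left (norm_incCross_le y y' p.2)
                (by positivity)) (hDensity_nonneg hc _ _)
          _ = _ := by ring
    -- Now u occurs in h alone, and Fubini integrates it out into the constant ρ₁² and a power of
    -- |v|.
    have h2 : ∫ p : ℝ × ℝ, ((x * x' : ℝ) : ℂ) * incCross y y' p.2 *
        ((hDensity H₁ H₂ c p.1 p.2 : ℝ) : ℂ) =
        ((rho₁ H₁ ^ 2 * c ^ ((1 - H₁) / 2) * (x * x') : ℝ) : ℂ) *
          ∫ v : ℝ, incCross y y' v * ((|v| ^ (-((H₁ * H₂ - H₂) / H₁)) : ℝ) : ℂ) := by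
      rw [Measure.volume_eq_prod] at hint ⊢
      rw [integral_prod_symm _ hint, ← integral_const_mul]
      refine integral_congr_ae ?_
      have h0 : ∀ᵐ v : ℝ, v ≠ 0 := by simp [ae_iff, measure_singleton]
      filter_upwards [h0] with v hv
      rw [integral_const_mul, integral_complex_ofReal, (integral_hDensity_left hc h1 hv).2]
      push_cast
      ring
    rw [h2, Complex.re_ofReal_mul, re_integral_incCross_rpow hα0 hα1] at key
    exact key
  · rw [show γ * H₂ / H₁ * (H₁ / H₂) - γ = 0 by field_simp; ring, sub_self, Real.rpow_zero,
      one_mul, one_mul]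
  · simp only [show γ * H₂ / H₁ * (H₁ / H₂) - γ = 0 by field_simp; ring, sub_self, Real.rpow_zero,
      one_mul]
    exact tendsto_const_nhds

/-- The frequencies v live on the scale n^(-γ₀), below n^(-γ) because γ < γ₀. The sum over s
contributes only yy', and h is integrated over v. -/
theorem tendsto_cov_minus_of_gt {γ : ℝ} (hγ0 : 0 < γ) (hγ : γ < H₁ / H₂) (h1 : 1 < H₂)
    (hHH : H₁ * H₂ < H₁ + H₂) :
    Tendsto (fun n : ℕ => cov[
      fun ω => (n : ℝ) ^ (-((H₂ + H₁ * H₂ - H₁ + 2 * γ * H₂) / (2 * H₂))) *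
        partialSum X γ n x y ω,
      fun ω => (n : ℝ) ^ (-((H₂ + H₁ * H₂ - H₁ + 2 * γ * H₂) / (2 * H₂))) *
        partialSum X γ n x' y' ω; P]) atTop
      (𝓝 (rho₂ H₁ H₂ ^ 2 * c ^ (-H₁ / (2 * H₂)) * (y * y') *
        ∫ u : ℝ, incRe x x' u * |u| ^ (-((H₁ * H₂ - H₁) / H₂)))) := by
  have hH₂ : 0 < H₂ := hH₁.trans_le hH
  have hα0 : 0 ≤ (H₁ * H₂ - H₁) / H₂ := div_nonneg (by nlinarith) hH₂.le
  have hα1 : (H₁ * H₂ - H₁) / H₂ < 1 := by rw [div_lt_one hH₂]; linarith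
  have hI := integrable_hDensity_of_right (c := c) hc hH₁ h1 hHH
  have hbound : Integrable (fun p : ℝ × ℝ =>
      (x * x' + Real.pi ^ 2) * (1 + p.1 ^ 2)⁻¹ * (y * y') * hDensity H₁ H₂ c p.1 p.2) :=
    (hI.const_mul (y * y' * (x * x' + Real.pi ^ 2))).congr
      (Eventually.of_forall fun p => by ring)
  have hA := dirichletCross_bound one_pos hx hx'
  simp only [Real.rpow_one] at hA
  have key := tendsto_cov_partialSum hc hH₁ hH₂ hg_bdd hg_cont hg_zero hL hX (α := 1)
    (β := H₁ / H₂) (μ := 1) (H := (H₂ + H₁ * H₂ - H₁ + 2 * γ * H₂) / (2 * H₂)) (γ := γ)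
    one_pos (by positivity) (by field_simp; ring)
    (Abar := fun u => (x * x' + Real.pi ^ 2) * (1 + u ^ 2)⁻¹)
    (Bbar := fun _ => y * y') (Alim := incCross x x')
    (hbar := fun p => hDensity H₁ H₂ c p.1 p.2) (hlim := fun p => hDensity H₁ H₂ c p.1 p.2)
    (by simpa only [Real.rpow_one] using hA) (dirichletCross_low_bound hγ0 hy hy')
    (fun u hu => ?_) (fun v _ => dirichletCross_low_tendsto hγ0 hγ hy hy' v)
    (Eventually.of_forall fun n u v _ _ => ?_) (fun u v _ _ => ?_)
    (fun p => hDensity_nonneg hc _ _) (fun u => by positivity) (fun v => by positivity) hbound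
  · have hint : Integrable (fun p : ℝ × ℝ => incCross x x' p.1 * ((y * y' : ℝ) : ℂ) *
        ((hDensity H₁ H₂ c p.1 p.2 : ℝ) : ℂ)) := by
      refine (hI.const_mul (y * y' * (x ^ 2 + x' ^ 2 + 4))).mono' ?_
        (Eventually.of_forall fun p => ?_)
      · exact ((((measurable_incCross x x').comp measurable_fst).mul_const _).mul
          (Complex.measurable_ofReal.comp measurable_hDensity)).aestronglyMeasurable
      · rw [norm_mul, norm_mul, Complex.norm_real, Complex.norm_real,
          Real.norm_of_nonneg (hDensity_nonneg hc _ _), Real.norm_of_nonneg (by positivity)]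
        calc _ ≤ ((x ^ 2 + x' ^ 2 + 4) * (1 + p.1 ^ 2)⁻¹) * (y * y') * hDensity H₁ H₂ c p.1 p.2 :=
              mul_le_mul_of_nonneg_right (mul_le_mul_of_nonneg_right (norm_incCross_le x x' p.1)
                (by positivity)) (hDensity_nonneg hc _ _)
          _ = _ := by ring
    have h2 : ∫ p : ℝ × ℝ, incCross x x' p.1 * ((y * y' : ℝ) : ℂ) *
        ((hDensity H₁ H₂ c p.1 p.2 : ℝ) : ℂ) =
        ((rho₂ H₁ H₂ ^ 2 * c ^ (-H₁ / (2 * H₂)) * (y * y') : ℝ) : ℂ) *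
          ∫ u : ℝ, incCross x x' u * ((|u| ^ (-((H₁ * H₂ - H₁) / H₂)) : ℝ) : ℂ) := by
      rw [Measure.volume_eq_prod] at hint ⊢
      rw [integral_prod _ hint, ← integral_const_mul]
      refine integral_congr_ae ?_
      have h0 : ∀ᵐ v : ℝ, v ≠ 0 := by simp [ae_iff, measure_singleton]
      filter_upwards [h0] with v hv
      rw [integral_const_mul, integral_complex_ofReal, (integral_hDensity_right hc hH₁ h1 hv).2]
      push_cast
      ring
    rw [h2, Complex.re_ofReal_mul, re_integral_incCross_rpow hα0 hα1] at key
    exact key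
  · simp only [Real.rpow_one]
    exact tendsto_dirichletCross_kernel tendsto_natCast_atTop_atTop hx hx' hu
  · simp
  · simp

end Convergence

/-! ### Covariances of increments from structure functions -/

section StructureFunction

/-- The covariance `½(σ(x) + σ(x') - σ(x - x'))` with structure function `σ`. -/
noncomputable def sfCov (σ : ℝ → ℝ) (x x' : ℝ) : ℝ := 2⁻¹ * (σ x + σ x' - σ (x - x'))

/-- The covariance of the increments over `[a, b]` and `[a', b']` for the structure function `σ`. -/
noncomputable def sfInc (σ : ℝ → ℝ) (a b a' b' : ℝ) : ℝ :=
  2⁻¹ * (σ (b - a') + σ (a - b') - σ (b - b') - σ (a - a'))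

/-- The terms depending on a single endpoint cancel; only differences of endpoints survive, whence
stationarity of increments. -/
lemma sfCov_increments (σ : ℝ → ℝ) (a b a' b' : ℝ) :
    sfCov σ b b' - sfCov σ a b' - sfCov σ b a' + sfCov σ a a' = sfInc σ a b a' b' := by
  simp only [sfCov, sfInc]
  ring

lemma sfInc_translate (σ : ℝ → ℝ) (a b b' : ℝ) :
    sfInc σ a b a b' = sfInc σ 0 (b - a) 0 (b' - a) := by
  simp only [sfInc]
  ring_nf

end StructureFunction

/-! ### Rectangular increments of Gaussian fields -/

section Increments

variable {Ω : Type*} [MeasurableSpace Ω] {P : Measure Ω} [IsProbabilityMeasure P]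
  {V : ℝ → ℝ → Ω → ℝ} {K : ℝ × ℝ → ℝ × ℝ → ℝ}

omit [IsProbabilityMeasure P] in
lemma IsCenteredGaussianField.memLp (hV : IsCenteredGaussianField V P K) (x y : ℝ) :
    MemLp (V x y) 2 P :=
  (hV.gaussian.hasGaussianLaw_eval (x, y)).memLp_two

omit [IsProbabilityMeasure P] in
lemma IsCenteredGaussianField.variance_eq (hV : IsCenteredGaussianField V P K) (x y : ℝ) :
    Var[V x y; P] = K (x, y) (x, y) := by
  rw [← covariance_self (hV.memLp x y).aemeasurable]
  exact hV.covariance_eq (x, y) (x, y)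

omit [IsProbabilityMeasure P] in
lemma IsCenteredGaussianField.gaussian_increment (hV : IsCenteredGaussianField V P K) :
    IsGaussianProcess (fun (r : ℝ × ℝ × ℝ × ℝ) ω => increment V r.1 r.2.1 r.2.2.1 r.2.2.2 ω) P := by
  classical
  refine hV.gaussian.of_isGaussianProcess fun r =>
    ⟨{(r.2.2.1, r.2.2.2), (r.1, r.2.2.2), (r.2.2.1, r.2.1), (r.1, r.2.1)},
      ContinuousLinearMap.proj ⟨(r.2.2.1, r.2.2.2), by simp⟩ -
      ContinuousLinearMap.proj ⟨(r.1, r.2.2.2), by simp⟩ -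
      ContinuousLinearMap.proj ⟨(r.2.2.1, r.2.1), by simp⟩ +
      ContinuousLinearMap.proj ⟨(r.1, r.2.1), by simp⟩, fun ω => ?_⟩
  simp [increment]

omit [IsProbabilityMeasure P] in
lemma IsCenteredGaussianField.memLp_increment (hV : IsCenteredGaussianField V P K) (u v x y : ℝ) :
    MemLp (increment V u v x y) 2 P :=
  (hV.gaussian_increment.hasGaussianLaw_eval (u, v, x, y)).memLp_two

lemma IsCenteredGaussianField.integral_increment (hV : IsCenteredGaussianField V P K)
    (u v x y : ℝ) : ∫ ω, increment V u v x y ω ∂P = 0 := by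
  have h1 : ∀ x y, Integrable (V x y) P := fun x y => (hV.memLp x y).integrable one_le_two
  have h2 : ∀ x y, ∫ ω, V x y ω ∂P = 0 := fun x y => hV.mean_zero (x, y)
  simp only [increment]
  rw [integral_add (by exact ((h1 x y).sub (h1 u y)).sub (h1 x v)) (h1 u v),
    integral_sub (by exact (h1 x y).sub (h1 u y)) (h1 x v), integral_sub (h1 x y) (h1 u y)]
  simp [h2]

lemma IsCenteredGaussianField.covariance_increment_left (hV : IsCenteredGaussianField V P K)
    (u v x y : ℝ) {Z : Ω → ℝ} (hZ : MemLp Z 2 P) :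
    cov[increment V u v x y, Z; P] =
      cov[V x y, Z; P] - cov[V u y, Z; P] - cov[V x v, Z; P] + cov[V u v, Z; P] := by
  have e : increment V u v x y = V x y - V u y - V x v + V u v := rfl
  rw [e, covariance_add_left (((hV.memLp x y).sub (hV.memLp u y)).sub (hV.memLp x v))
    (hV.memLp u v) hZ, covariance_sub_left ((hV.memLp x y).sub (hV.memLp u y)) (hV.memLp x v) hZ,
    covariance_sub_left (hV.memLp x y) (hV.memLp u y) hZ]

/-- Covariances of increments in terms of the covariance function. -/
lemma IsCenteredGaussianField.covariance_increment (hV : IsCenteredGaussianField V P K)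
    (u v x y u' v' x' y' : ℝ) :
    cov[increment V u v x y, increment V u' v' x' y'; P] =
      (K (x, y) (x', y') - K (u, y) (x', y') - K (x, v) (x', y') + K (u, v) (x', y')) -
      (K (x, y) (u', y') - K (u, y) (u', y') - K (x, v) (u', y') + K (u, v) (u', y')) -
      (K (x, y) (x', v') - K (u, y) (x', v') - K (x, v) (x', v') + K (u, v) (x', v')) +
      (K (x, y) (u', v') - K (u, y) (u', v') - K (x, v) (u', v') + K (u, v) (u', v')) := by
  have h : ∀ a b a' b', cov[V a b, V a' b'; P] = K (a, b) (a', b') := fun a b a' b' =>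
    hV.covariance_eq (a, b) (a', b')
  have h2 : ∀ a b, cov[V a b, increment V u' v' x' y'; P] =
      K (a, b) (x', y') - K (a, b) (u', y') - K (a, b) (x', v') + K (a, b) (u', v') := by
    intro a b
    rw [covariance_comm, hV.covariance_increment_left _ _ _ _ (hV.memLp a b)]
    rw [covariance_comm (V x' y'), covariance_comm (V u' y'), covariance_comm (V x' v'),
      covariance_comm (V u' v'), h, h, h, h]
  rw [hV.covariance_increment_left _ _ _ _ (hV.memLp_increment _ _ _ _), h2, h2, h2, h2]
  ring

lemma IsCenteredGaussianField.ae_eq_zero (hV : IsCenteredGaussianField V P K) {x y : ℝ}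
    (h : K (x, y) (x, y) = 0) : V x y =ᵐ[P] 0 := by
  have h1 := ae_eq_integral_of_variance_eq_zero (hV.memLp x y) ((hV.variance_eq x y).trans h)
  rw [hV.mean_zero (x, y)] at h1
  exact h1

omit [IsProbabilityMeasure P] in
lemma IsCenteredGaussianField.not_ae_eq_zero (hV : IsCenteredGaussianField V P K) {x y : ℝ}
    (h : 0 < K (x, y) (x, y)) : ¬ V x y =ᵐ[P] 0 := by
  intro h0
  have h1 := hV.variance_eq x y
  rw [variance_congr h0, variance_zero] at h1
  exact h.ne h1

lemma IsCenteredGaussianField.hasStationaryIncrements (hV : IsCenteredGaussianField V P K)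
    (h : ∀ u v x y x' y', cov[increment V u v x y, increment V u v x' y'; P] =
      cov[increment V 0 0 (x - u) (y - v), increment V 0 0 (x' - u) (y' - v); P]) :
    HasStationaryIncrements V P := by
  intro u v _ _ k p _
  refine identDistrib_of_centered_gaussian (X := fun i ω => increment V u v (p i).1 (p i).2 ω)
    (Y := fun i ω => increment V 0 0 ((p i).1 - u) ((p i).2 - v) ω)
    (hasGaussianLaw_pi (hV.gaussian_increment.comp_right fun i => (u, v, (p i).1, (p i).2)))
    (fun i => hV.integral_increment _ _ _ _)
    (hasGaussianLaw_pi (hV.gaussian_increment.comp_right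
      fun i => (0, 0, (p i).1 - u, (p i).2 - v)))
    (fun i => hV.integral_increment _ _ _ _) fun i j => h _ _ _ _ _ _

omit [IsProbabilityMeasure P] in
lemma IsCenteredGaussianField.indepFun_increment (hV : IsCenteredGaussianField V P K)
    {u v x y u' v' x' y' : ℝ}
    (h : cov[increment V u v x y, increment V u' v' x' y'; P] = 0) :
    IndepFun (increment V u v x y) (increment V u' v' x' y') P :=
  (hV.gaussian_increment.hasGaussianLaw_prodMk (s := (u, v, x, y))
    (t := (u', v', x', y'))).indepFun_of_covariance_eq_zero h

/-- The two identities force the variance of the difference, a centered variable, to be zero. -/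
lemma IsCenteredGaussianField.increment_ae_eq (hV : IsCenteredGaussianField V P K)
    {u v x y u' v' x' y' : ℝ}
    (h1 : cov[increment V u v x y, increment V u v x y; P] =
      cov[increment V u v x y, increment V u' v' x' y'; P])
    (h2 : cov[increment V u' v' x' y', increment V u' v' x' y'; P] =
      cov[increment V u v x y, increment V u' v' x' y'; P]) :
    increment V u v x y =ᵐ[P] increment V u' v' x' y' := by
  have m1 := hV.memLp_increment u v x y
  have m2 := hV.memLp_increment u' v' x' y'
  have hvar : Var[increment V u v x y - increment V u' v' x' y'; P] = 0 := by
    rw [← covariance_self (m1.sub m2).aemeasurable, covariance_sub_sub m1 m2 m1 m2,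
      covariance_comm (increment V u' v' x' y') (increment V u v x y)]
    linarith
  have h3 := ae_eq_integral_of_variance_eq_zero (m1.sub m2) hvar
  have h4 : ∫ ω, (increment V u v x y - increment V u' v' x' y') ω ∂P = 0 := by
    rw [integral_sub' (m1.integrable one_le_two) (m2.integrable one_le_two),
      hV.integral_increment, hV.integral_increment, sub_zero]
  rw [h4] at h3
  filter_upwards [h3] with ω h5
  exact sub_eq_zero.1 h5

end Increments

/-! ### Fractional Brownian sheets: increments and exponents -/

section PowerFields

variable {Ω : Type*} [MeasurableSpace Ω] {P : Measure Ω} [IsProbabilityMeasure P]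
  {V : ℝ → ℝ → Ω → ℝ} {C p q : ℝ}

/-- Gaussian fields whose covariance is a multiple of the product of two fractional Brownian
covariances (fractional Brownian sheets). -/
def IsSheet (V : ℝ → ℝ → Ω → ℝ) (P : Measure Ω) (C p q : ℝ) : Prop :=
  0 < C ∧ 0 < p ∧ 0 < q ∧ IsCenteredGaussianField V P
    (fun r s => C * (powCov p r.1 s.1 * powCov q r.2 s.2))

lemma powCov_eq_sfCov (p x x' : ℝ) : powCov p x x' = sfCov (fun t => |t| ^ p) x x' := rfl

lemma powCov_self {x : ℝ} (hp : 0 < p) : powCov p x x = |x| ^ p := by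
  rw [powCov, sub_self, abs_zero, Real.zero_rpow hp.ne']
  ring

lemma IsSheet.covariance_increment (hV : IsSheet V P C p q) (u v x y u' v' x' y' : ℝ) :
    cov[increment V u v x y, increment V u' v' x' y'; P] =
      C * (sfInc (fun t => |t| ^ p) u x u' x' * sfInc (fun t => |t| ^ q) v y v' y') := by
  rw [hV.2.2.2.covariance_increment]
  simp only [powCov_eq_sfCov]
  rw [← sfCov_increments, ← sfCov_increments]
  ring

lemma IsSheet.vanishesOnAxes (hV : IsSheet V P C p q) : VanishesOnAxes V P := by
  obtain ⟨_, hp, hq, hG⟩ := hV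
  refine ⟨fun x _ => hG.ae_eq_zero ?_, fun y _ => hG.ae_eq_zero ?_⟩
  · simp only [powCov_self hq, abs_zero, Real.zero_rpow hq.ne', mul_zero]
  · simp only [powCov_self hp, abs_zero, Real.zero_rpow hp.ne', mul_zero, zero_mul]

lemma IsSheet.hasStationaryIncrements (hV : IsSheet V P C p q) : HasStationaryIncrements V P := by
  refine hV.2.2.2.hasStationaryIncrements fun u v x y x' y' => ?_
  rw [hV.covariance_increment, hV.covariance_increment, sfInc_translate, sfInc_translate _ v]

omit [IsProbabilityMeasure P] in
lemma IsSheet.variance_eq (hV : IsSheet V P C p q) {x y : ℝ} (hx : 0 < x) (hy : 0 < y) :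
    Var[V x y; P] = C * (x ^ p * y ^ q) := by
  rw [hV.2.2.2.variance_eq, powCov_self hV.2.1, powCov_self hV.2.2.1, abs_of_pos hx, abs_of_pos hy]

omit [IsProbabilityMeasure P] in
lemma IsSheet.not_ae_eq_zero (hV : IsSheet V P C p q) : ¬ V 1 1 =ᵐ[P] 0 := by
  refine hV.2.2.2.not_ae_eq_zero ?_
  simp only [powCov_self hV.2.1, powCov_self hV.2.2.1, abs_one, Real.one_rpow, mul_one]
  exact hV.1

/-- Brownian increments over disjoint intervals are uncorrelated: the four differences have the same
sign, and |t| is linear there. -/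
lemma sfInc_abs_of_le {a b a' b' : ℝ} (h1 : a ≤ b) (h2 : b ≤ a') (h3 : a' ≤ b') :
    sfInc (fun t => |t| ^ (1 : ℝ)) a b a' b' = 0 := by
  simp only [sfInc, Real.rpow_one]
  rw [abs_of_nonpos (by linarith), abs_of_nonpos (by linarith), abs_of_nonpos (by linarith),
    abs_of_nonpos (by linarith)]
  ring

lemma sfInc_abs_of_ge {a b a' b' : ℝ} (h1 : a' ≤ b') (h2 : b' ≤ a) (h3 : a ≤ b) :
    sfInc (fun t => |t| ^ (1 : ℝ)) a b a' b' = 0 := by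
  simp only [sfInc, Real.rpow_one]
  rw [abs_of_nonneg (by linarith), abs_of_nonneg (by linarith), abs_of_nonneg (by linarith),
    abs_of_nonneg (by linarith)]
  ring

/-- Only the lengths of the intervals matter, which is the source of invariant increments when an
exponent equals 2. -/
lemma sfInc_sq (a b a' b' : ℝ) :
    sfInc (fun t => |t| ^ (2 : ℝ)) a b a' b' = (b - a) * (b' - a') := by
  simp only [sfInc, Real.rpow_two, sq_abs]
  ring

/-- Rectangles are half-open, so the inequality at the left endpoint has to be recovered as a limit.
-/
lemma mul_le_of_forall_Ioc {m c u x : ℝ} (hux : u < x) (h : ∀ t ∈ Set.Ioc u x, c ≤ m * t) :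
    c ≤ m * u := by
  have h1 : Tendsto (fun t => m * t) (𝓝[>] u) (𝓝 (m * u)) :=
    ((continuous_const.mul continuous_id).tendsto u).mono_left nhdsWithin_le_nhds
  refine ge_of_tendsto h1 ?_
  filter_upwards [Ioc_mem_nhdsGT hux] with t ht
  exact h t ht

lemma Rect.separated_intervals {u x u' x' m c : ℝ} (hm : m ≠ 0) (hux : u < x) (hux' : u' < x')
    (h : (∀ t ∈ Set.Ioc u x, m * t ≤ c) ∧ ∀ t ∈ Set.Ioc u' x', c ≤ m * t) :
    x ≤ u' ∨ x' ≤ u := by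
  have h1 : m * x ≤ c := h.1 x ⟨hux, le_rfl⟩
  have h2 : c ≤ m * x' := h.2 x' ⟨hux', le_rfl⟩
  have h3 : c ≤ m * u' := mul_le_of_forall_Ioc hux' h.2
  have h4 : -c ≤ -m * u := mul_le_of_forall_Ioc hux fun t ht => by linarith [h.1 t ht]
  rcases lt_or_gt_of_ne hm with h0 | h0
  · right
    nlinarith
  · left
    nlinarith

lemma Rect.fst_mem {K : Rect} {t : ℝ} (ht : t ∈ Set.Ioc K.u K.x) : (t, K.y) ∈ K.toSet :=
  ⟨ht, K.v_lt_y, le_rfl⟩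

lemma Rect.snd_mem {K : Rect} {t : ℝ} (ht : t ∈ Set.Ioc K.v K.y) : (K.x, t) ∈ K.toSet :=
  ⟨⟨K.u_lt_x, le_rfl⟩, ht⟩

lemma Rect.SeparatedBy.fst {K K' : Rect} {m c : ℝ} (h : K.SeparatedBy K' m 0 c) (hm : m ≠ 0) :
    K.x ≤ K'.u ∨ K'.x ≤ K.u := by
  rcases h with ⟨h1, h2⟩ | ⟨h1, h2⟩
  · exact Rect.separated_intervals hm K.u_lt_x K'.u_lt_x
      ⟨fun t ht => by simpa using h1 _ (K.fst_mem ht), fun t ht => by simpa using h2 _ (K'.fst_mem ht)⟩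
  · exact (Rect.separated_intervals hm K'.u_lt_x K.u_lt_x
      ⟨fun t ht => by simpa using h1 _ (K'.fst_mem ht),
        fun t ht => by simpa using h2 _ (K.fst_mem ht)⟩).symm

lemma Rect.SeparatedBy.snd {K K' : Rect} {m c : ℝ} (h : K.SeparatedBy K' 0 m c) (hm : m ≠ 0) :
    K.y ≤ K'.v ∨ K'.y ≤ K.v := by
  rcases h with ⟨h1, h2⟩ | ⟨h1, h2⟩
  · exact Rect.separated_intervals hm K.v_lt_y K'.v_lt_y
      ⟨fun t ht => by simpa using h1 _ (K.snd_mem ht), fun t ht => by simpa using h2 _ (K'.snd_mem ht)⟩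
  · exact (Rect.separated_intervals hm K'.v_lt_y K.v_lt_y
      ⟨fun t ht => by simpa using h1 _ (K'.snd_mem ht),
        fun t ht => by simpa using h2 _ (K.snd_mem ht)⟩).symm

lemma sfInc_abs_of_disjoint {a b a' b' : ℝ} (h1 : a ≤ b) (h2 : a' ≤ b') (h : b ≤ a' ∨ b' ≤ a) :
    sfInc (fun t => |t| ^ (1 : ℝ)) a b a' b' = 0 :=
  h.elim (fun h => sfInc_abs_of_le h1 h h2) fun h => sfInc_abs_of_ge h2 h h1

lemma IsSheet.independent_fst (hV : IsSheet V P C 1 q) : IndependentIncrementsAlong V P 0 1 := by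
  intro a' b' c' hab h K K' hK
  have hb : b' = 0 := by linarith
  subst hb
  have ha : a' ≠ 0 := fun h => hab (by rw [h])
  refine hV.2.2.2.indepFun_increment ?_
  rw [hV.covariance_increment, sfInc_abs_of_disjoint K.u_lt_x.le K'.u_lt_x.le (hK.fst ha), zero_mul,
    mul_zero]

lemma IsSheet.independent_snd (hV : IsSheet V P C p 1) : IndependentIncrementsAlong V P 1 0 := by
  intro a' b' c' hab h K K' hK
  have ha : a' = 0 := by linarith
  subst ha
  have hb : b' ≠ 0 := fun h => hab (by rw [h])
  refine hV.2.2.2.indepFun_increment ?_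
  rw [hV.covariance_increment, sfInc_abs_of_disjoint K.v_lt_y.le K'.v_lt_y.le (hK.snd hb), mul_zero,
    mul_zero]

/-- The increments are independent in a coordinate direction if `p` or `q` equals one, and invariant
in a coordinate direction if `p` or `q` equals two. -/
lemma IsSheet.not_hasDependentIncrements (hV : IsSheet V P C p q)
    (h : p = 1 ∨ q = 1 ∨ p = 2 ∨ q = 2) :
    ¬ HasDependentIncrements V P := by
  intro hD
  rcases h with rfl | rfl | rfl | rfl
  · exact (hD 0 1 (by simp)).1 hV.independent_fst
  · exact (hD 1 0 (by simp)).1 hV.independent_snd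
  · refine (hD 0 1 (by simp)).2 fun z w h K K' h1 h2 h3 h4 => hV.2.2.2.increment_ae_eq ?_ ?_
    all_goals
      have hw : w = 0 := by linarith
      rw [hV.covariance_increment, hV.covariance_increment, sfInc_sq, sfInc_sq, h1, h2, h3, h4, hw,
        add_zero, add_zero]
      ring
  · refine (hD 1 0 (by simp)).2 fun z w h K K' h1 h2 h3 h4 => hV.2.2.2.increment_ae_eq ?_ ?_
    all_goals
      have hz : z = 0 := by linarith
      rw [hV.covariance_increment, hV.covariance_increment, sfInc_sq, sfInc_sq, h1, h2, h3, h4, hz,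
        add_zero, add_zero]
      ring

omit [IsProbabilityMeasure P] in
lemma FddEq.variance_eq {V V' : ℝ → ℝ → Ω → ℝ} (h : FddEq V V' P) {x y : ℝ} (hx : 0 < x)
    (hy : 0 < y) : Var[V x y; P] = Var[V' x y; P] :=
  ((h 1 (fun _ => (x, y)) fun _ => ⟨hx, hy⟩).comp (measurable_pi_apply (0 : Fin 1))).variance_eq

omit [IsProbabilityMeasure P] in
/-- The exponents of a sheet are determined by its law up to a constant factor. -/
lemma IsSheet.exponents_eq {V' : ℝ → ℝ → Ω → ℝ} {C' p' q' : ℝ} (hV : IsSheet V P C p q)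
    (hV' : IsSheet V' P C' p' q') {a : ℝ} (h : FddEq V (fun x y ω => a * V' x y ω) P) :
    p = p' ∧ q = q' := by
  have key : ∀ x y : ℝ, 0 < x → 0 < y → C * (x ^ p * y ^ q) = a ^ 2 * (C' * (x ^ p' * y ^ q')) := by
    intro x y hx hy
    rw [← hV.variance_eq hx hy, ← hV'.variance_eq hx hy, h.variance_eq hx hy]
    exact variance_const_mul a (V' x y) P
  -- The point (1,1) matches the constants; doubling one coordinate then isolates one exponent.
  have h1 := key 1 1 one_pos one_pos
  have h2 := key 2 1 two_pos one_pos
  have h3 := key 1 2 one_pos two_pos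
  simp only [Real.one_rpow, mul_one, one_mul] at h1 h2 h3
  have hC := hV.1
  rw [← mul_assoc, ← h1] at h2 h3
  exact ⟨(Real.rpow_right_inj two_pos (by norm_num)).1 (mul_left_cancel₀ hC.ne' h2),
    (Real.rpow_right_inj two_pos (by norm_num)).1 (mul_left_cancel₀ hC.ne' h3)⟩

variable {W : Set (ℝ × ℝ) → Ω → ℂ} {W₁ : Set ℝ → Ω → ℂ} {H₁ H₂ c : ℝ}

omit [IsProbabilityMeasure P] in
lemma IsCenteredGaussianField.congr {K K' : ℝ × ℝ → ℝ × ℝ → ℝ}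
    (hV : IsCenteredGaussianField V P K) (h : ∀ r s, K r s = K' r s) :
    IsCenteredGaussianField V P K' :=
  ⟨hV.gaussian, hV.mean_zero, fun r s => (hV.covariance_eq r s).trans (h r s)⟩

/-- For H₁ < 1 the weight |u|^(-H₁) is constant in v, which makes the field Brownian in y; for H₁ >
1 the factor x gives exponent 2. Of the remaining exponent only q > 1 is recorded, which suffices
later. -/
theorem isSheet_VPlus (hW : IsComplexGaussianNoise W P) (hW₁ : IsComplexGaussianNoise W₁ P)
    (hc : 0 < c) (hH₁ : 0 < H₁) (hH : H₁ ≤ H₂) (hH₁_ne : H₁ ≠ 1) (hHH : H₁ * H₂ < H₁ + H₂) :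
    ∃ C p q, IsSheet (VPlus W W₁ P H₁ H₂ c) P C p q ∧
      ((H₁ < 1 ∧ p = 1 + H₁ ∧ q = 1) ∨ (1 < H₁ ∧ p = 2 ∧ 1 < q)) := by
  rcases lt_or_gt_of_ne hH₁_ne with h | h
  · refine ⟨powConst H₁ * powConst 0, 1 + H₁, 1, ⟨mul_pos (powConst_pos hH₁.le h)
      (powConst_pos le_rfl one_pos), by positivity, one_pos, (VPlus_field_of_lt hW hH₁ h).congr
        fun r s => ?_⟩, Or.inl ⟨h, rfl, rfl⟩⟩
    exact integral_incRe_mul_rpow_left hH₁.le h _ _ _ _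
  · have hα0 : 0 < (H₁ * H₂ - H₂) / H₁ := div_pos (by nlinarith) hH₁
    have hα1 : (H₁ * H₂ - H₂) / H₁ < 1 := by rw [div_lt_one hH₁]; linarith
    have hρ : 0 < rho₁ H₁ := Real.sqrt_pos.2 (beta_pos (by norm_num) (by linarith))
    refine ⟨rho₁ H₁ ^ 2 * c ^ ((1 - H₁) / 2) * powConst ((H₁ * H₂ - H₂) / H₁), 2,
      1 + (H₁ * H₂ - H₂) / H₁, ⟨mul_pos (by positivity) (powConst_pos hα0.le hα1), two_pos,
        by positivity, (VPlus_field_of_gt hW₁ hc h hH hHH).congr fun r s => ?_⟩,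
        Or.inr ⟨h, rfl, by linarith⟩⟩
    rw [integral_incRe_mul_rpow hα0.le hα1, powCov_two]
    ring

/-- The bound p < 2 is H₁H₂ < H₁ + H₂ once more; it separates this field from `VPlus` when both H₁
and H₂ exceed 1. -/
theorem isSheet_VMinus (hW : IsComplexGaussianNoise W P) (hW₁ : IsComplexGaussianNoise W₁ P)
    (hc : 0 < c) (hH₁ : 0 < H₁) (hH : H₁ ≤ H₂) (hH₂_ne : H₂ ≠ 1) (hHH : H₁ * H₂ < H₁ + H₂) :
    ∃ C p q, IsSheet (VMinus W W₁ P H₁ H₂ c) P C p q ∧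
      ((H₂ < 1 ∧ p = 1 ∧ q = 1 + H₂) ∨ (1 < H₂ ∧ p < 2 ∧ q = 2)) := by
  have hH₂ : 0 < H₂ := hH₁.trans_le hH
  rcases lt_or_gt_of_ne hH₂_ne with h | h
  · refine ⟨c ^ (-H₁ / 2) * (powConst 0 * powConst H₂), 1, 1 + H₂, ⟨mul_pos (by positivity)
      (mul_pos (powConst_pos le_rfl one_pos) (powConst_pos hH₂.le h)), one_pos, by positivity,
        (VMinus_field_of_lt hW hc hH₂ h).congr fun r s => ?_⟩, Or.inl ⟨h, rfl, rfl⟩⟩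
    rw [integral_incRe_mul_rpow_right hH₂.le h]
    ring
  · have hα0 : 0 < (H₁ * H₂ - H₁) / H₂ := div_pos (by nlinarith) hH₂
    have hα1 : (H₁ * H₂ - H₁) / H₂ < 1 := by rw [div_lt_one hH₂]; linarith
    have hρ : 0 < rho₂ H₁ H₂ := Real.sqrt_pos.2
      (mul_pos (by positivity) (beta_pos (by positivity) (div_pos (by nlinarith) (by positivity))))
    refine ⟨rho₂ H₁ H₂ ^ 2 * c ^ (-H₁ / (2 * H₂)) * powConst ((H₁ * H₂ - H₁) / H₂),
      1 + (H₁ * H₂ - H₁) / H₂, 2, ⟨mul_pos (by positivity) (powConst_pos hα0.le hα1),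
        by positivity, two_pos, (VMinus_field_of_gt hW₁ hc hH₁ h hHH).congr fun r s => ?_⟩,
        Or.inr ⟨h, by linarith, rfl⟩⟩
    rw [integral_incRe_mul_rpow hα0.le hα1, powCov_two]
    ring

end PowerFields

/-! ### Increments of fields with a spectral weight; failure of invariance -/

section SpectralIncrements

lemma integral_sub_sub_add {f₁ f₂ f₃ f₄ : ℝ × ℝ → ℝ} (h₁ : Integrable f₁) (h₂ : Integrable f₂)
    (h₃ : Integrable f₃) (h₄ : Integrable f₄) :
    Integrable (fun z => f₁ z - f₂ z - f₃ z + f₄ z) ∧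
    ∫ z, (f₁ z - f₂ z - f₃ z + f₄ z) = (∫ z, f₁ z) - (∫ z, f₂ z) - (∫ z, f₃ z) + ∫ z, f₄ z := by
  have h12 : Integrable (fun z => f₁ z - f₂ z) := h₁.sub h₂
  have h123 : Integrable (fun z => f₁ z - f₂ z - f₃ z) := h12.sub h₃
  exact ⟨h123.add h₄, by rw [integral_add h123 h₄, integral_sub h12 h₃, integral_sub h₁ h₂]⟩

/-- The covariance of rectangular increments for the spectral weight `w`. -/
noncomputable def spectralInc (w : ℝ × ℝ → ℝ) (u v x y u' v' x' y' : ℝ) : ℝ :=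
  ∫ z : ℝ × ℝ, sfInc (fun t => incSq t z.1) u x u' x' * sfInc (fun t => incSq t z.2) v y v' y' * w z

variable {w : ℝ × ℝ → ℝ}

lemma sfInc_incSq (a b a' b' t : ℝ) : sfInc (fun s => incSq s t) a b a' b' =
    incRe b b' t - incRe a b' t - incRe b a' t + incRe a a' t :=
  (sfCov_increments (fun s => incSq s t) a b a' b').symm

/-- The sixteen-term expansion is done one coordinate at a time, so that each stage splits an
integral into four integrable pieces. -/
lemma integrable_spectralInc_and_eq (hw : IsWeight w) (u v x y u' v' x' y' : ℝ) :
    Integrable (fun z : ℝ × ℝ => sfInc (fun t => incSq t z.1) u x u' x' *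
      sfInc (fun t => incSq t z.2) v y v' y' * w z) ∧
    let K : ℝ × ℝ → ℝ × ℝ → ℝ := fun p q => ∫ z : ℝ × ℝ,
      incRe p.1 q.1 z.1 * incRe p.2 q.2 z.2 * w z
    spectralInc w u v x y u' v' x' y' =
      (K (x, y) (x', y') - K (u, y) (x', y') - K (x, v) (x', y') + K (u, v) (x', y')) -
      (K (x, y) (u', y') - K (u, y) (u', y') - K (x, v) (u', y') + K (u, v) (u', y')) -
      (K (x, y) (x', v') - K (u, y) (x', v') - K (x, v) (x', v') + K (u, v) (x', v')) +
      (K (x, y) (u', v') - K (u, y) (u', v') - K (x, v) (u', v') + K (u, v) (u', v')) := by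
  have h1 : ∀ a a' : ℝ, Integrable (fun z : ℝ × ℝ => sfInc (fun t => incSq t z.1) u x u' x' *
      incRe a a' z.2 * w z) ∧
      ∫ z : ℝ × ℝ, sfInc (fun t => incSq t z.1) u x u' x' * incRe a a' z.2 * w z =
      (∫ z : ℝ × ℝ, incRe x x' z.1 * incRe a a' z.2 * w z) -
      (∫ z : ℝ × ℝ, incRe u x' z.1 * incRe a a' z.2 * w z) -
      (∫ z : ℝ × ℝ, incRe x u' z.1 * incRe a a' z.2 * w z) +
      ∫ z : ℝ × ℝ, incRe u u' z.1 * incRe a a' z.2 * w z := by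
    intro a a'
    have h := integral_sub_sub_add (integrable_incRe_mul hw x x' a a')
      (integrable_incRe_mul hw u x' a a') (integrable_incRe_mul hw x u' a a')
      (integrable_incRe_mul hw u u' a a')
    simp only [sfInc_incSq, sub_mul, add_mul]
    exact h
  have h := integral_sub_sub_add (h1 y y').1 (h1 v y').1 (h1 y v').1 (h1 v v').1
  have e : ∀ z : ℝ × ℝ, sfInc (fun t => incSq t z.1) u x u' x' *
      sfInc (fun t => incSq t z.2) v y v' y' * w z =
      sfInc (fun t => incSq t z.1) u x u' x' * incRe y y' z.2 * w z -
      sfInc (fun t => incSq t z.1) u x u' x' * incRe v y' z.2 * w z -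
      sfInc (fun t => incSq t z.1) u x u' x' * incRe y v' z.2 * w z +
      sfInc (fun t => incSq t z.1) u x u' x' * incRe v v' z.2 * w z := by
    intro z
    rw [sfInc_incSq v y v' y']
    ring
  simp only [spectralInc, e]
  refine ⟨h.1, ?_⟩
  rw [h.2, (h1 y y').2, (h1 v y').2, (h1 y v').2, (h1 v v').2]
  ring

variable {Ω : Type*} [MeasurableSpace Ω] {P : Measure Ω} [IsProbabilityMeasure P]
  {V : ℝ → ℝ → Ω → ℝ}

/-- Gaussian fields with spectral weight `w`. -/
def IsSpectralField (V : ℝ → ℝ → Ω → ℝ) (P : Measure Ω) (w : ℝ × ℝ → ℝ) : Prop :=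
  IsWeight w ∧ IsCenteredGaussianField V P
    (fun p q => ∫ z : ℝ × ℝ, incRe p.1 q.1 z.1 * incRe p.2 q.2 z.2 * w z)

lemma IsSpectralField.covariance_increment (hV : IsSpectralField V P w)
    (u v x y u' v' x' y' : ℝ) :
    cov[increment V u v x y, increment V u' v' x' y'; P] =
      spectralInc w u v x y u' v' x' y' := by
  rw [hV.2.covariance_increment, (integrable_spectralInc_and_eq hV.1 _ _ _ _ _ _ _ _).2]

lemma IsSpectralField.vanishesOnAxes (hV : IsSpectralField V P w) : VanishesOnAxes V P :=
  ⟨fun x _ => hV.2.ae_eq_zero (by simp [incRe]), fun y _ => hV.2.ae_eq_zero (by simp [incRe])⟩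

lemma IsSpectralField.hasStationaryIncrements (hV : IsSpectralField V P w) :
    HasStationaryIncrements V P := by
  refine hV.2.hasStationaryIncrements fun u v x y x' y' => ?_
  rw [hV.covariance_increment, hV.covariance_increment, spectralInc, spectralInc]
  simp only [sfInc_translate _ u, sfInc_translate _ v]

lemma sfInc_self {σ : ℝ → ℝ} (hσ : ∀ t, σ (-t) = σ t) (h0 : σ 0 = 0) (a ℓ : ℝ) :
    sfInc σ a (a + ℓ) a (a + ℓ) = σ ℓ := by
  simp only [sfInc]
  rw [show a + ℓ - a = ℓ by ring, show a - (a + ℓ) = -ℓ by ring, sub_self, sub_self, hσ, h0]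
  ring

/-- For intervals of equal length the covariance depends only on the distance of their left
endpoints, because σ is even. Hence a rectangle may be reflected relative to another without
changing their covariance. -/
lemma sfInc_congr_abs {σ : ℝ → ℝ} (hσ : ∀ t, σ (-t) = σ t) {a b a' b' ℓ : ℝ}
    (h : |a - b| = |a' - b'|) :
    sfInc σ a (a + ℓ) b (b + ℓ) = sfInc σ a' (a' + ℓ) b' (b' + ℓ) := by
  have e : ∀ a b, sfInc σ a (a + ℓ) b (b + ℓ) =
      2⁻¹ * (σ (a - b + ℓ) + σ (a - b - ℓ) - σ (a - b) - σ (a - b)) := by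
    intro a b
    simp only [sfInc]
    rw [show a + ℓ - b = a - b + ℓ by ring, show a - (b + ℓ) = a - b - ℓ by ring,
      show a + ℓ - (b + ℓ) = a - b by ring]
  rw [e, e]
  rcases abs_eq_abs.1 h with h | h
  · rw [h]
  · rw [h, show -(a' - b') + ℓ = -(a' - b' - ℓ) by ring,
      show -(a' - b') - ℓ = -(a' - b' + ℓ) by ring, hσ, hσ, hσ]
    ring

lemma spectralInc_self (w : ℝ × ℝ → ℝ) (a b ℓ m : ℝ) :
    spectralInc w a b (a + ℓ) (b + m) a b (a + ℓ) (b + m) =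
      ∫ z : ℝ × ℝ, incSq ℓ z.1 * incSq m z.2 * w z := by
  simp only [spectralInc]
  refine integral_congr_ae (Eventually.of_forall fun z => ?_)
  simp only
  rw [sfInc_self (σ := fun t => incSq t z.1) (fun t => incSq_neg_left t _) (incSq_zero _),
    sfInc_self (σ := fun t => incSq t z.2) (fun t => incSq_neg_left t _) (incSq_zero _)]

lemma spectralInc_congr_abs (w : ℝ × ℝ → ℝ) {a b a' b' c d c' d' : ℝ} (ℓ m : ℝ)
    (h1 : |a - a'| = |c - c'|) (h2 : |b - b'| = |d - d'|) :
    spectralInc w a b (a + ℓ) (b + m) a' b' (a' + ℓ) (b' + m) =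
      spectralInc w c d (c + ℓ) (d + m) c' d' (c' + ℓ) (d' + m) := by
  simp only [spectralInc]
  refine integral_congr_ae (Eventually.of_forall fun z => ?_)
  simp only
  rw [sfInc_congr_abs (σ := fun t => incSq t z.1) (fun t => incSq_neg_left t _) h1,
    sfInc_congr_abs (σ := fun t => incSq t z.2) (fun t => incSq_neg_left t _) h2]

/-- A shift turns a squared kernel into the squared kernel times a phase, of which only the cosine
survives in the real structure function. -/
lemma spectralInc_translate (w : ℝ × ℝ → ℝ) (a b s t : ℝ) :
    spectralInc w a b (a + 1) (b + 1) (a + s) (b + t) (a + 1 + s) (b + 1 + t) =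
      ∫ z : ℝ × ℝ, incSq 1 z.1 * incSq 1 z.2 * w z *
        (Real.cos (s * z.1) * Real.cos (t * z.2)) := by
  have key : ∀ a s u : ℝ, sfInc (fun t => incSq t u) a (a + 1) (a + s) (a + 1 + s) =
      incSq 1 u * Real.cos (s * u) := by
    intro a s u
    simp only [sfInc]
    rw [show a + 1 - (a + s) = 1 - s by ring, show a - (a + 1 + s) = -(1 + s) by ring,
      show a + 1 - (a + 1 + s) = -s by ring, show a - (a + s) = -s by ring, incSq_neg_left,
      incSq_neg_left]
    simp only [incSq]
    rw [sub_mul, add_mul, Real.cos_sub, Real.cos_add]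
    ring
  simp only [spectralInc, key]
  refine integral_congr_ae (Eventually.of_forall fun z => ?_)
  simp only
  ring

lemma integral_pos_of_pos_on_square {F : ℝ × ℝ → ℝ} (hF : Integrable F) (h0 : ∀ z, 0 ≤ F z) {δ : ℝ}
    (hδ : 0 < δ) (hpos : ∀ u v, u ∈ Set.Ioo 0 δ → v ∈ Set.Ioo 0 δ → 0 < F (u, v)) :
    0 < ∫ z, F z := by
  refine (integral_pos_iff_support_of_nonneg h0 hF).2 ?_
  refine lt_of_lt_of_le ?_ (measure_mono (s := Set.Ioo 0 δ ×ˢ Set.Ioo 0 δ)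
    fun z hz => (hpos z.1 z.2 hz.1 hz.2).ne')
  rw [Measure.volume_eq_prod, Measure.prod_prod]
  simp [hδ]

lemma integrable_incSq_mul (hw : IsWeight w) (ℓ m : ℝ) :
    Integrable (fun z : ℝ × ℝ => incSq ℓ z.1 * incSq m z.2 * w z) := by
  refine (integrable_incRe_mul hw ℓ ℓ m m).congr (Eventually.of_forall fun z => ?_)
  simp only [incRe, sub_self, incSq_zero]
  ring

/-- Fields with a positive spectral weight have no invariant increments in any direction. -/
theorem IsSpectralField.not_invariant (hV : IsSpectralField V P w)
    (hpos : ∀ u v, 0 < u → 0 < v → 0 < w (u, v)) {a b : ℝ} (hab : (a, b) ≠ (0, 0)) :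
    ¬ InvariantIncrementsAlong V P a b := by
  intro h
  have hb0 := abs_nonneg b
  have ha0 := abs_nonneg a
  -- The vector (b, -a) spans the line; the base point (|b|, |a|) keeps the unit square and its
  -- translate in the quadrant.
  have h1 := h b (-a) (by ring)
    ⟨|b|, |a|, |b| + 1, |a| + 1, hb0, ha0, by linarith, by linarith⟩
    ⟨|b| + b, |a| + -a, |b| + 1 + b, |a| + 1 + -a, by linarith [neg_abs_le b],
      by linarith [le_abs_self a], by linarith, by linarith⟩ rfl rfl rfl rfl
  simp only [Rect.incr] at h1
  have h2 := covariance_congr_ae (P := P) (EventuallyEq.refl _ (increment V |b| |a| (|b| + 1) (|a| + 1)))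
    h1
  rw [hV.covariance_increment, hV.covariance_increment, spectralInc_self,
    spectralInc_translate] at h2
  have hI := integrable_incSq_mul hV.1 1 1
  have hcos : ∀ z : ℝ × ℝ, |Real.cos (b * z.1) * Real.cos (-a * z.2)| ≤ 1 := by
    intro z
    rw [abs_mul]
    exact mul_le_one₀ (Real.abs_cos_le_one _) (abs_nonneg _) (Real.abs_cos_le_one _)
  have hI2 : Integrable (fun z : ℝ × ℝ => incSq 1 z.1 * incSq 1 z.2 * w z *
      (Real.cos (b * z.1) * Real.cos (-a * z.2))) :=
    hI.mul_bdd (c := 1) (Continuous.aestronglyMeasurable (by fun_prop))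
      (Eventually.of_forall hcos)
  have hd0 : 0 < 1 + |a| + |b| := by positivity
  have h3 : 0 < ∫ z : ℝ × ℝ, (incSq 1 z.1 * incSq 1 z.2 * w z - incSq 1 z.1 * incSq 1 z.2 * w z *
      (Real.cos (b * z.1) * Real.cos (-a * z.2))) := by
    -- With this δ both |b|u and |a|v are below 1, so a nonzero coefficient gives a cosine of
    -- modulus strictly below 1; one coefficient is nonzero.
    refine integral_pos_of_pos_on_square (hI.sub hI2) (fun z => ?_) (δ := 1 / (1 + |a| + |b|))
      (by positivity) (fun u v hu hv => ?_)
    · rw [← mul_one_sub]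
      exact mul_nonneg (mul_nonneg (mul_nonneg (incSq_nonneg _ _) (incSq_nonneg _ _)) (hV.1.2.1 z))
        (by linarith [le_of_abs_le (hcos z)])
    · have hlt : ∀ r s : ℝ, r ≠ 0 → |r| ≤ 1 + |a| + |b| → s ∈ Set.Ioo 0 (1 / (1 + |a| + |b|)) →
          |Real.cos (r * s)| < 1 := by
        intro r s hr hr1 hs
        have e1 : 0 < |r * s| := abs_pos.2 (mul_ne_zero hr hs.1.ne')
        have e2 : |r * s| < 1 := by
          rw [abs_mul, abs_of_pos hs.1]
          calc |r| * s ≤ (1 + |a| + |b|) * s := mul_le_mul_of_nonneg_right hr1 hs.1.le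
            _ < (1 + |a| + |b|) * (1 / (1 + |a| + |b|)) := mul_lt_mul_of_pos_left hs.2 hd0
            _ = 1 := mul_one_div_cancel hd0.ne'
        have e3 : 0 < Real.sin |r * s| := Real.sin_pos_of_pos_of_lt_pi e1
          (by linarith [Real.pi_gt_three])
        have e4 := Real.sin_sq_add_cos_sq |r * s|
        rw [Real.cos_abs] at e4
        rw [← sq_lt_one_iff_abs_lt_one]
        nlinarith [pow_pos e3 2]
      have hδ1 : 1 / (1 + |a| + |b|) ≤ 1 := by
        rw [div_le_one hd0]
        linarith
      have hs : ∀ s ∈ Set.Ioo 0 (1 / (1 + |a| + |b|)), 0 < incSq 1 s := fun s hs =>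
        incSq_pos hs.1 one_pos (by linarith [hs.2, Real.pi_gt_three])
      have hlt2 : Real.cos (b * u) * Real.cos (-a * v) < 1 := by
        refine lt_of_le_of_lt (le_abs_self _) ?_
        rw [abs_mul]
        rcases eq_or_ne b 0 with hb | hb
        · have ha : -a ≠ 0 := fun ha => hab (by rw [hb, neg_eq_zero.1 ha])
          have := hlt (-a) v ha (by rw [abs_neg]; linarith) hv
          exact mul_lt_one_of_nonneg_of_lt_one_right (Real.abs_cos_le_one _) (abs_nonneg _) this
        · have := hlt b u hb (by linarith) hu
          exact mul_lt_one_of_nonneg_of_lt_one_left (abs_nonneg _) this (Real.abs_cos_le_one _)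
      rw [← mul_one_sub]
      exact mul_pos (mul_pos (mul_pos (hs u hu) (hs v hv)) (hpos u v hu.1 hv.1)) (by linarith)
  rw [integral_sub hI hI2, h2, sub_self] at h3
  exact h3.false

end SpectralIncrements

/-! ### Grids in which only neighbouring cells are correlated -/

section Grid

variable {Ω : Type*} [MeasurableSpace Ω] {P : Measure Ω} [IsProbabilityMeasure P]
  {V : ℝ → ℝ → Ω → ℝ} {w : ℝ × ℝ → ℝ}

/-- The variance of a sum over a grid in which only neighbouring cells are correlated. -/
lemma variance_sum_grid_le {Y : ℕ × ℕ → Ω → ℝ} (hY : ∀ p, MemLp (Y p) 2 P) {s : ℝ}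
    (hs : ∀ p, Var[Y p; P] = s) {M N : ℕ}
    (h0 : ∀ p ∈ Finset.range M ×ˢ Finset.range N, ∀ q ∈ Finset.range M ×ˢ Finset.range N,
      2 ≤ Nat.dist p.1 q.1 ∨ 2 ≤ Nat.dist p.2 q.2 → cov[Y p, Y q; P] = 0) :
    Var[fun ω => ∑ p ∈ Finset.range M ×ˢ Finset.range N, Y p ω; P] ≤ 9 * (M * N) * s := by
  have hs0 : 0 ≤ s := (hs (0, 0)).symm ▸ variance_nonneg _ _
  -- Cauchy–Schwarz for equal variances, read off from Var(Y p - Y q) ≥ 0.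
  have hle : ∀ p q, cov[Y p, Y q; P] ≤ s := by
    intro p q
    have h1 : 0 ≤ Var[Y p - Y q; P] := variance_nonneg _ _
    rw [← covariance_self ((hY p).sub (hY q)).aemeasurable,
      covariance_sub_sub (hY p) (hY q) (hY p) (hY q), covariance_self (hY p).aemeasurable,
      covariance_self (hY q).aemeasurable, covariance_comm (Y q) (Y p), hs, hs] at h1
    linarith
  have hm : AEMeasurable (fun ω => ∑ p ∈ Finset.range M ×ˢ Finset.range N, Y p ω) P :=
    Finset.aemeasurable_fun_sum _ fun p _ => (hY p).aemeasurable
  rw [← covariance_self hm, covariance_fun_sum_fun_sum' (fun p _ => hY p) (fun p _ => hY p)]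
  have hrow : ∀ p ∈ Finset.range M ×ˢ Finset.range N,
      ∑ q ∈ Finset.range M ×ˢ Finset.range N, cov[Y p, Y q; P] ≤ 9 * s := by
    intro p hp
    -- The at most 3 × 3 neighbours of p. Truncated subtraction at 0 only makes the block smaller.
    let S : Finset (ℕ × ℕ) := Finset.Icc (p.1 - 1) (p.1 + 1) ×ˢ Finset.Icc (p.2 - 1) (p.2 + 1)
    have hcard : S.card ≤ 9 := by
      have e : ∀ k : ℕ, (Finset.Icc (k - 1) (k + 1)).card ≤ 3 := by
        intro k
        rw [Nat.card_Icc]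
        omega
      rw [Finset.card_product]
      exact (Nat.mul_le_mul (e _) (e _)).trans_eq (by norm_num)
    calc ∑ q ∈ Finset.range M ×ˢ Finset.range N, cov[Y p, Y q; P]
        ≤ ∑ q ∈ Finset.range M ×ˢ Finset.range N, if q ∈ S then s else 0 := by
          refine Finset.sum_le_sum fun q hq => ?_
          split_ifs with hqS
          · exact hle p q
          · refine (h0 p hp q hq ?_).le
            simp only [S, Finset.mem_product, Finset.mem_Icc] at hqS
            simp only [Nat.dist]
            omega
      _ = ∑ q ∈ (Finset.range M ×ˢ Finset.range N) ∩ S, s := Finset.sum_ite_mem _ _ _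
      _ = ((Finset.range M ×ˢ Finset.range N) ∩ S).card * s := by
          rw [Finset.sum_const, nsmul_eq_mul]
      _ ≤ 9 * s := by
          refine mul_le_mul_of_nonneg_right ?_ hs0
          exact_mod_cast (Finset.card_le_card Finset.inter_subset_right).trans hcard
  refine (Finset.sum_le_card_nsmul _ _ _ hrow).trans (le_of_eq ?_)
  rw [Finset.card_product, Finset.card_range, Finset.card_range, nsmul_eq_mul]
  push_cast
  ring

/-- Rectangular increments are additive: the sum telescopes in each coordinate. -/
lemma sum_grid_increment {Ω : Type*} (V : ℝ → ℝ → Ω → ℝ) (ℓ m : ℝ) (M N : ℕ) (ω : Ω) :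
    ∑ p ∈ Finset.range M ×ˢ Finset.range N,
      increment V (p.1 * ℓ) (p.2 * m) (p.1 * ℓ + ℓ) (p.2 * m + m) ω =
      increment V 0 0 (M * ℓ) (N * m) ω := by
  let G : ℕ → ℕ → ℝ := fun i j => V (i * ℓ) (j * m) ω
  have e : ∀ i j : ℕ, increment V (i * ℓ) (j * m) (i * ℓ + ℓ) (j * m + m) ω =
      (G (i + 1) (j + 1) - G i (j + 1)) - (G (i + 1) j - G i j) := by
    intro i j
    simp only [increment, G]
    push_cast
    rw [add_mul, add_mul, one_mul, one_mul]
    ring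
  rw [Finset.sum_product]
  simp only [e]
  have h1 : ∀ i, ∑ j ∈ Finset.range N, ((G (i + 1) (j + 1) - G i (j + 1)) - (G (i + 1) j - G i j)) =
      (G (i + 1) N - G (i + 1) 0) - (G i N - G i 0) := by
    intro i
    rw [Finset.sum_range_sub (fun j => G (i + 1) j - G i j)]
    ring
  simp only [h1]
  rw [Finset.sum_range_sub (fun i => G i N - G i 0)]
  simp only [increment, G, Nat.cast_zero, zero_mul]
  ring

/-- If the increments over rectangles separated by lines with normal `(α, β)` are independent, then
distant cells of a grid are uncorrelated. -/
lemma IsSpectralField.spectralInc_eq_zero (hV : IsSpectralField V P w) {α β : ℝ} (hα : 0 ≤ α)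
    (h : ∀ c, ∀ K K' : Rect, K.SeparatedBy K' α β c → IndepFun (K.incr V) (K'.incr V) P)
    {ℓ m a b a' b' : ℝ} (hℓ : 0 < ℓ) (hm : 0 < m)
    (hdist : α * ℓ + |β| * m ≤ α * |a - a'| + |β| * |b - b'|) :
    spectralInc w a b (a + ℓ) (b + m) a' b' (a' + ℓ) (b' + m) = 0 := by
  have hs := abs_nonneg (a - a')
  have ht := abs_nonneg (b - b')
  set s := |a - a'|
  set t := |b - b'|
  have hcov : ∀ K K' : Rect, IndepFun (K.incr V) (K'.incr V) P →
      spectralInc w K.u K.v K.x K.y K'.u K'.v K'.x K'.y = 0 := by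
    intro K K' hKK
    rw [← hV.covariance_increment]
    exact hKK.covariance_eq_zero (hV.2.memLp_increment _ _ _ _) (hV.2.memLp_increment _ _ _ _)
  -- The covariance depends only on the offsets s and t, so the rectangles may be placed along
  -- whichever diagonal the normal separates: (0,0), (s,t) for β ≥ 0 and (0,t), (s,0) for β < 0. The
  -- level is the supremum of αx + βy over the first rectangle.
  rcases le_or_gt 0 β with hβ | hβ
  · rw [abs_of_nonneg hβ] at hdist
    have h1 := hcov ⟨0, 0, 0 + ℓ, 0 + m, le_rfl, le_rfl, by linarith, by linarith⟩
      ⟨s, t, s + ℓ, t + m, hs, ht, by linarith, by linarith⟩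
      (h (α * ℓ + β * m) _ _ (Or.inl ⟨fun p hp => ?_, fun p hp => ?_⟩))
    · rw [← h1]
      exact spectralInc_congr_abs w ℓ m (by rw [zero_sub, abs_neg, abs_of_nonneg hs])
        (by rw [zero_sub, abs_neg, abs_of_nonneg ht])
    · have e1 : p.1 ≤ 0 + ℓ := hp.1.2
      have e2 : p.2 ≤ 0 + m := hp.2.2
      nlinarith
    · have e1 : s < p.1 := hp.1.1
      have e2 : t < p.2 := hp.2.1
      nlinarith
  · rw [abs_of_neg hβ] at hdist
    have h1 := hcov ⟨0, t, 0 + ℓ, t + m, le_rfl, ht, by linarith, by linarith⟩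
      ⟨s, 0, s + ℓ, 0 + m, hs, le_rfl, by linarith, by linarith⟩
      (h (α * ℓ + β * t) _ _ (Or.inl ⟨fun p hp => ?_, fun p hp => ?_⟩))
    · rw [← h1]
      exact spectralInc_congr_abs w ℓ m (by rw [zero_sub, abs_neg, abs_of_nonneg hs])
        (by rw [sub_zero, abs_of_nonneg ht])
    · have e1 : p.1 ≤ 0 + ℓ := hp.1.2
      have e2 : t < p.2 := hp.2.1
      nlinarith
    · have e1 : s < p.1 := hp.1.1
      have e2 : p.2 ≤ 0 + m := hp.2.2
      nlinarith

/-- The variance over a large rectangle is bounded by that over small cells. -/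
lemma IsSpectralField.integral_incSq_le (hV : IsSpectralField V P w) {α β : ℝ} (hα : 0 ≤ α)
    (h : ∀ c, ∀ K K' : Rect, K.SeparatedBy K' α β c → IndepFun (K.incr V) (K'.incr V) P)
    {ℓ m : ℝ} (hℓ : 0 < ℓ) (hm : 0 < m) {M N : ℕ}
    (hdist : ∀ i < M, ∀ j < N, 2 ≤ i ∨ 2 ≤ j → α * ℓ + |β| * m ≤ α * (i * ℓ) + |β| * (j * m)) :
    ∫ z : ℝ × ℝ, incSq (M * ℓ) z.1 * incSq (N * m) z.2 * w z ≤
      9 * (M * N) * ∫ z : ℝ × ℝ, incSq ℓ z.1 * incSq m z.2 * w z := by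
  let Y : ℕ × ℕ → Ω → ℝ := fun p => increment V (p.1 * ℓ) (p.2 * m) (p.1 * ℓ + ℓ) (p.2 * m + m)
  have hY : ∀ p, MemLp (Y p) 2 P := fun p => hV.2.memLp_increment _ _ _ _
  have key := variance_sum_grid_le (P := P) hY
    (s := ∫ z : ℝ × ℝ, incSq ℓ z.1 * incSq m z.2 * w z) (M := M) (N := N) (fun p => ?_) ?_
  · have e : (fun ω => ∑ p ∈ Finset.range M ×ˢ Finset.range N, Y p ω) =
        increment V 0 0 (M * ℓ) (N * m) := funext fun ω => sum_grid_increment V ℓ m M N ω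
    rw [e, ← covariance_self (hV.2.memLp_increment _ _ _ _).aemeasurable,
      hV.covariance_increment] at key
    have e2 := spectralInc_self w 0 0 (M * ℓ) (N * m)
    rw [zero_add, zero_add] at e2
    rwa [e2] at key
  · rw [← covariance_self (hY p).aemeasurable, hV.covariance_increment, spectralInc_self]
  · intro p hp q hq hpq
    simp only [Finset.mem_product, Finset.mem_range] at hp hq
    rw [hV.covariance_increment]
    have hd : ∀ (i j : ℕ) (t : ℝ), 0 < t → |(i : ℝ) * t - j * t| = (Nat.dist i j : ℕ) * t := by
      intro i j t ht
      rw [← sub_mul, abs_mul, abs_of_pos ht]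
      congr 1
      rcases le_total i j with hij | hij
      · rw [Nat.dist_eq_sub_of_le hij, Nat.cast_sub hij, abs_sub_comm, abs_of_nonneg]
        exact sub_nonneg.2 (by exact_mod_cast hij)
      · rw [Nat.dist_eq_sub_of_le_right hij, Nat.cast_sub hij, abs_of_nonneg]
        exact sub_nonneg.2 (by exact_mod_cast hij)
    refine hV.spectralInc_eq_zero hα h hℓ hm ?_
    rw [hd _ _ _ hℓ, hd _ _ _ hm]
    refine hdist _ ?_ _ ?_ hpq
    · simp only [Nat.dist]
      omega
    · simp only [Nat.dist]
      omega

/-- Grids adapted to a given normal. -/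
lemma exists_adapted_grids {α β : ℝ} (hα : 0 ≤ α) (hβ : 0 ≤ β) (h : ¬ (α = 0 ∧ β = 0)) :
    ∃ (L M : ℝ) (m k : ℕ → ℕ), 0 < L ∧ 0 < M ∧ (∀ n, 1 ≤ m n) ∧ (∀ n, 1 ≤ k n) ∧
      (Tendsto m atTop atTop ∨ Tendsto k atTop atTop) ∧
      ∀ n, ∀ i < m n, ∀ j < k n, 2 ≤ i ∨ 2 ≤ j →
        α * (L / m n) + β * (M / k n) ≤ α * (i * (L / m n)) + β * (j * (M / k n)) := by
  have ht : Tendsto (fun n : ℕ => n + 1) atTop atTop := tendsto_add_atTop_nat 1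
  rcases hα.eq_or_lt with hα | hα
  · subst hα
    have hβ' : 0 < β := lt_of_le_of_ne hβ fun e => h ⟨rfl, e.symm⟩
    -- For a vertical normal a single column is used: separation can come only from the second
    -- index.
    refine ⟨1, 1, fun _ => 1, fun n => n + 1, one_pos, one_pos, fun _ => le_rfl, fun n => Nat.le_add_left 1 n,
      Or.inr ht, fun n i hi j hj hij => ?_⟩
    have hi' : i < 1 := hi
    have hj2 : (1 : ℝ) ≤ j := by exact_mod_cast (by omega : 1 ≤ j)
    rw [zero_mul, zero_mul, zero_add, zero_add]
    exact mul_le_mul_of_nonneg_left (le_mul_of_one_le_left (by positivity) hj2) hβ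
  · rcases hβ.eq_or_lt with hβ | hβ
    · subst hβ
      refine ⟨1, 1, fun n => n + 1, fun _ => 1, one_pos, one_pos, fun n => Nat.le_add_left 1 n, fun _ => le_rfl,
        Or.inl ht, fun n i hi j hj hij => ?_⟩
      have hj' : j < 1 := hj
      have hi2 : (1 : ℝ) ≤ i := by exact_mod_cast (by omega : 1 ≤ i)
      rw [zero_mul, zero_mul, add_zero, add_zero]
      exact mul_le_mul_of_nonneg_left (le_mul_of_one_le_left (by positivity) hi2) hα.le
    · refine ⟨1 / α, 1 / β, fun n => n + 1, fun n => n + 1, by positivity, by positivity,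
        fun n => Nat.le_add_left 1 n, fun n => Nat.le_add_left 1 n, Or.inl ht, fun n i hi j hj hij => ?_⟩
      have hij2 : (2 : ℝ) ≤ i + j := by exact_mod_cast (by omega : 2 ≤ i + j)
      have hn : (0 : ℝ) < ((n + 1 : ℕ) : ℝ) := by positivity
      have e1 : α * (1 / α / ((n + 1 : ℕ) : ℝ)) = 1 / ((n + 1 : ℕ) : ℝ) := by field_simp
      have e2 : β * (1 / β / ((n + 1 : ℕ) : ℝ)) = 1 / ((n + 1 : ℕ) : ℝ) := by field_simp
      rw [mul_left_comm α, mul_left_comm β, e1, e2, ← add_mul, ← two_mul]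
      exact mul_le_mul_of_nonneg_right hij2 (by positivity)

end Grid

/-! ### The balanced field has no direction of independence -/

section Balanced

variable {Ω : Type*} [MeasurableSpace Ω] {P : Measure Ω} [IsProbabilityMeasure P]
  {V : ℝ → ℝ → Ω → ℝ} {H₁ H₂ c : ℝ}

/-- Monotonicity of h under dilation supplies the majorant for grids of growing size. -/
lemma hDensity_mul_le (hc : 0 < c) (hH₁ : 0 < H₁) (hH₂ : 0 < H₂) {r s u : ℝ} (hr : 1 ≤ r)
    (hs : 1 ≤ s) (hu : u ≠ 0) (v : ℝ) :
    hDensity H₁ H₂ c (r * u) (s * v) ≤ hDensity H₁ H₂ c u v := by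
  have hu' := abs_pos.2 hu
  rw [hDensity_eq_rpow hc, hDensity_eq_rpow hc]
  refine Real.rpow_le_rpow_of_nonpos (by positivity) ?_ (by linarith)
  have e : ∀ (t a : ℝ), 1 ≤ t → |a| ≤ |t * a| := by
    intro t a ht
    rw [abs_mul, abs_of_pos (by linarith : 0 < t)]
    exact le_mul_of_one_le_left (abs_nonneg _) ht
  have h1 := pow_le_pow_left₀ (abs_nonneg u) (e r u hr) 2
  have h2 := Real.rpow_le_rpow (abs_nonneg v) (e s v hs) (by positivity : 0 ≤ 2 * H₂ / H₁)
  exact add_le_add h1 (mul_le_mul_of_nonneg_left h2 hc.le)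

lemma tendsto_abs_natCast_mul_rpow {m : ℕ → ℕ} (hm : Tendsto m atTop atTop) {u s : ℝ}
    (hu : u ≠ 0) (hs : 0 < s) : Tendsto (fun n => |(m n : ℝ) * u| ^ (-s)) atTop (𝓝 0) := by
  have h1 : Tendsto (fun n => (m n : ℝ)) atTop atTop := tendsto_natCast_atTop_atTop.comp hm
  have h2 : Tendsto (fun n => |(m n : ℝ) * u|) atTop atTop :=
    (h1.atTop_mul_const (abs_pos.2 hu)).congr fun n => by
      rw [abs_mul, Nat.abs_cast]
  exact (tendsto_rpow_neg_atTop hs).comp h2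

/-- One dilation suffices, since the grid may be refined in a single coordinate; h is bounded by a
negative power of either argument. -/
lemma tendsto_hDensity_zero (hc : 0 < c) (hH₁ : 0 < H₁) (hH₂ : 0 < H₂) {m k : ℕ → ℕ}
    (hm : ∀ n, 1 ≤ m n) (hk : ∀ n, 1 ≤ k n) (h : Tendsto m atTop atTop ∨ Tendsto k atTop atTop)
    {u v : ℝ} (hu : u ≠ 0) (hv : v ≠ 0) :
    Tendsto (fun n => hDensity H₁ H₂ c (m n * u) (k n * v)) atTop (𝓝 0) := by
  have h0 : ∀ (j : ℕ) (t : ℝ), 1 ≤ j → t ≠ 0 → (j : ℝ) * t ≠ 0 := fun j t hj ht =>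
    mul_ne_zero (by exact_mod_cast (by omega : j ≠ 0)) ht
  rcases h with h | h
  · exact squeeze_zero (fun n => hDensity_nonneg hc _ _)
      (fun n => hDensity_le_left hc hH₁ (h0 _ _ (hm n) hu) _) (tendsto_abs_natCast_mul_rpow h hu hH₁)
  · refine squeeze_zero (fun n => hDensity_nonneg hc _ _)
      (fun n => hDensity_le_right hc hH₁ _ (h0 _ _ (hk n) hv)) ?_
    simpa using (tendsto_abs_natCast_mul_rpow h hv hH₂).const_mul (c ^ (-H₁ / 2))

/-- The substitution returns to the large rectangle and moves the dilation into h. In each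
coordinate the kernel gives the factor m⁻², the Jacobian m, and the number of cells m. -/
lemma integral_incSq_cell (L M : ℝ) {m k : ℕ} (hm : 1 ≤ m) (hk : 1 ≤ k) :
    ((m : ℝ) * k) * ∫ z : ℝ × ℝ, incSq (L / m) z.1 * incSq (M / k) z.2 * hDensity H₁ H₂ c z.1 z.2 =
      ∫ z : ℝ × ℝ, incSq L z.1 * incSq M z.2 * hDensity H₁ H₂ c (m * z.1) (k * z.2) := by
  have hm' : (0 : ℝ) < m := by exact_mod_cast hm
  have hk' : (0 : ℝ) < k := by exact_mod_cast hk
  rw [integral_comp_div (inv_pos.2 hm') (inv_pos.2 hk'), smul_eq_mul, ← mul_assoc,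
    ← integral_const_mul]
  refine integral_congr_ae (Eventually.of_forall fun z => ?_)
  simp only
  have e : ∀ (a b t : ℝ), 0 < b → incSq (a / b) (t / b⁻¹) = (b⁻¹) ^ 2 * incSq a t := by
    intro a b t hb
    rw [div_eq_inv_mul a b, incSq_mul (inv_ne_zero hb.ne')]
    congr 2
    field_simp
  rw [e _ _ _ hm', e _ _ _ hk', div_inv_eq_mul, div_inv_eq_mul, mul_comm z.1, mul_comm z.2]
  field_simp

/-- Independence would bound the variance of a fixed rectangle by 9 times the total variance of the
cells of ever finer grids. That total tends to 0 by dominated convergence, whereas the variance is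
positive. -/
theorem IsSpectralField.not_independent (hc : 0 < c) (hH₁ : 0 < H₁) (hH₂ : 0 < H₂)
    (hV : IsSpectralField V P (fun z => hDensity H₁ H₂ c z.1 z.2)) {a b : ℝ}
    (hab : (a, b) ≠ (0, 0)) : ¬ IndependentIncrementsAlong V P a b := by
  intro h
  -- The normal of a separating line is orthogonal to (a,b) and determined up to sign; the sign is
  -- fixed so that α ≥ 0.
  obtain ⟨α, β, hα, hne, hnormal⟩ : ∃ α β : ℝ, 0 ≤ α ∧ (α, β) ≠ (0, 0) ∧ a * α + b * β = 0 := by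
    rcases le_total 0 b with hb | hb
    · exact ⟨b, -a, hb, fun e => hab (by simp_all), by ring⟩
    · exact ⟨-b, a, by linarith, fun e => hab (by simp_all), by ring⟩
  have hindep := fun c' => h α β c' hne hnormal
  obtain ⟨L, M, m, k, hL, hM, hm, hk, hlim, hgrid⟩ := exists_adapted_grids hα (abs_nonneg β)
    (fun e => hne (by rw [e.1, abs_eq_zero.1 e.2]))
  have hle : ∀ n, ∫ z : ℝ × ℝ, incSq L z.1 * incSq M z.2 * hDensity H₁ H₂ c z.1 z.2 ≤
      9 * ∫ z : ℝ × ℝ, incSq L z.1 * incSq M z.2 * hDensity H₁ H₂ c (m n * z.1) (k n * z.2) := by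
    intro n
    have hm' : (0 : ℝ) < m n := by exact_mod_cast hm n
    have hk' : (0 : ℝ) < k n := by exact_mod_cast hk n
    have h1 := hV.integral_incSq_le hα hindep (ℓ := L / m n) (m := M / k n) (by positivity)
      (by positivity) (hgrid n)
    rw [mul_div_cancel₀ _ hm'.ne', mul_div_cancel₀ _ hk'.ne', mul_assoc 9,
      integral_incSq_cell L M (hm n) (hk n)] at h1
    exact h1
  have hI := integrable_incSq_mul hV.1 L M
  have hto : Tendsto (fun n => ∫ z : ℝ × ℝ, incSq L z.1 * incSq M z.2 *
      hDensity H₁ H₂ c (m n * z.1) (k n * z.2)) atTop (𝓝 (∫ _ : ℝ × ℝ, (0 : ℝ))) := by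
    refine tendsto_integral_of_dominated_convergence
      (fun z : ℝ × ℝ => incSq L z.1 * incSq M z.2 * hDensity H₁ H₂ c z.1 z.2) (fun n => ?_) hI
      (fun n => ?_) ?_
    · refine Measurable.aestronglyMeasurable (Measurable.mul (Measurable.mul ?_ ?_) ?_)
      · exact (measurable_incSq L).comp measurable_fst
      · exact (measurable_incSq M).comp measurable_snd
      · exact measurable_hDensity.comp (g := fun p : ℝ × ℝ => hDensity H₁ H₂ c p.1 p.2)
          (f := fun z : ℝ × ℝ => ((m n : ℝ) * z.1, (k n : ℝ) * z.2)) (by fun_prop)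
    · filter_upwards [ae_fst_ne_zero] with z hz
      have h0 := mul_nonneg (incSq_nonneg L z.1) (incSq_nonneg M z.2)
      rw [Real.norm_of_nonneg (mul_nonneg h0 (hDensity_nonneg hc _ _))]
      exact mul_le_mul_of_nonneg_left (hDensity_mul_le hc hH₁ hH₂ (by exact_mod_cast hm n)
        (by exact_mod_cast hk n) hz _) h0
    · filter_upwards [ae_fst_ne_zero, ae_snd_ne_zero] with z hz1 hz2
      simpa using (tendsto_hDensity_zero hc hH₁ hH₂ hm hk hlim hz1 hz2).const_mul
        (incSq L z.1 * incSq M z.2)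
  have hle0 : ∫ z : ℝ × ℝ, incSq L z.1 * incSq M z.2 * hDensity H₁ H₂ c z.1 z.2 ≤ 0 := by
    have := hto.const_mul 9
    rw [integral_zero, mul_zero] at this
    exact ge_of_tendsto' this hle
  have hpos : 0 < ∫ z : ℝ × ℝ, incSq L z.1 * incSq M z.2 * hDensity H₁ H₂ c z.1 z.2 := by
    refine integral_pos_of_pos_on_square hI (fun z => mul_nonneg (mul_nonneg (incSq_nonneg _ _)
      (incSq_nonneg _ _)) (hDensity_nonneg hc _ _)) (δ := 1 / (L + M)) (by positivity)
      fun u v hu hv => ?_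
    have hs : ∀ t s : ℝ, 0 < t → t ≤ L + M → s ∈ Set.Ioo 0 (1 / (L + M)) → 0 < incSq t s := by
      intro t s ht htL hs
      refine incSq_pos hs.1 ht ?_
      have e1 := (lt_div_iff₀ (by positivity)).1 hs.2
      have e2 := mul_le_mul_of_nonneg_left htL hs.1.le
      linarith [Real.pi_gt_three]
    exact mul_pos (mul_pos (hs L u hL (by linarith) hu) (hs M v hM (by linarith) hv))
      (hDensity_pos hc hu.1.ne' v)
  exact hpos.not_ge hle0

end Balanced

/-! ### Assembling the regimes -/

section LimitTheorem

variable {Ω Ω' : Type*} [MeasurableSpace Ω] [MeasurableSpace Ω'] {P : Measure Ω}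
  [IsProbabilityMeasure P] {P' : Measure Ω'} [IsProbabilityMeasure P']
  {X : ℤ → ℤ → Ω → ℝ} {g : ℝ → ℝ → ℝ} {H₁ H₂ c γ : ℝ}
  {W : Set (ℝ × ℝ) → Ω' → ℂ} {W₁ : Set ℝ → Ω' → ℂ}

/-- Convergence of the normalized partial sums to the limit fields. -/
theorem fddTendsto_VLimit
    (hc : 0 < c) (hH₁ : 0 < H₁) (hH : H₁ ≤ H₂) (hH₁_ne : H₁ ≠ 1) (hH₂_ne : H₂ ≠ 1)
    (hHH : H₁ * H₂ < H₁ + H₂)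
    (hg_bdd : ∃ M : ℝ, ∀ x ∈ Set.Icc (-Real.pi) Real.pi, ∀ y ∈ Set.Icc (-Real.pi) Real.pi,
      |g x y| ≤ M)
    (hg_cont : ContinuousAt (fun p : ℝ × ℝ => g p.1 p.2) (0, 0)) (hg_zero : g 0 0 = 1)
    (hX_gauss : IsGaussianProcess (fun (p : ℤ × ℤ) ω => X p.1 p.2 ω) P)
    (hX_mean : ∀ t s : ℤ, ∫ ω, X t s ω ∂P = 0)
    (hX : HasSpectralDensity X P (fun x y => g x y * hDensity H₁ H₂ c x y))
    (hW : IsComplexGaussianNoise W P') (hW₁ : IsComplexGaussianNoise W₁ P') (hγ : 0 < γ) :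
    FddTendsto (fun n x y ω => (n : ℝ) ^ (-expLimit H₁ H₂ γ) * partialSum X γ n x y ω) P
      (VLimit W W₁ P' H₁ H₂ c γ) P' := by
  have hL : ∀ t s, MemLp (X t s) 2 P := fun t s => (hX_gauss.hasGaussianLaw_eval (t, s)).memLp_two
  have hH₂ : 0 < H₂ := hH₁.trans_le hH
  rcases lt_trichotomy (H₁ / H₂) γ with h | h | h
  · rw [VLimit, if_pos h, expLimit, if_pos h]
    rcases lt_or_gt_of_ne hH₁_ne with h1 | h1
    · rw [expPlus, if_pos h1]
      exact fddTendsto_of_covariance hX_gauss hX_mean (VPlus_field_of_lt hW hH₁ h1)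
        fun x y x' y' hx hy hx' hy' => tendsto_cov_plus_of_lt hc hH₁ hH hg_bdd hg_cont hg_zero hL hX
          hx hy hx' hy' h h1
    · rw [expPlus, if_neg h1.not_gt]
      exact fddTendsto_of_covariance hX_gauss hX_mean (VPlus_field_of_gt hW₁ hc h1 hH hHH)
        fun x y x' y' hx hy hx' hy' => tendsto_cov_plus_of_gt hc hH₁ hH hg_bdd hg_cont hg_zero hL hX
          hx hy hx' hy' h h1 hHH
  · subst h
    rw [VLimit, if_neg (lt_irrefl _), if_neg (lt_irrefl _), expLimit, if_neg (lt_irrefl _),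
      if_neg (lt_irrefl _)]
    exact fddTendsto_of_covariance hX_gauss hX_mean (VBalanced_field hW hc hH₁ hH hH₁_ne hHH)
      fun x y x' y' hx hy hx' hy' => tendsto_cov_balanced hc hH₁ hH hg_bdd hg_cont hg_zero hL hX
        hx hy hx' hy' hH₁_ne hHH
  · rw [VLimit, if_neg h.not_gt, if_pos h, expLimit, if_neg h.not_gt, if_pos h]
    rcases lt_or_gt_of_ne hH₂_ne with h1 | h1
    · rw [expMinus, if_pos h1]
      exact fddTendsto_of_covariance hX_gauss hX_mean (VMinus_field_of_lt hW hc hH₂ h1)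
        fun x y x' y' hx hy hx' hy' => tendsto_cov_minus_of_lt hc hH₁ hH hg_bdd hg_cont hg_zero hL
          hX hx hy hx' hy' hγ h h1
    · rw [expMinus, if_neg h1.not_gt]
      exact fddTendsto_of_covariance hX_gauss hX_mean (VMinus_field_of_gt hW₁ hc hH₁ h1 hHH)
        fun x y x' y' hx hy hx' hy' => tendsto_cov_minus_of_gt hc hH₁ hH hg_bdd hg_cont hg_zero hL
          hX hx hy hx' hy' hγ h h1 hHH

/-- The definition of a scaling limit asks the normalization n^H(γ) to diverge. -/
lemma expLimit_pos (hH₁ : 0 < H₁) (hH : H₁ ≤ H₂) (hH₁_ne : H₁ ≠ 1) (hH₂_ne : H₂ ≠ 1)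
    (hγ : 0 < γ) : 0 < expLimit H₁ H₂ γ := by
  have hH₂ : 0 < H₂ := hH₁.trans_le hH
  unfold expLimit
  split_ifs
  · unfold expPlus
    split_ifs with h
    · positivity
    · have h1 : 1 < H₁ := lt_of_le_of_ne (not_lt.1 h) hH₁_ne.symm
      refine div_pos ?_ (by positivity)
      nlinarith [mul_pos hγ hH₁, mul_pos (mul_pos hγ hH₂) (sub_pos.2 h1)]
  · unfold expMinus
    split_ifs with h
    · positivity
    · have h1 : 1 < H₂ := lt_of_le_of_ne (not_lt.1 h) hH₂_ne.symm
      refine div_pos ?_ (by positivity)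
      nlinarith [mul_pos hγ hH₂, mul_pos hH₁ (sub_pos.2 h1)]
  · positivity

variable (hc : 0 < c) (hH₁ : 0 < H₁) (hH : H₁ ≤ H₂) (hH₁_ne : H₁ ≠ 1) (hHH : H₁ * H₂ < H₁ + H₂)
  (hW : IsComplexGaussianNoise W P')

include hc hH₁ hH hH₁_ne hHH hW

lemma isSpectralField_VBalanced :
    IsSpectralField (VBalanced W P' H₁ H₂ c) P' (fun z => hDensity H₁ H₂ c z.1 z.2) :=
  ⟨isWeight_hDensity hc hH₁ hH hH₁_ne hHH, VBalanced_field hW hc hH₁ hH hH₁_ne hHH⟩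

lemma VBalanced_hasDependentIncrements : HasDependentIncrements (VBalanced W P' H₁ H₂ c) P' := by
  have hV := isSpectralField_VBalanced hc hH₁ hH hH₁_ne hHH hW
  exact fun a b hab => ⟨hV.not_independent hc hH₁ (hH₁.trans_le hH) hab,
    hV.not_invariant (fun u v hu _ => hDensity_pos hc hu.ne' v) hab⟩

lemma VBalanced_not_ae_eq_zero : ¬ VBalanced W P' H₁ H₂ c 1 1 =ᵐ[P'] 0 := by
  have hV := isSpectralField_VBalanced hc hH₁ hH hH₁_ne hHH hW
  refine hV.2.not_ae_eq_zero ?_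
  have e : ∫ z : ℝ × ℝ, incRe 1 1 z.1 * incRe 1 1 z.2 * hDensity H₁ H₂ c z.1 z.2 =
      ∫ z : ℝ × ℝ, incSq 1 z.1 * incSq 1 z.2 * hDensity H₁ H₂ c z.1 z.2 := by
    refine integral_congr_ae (Eventually.of_forall fun z => ?_)
    simp only [incRe, sub_self, incSq_zero]
    ring
  simp only
  rw [e]
  have hs : ∀ s ∈ Set.Ioo (0 : ℝ) 1, 0 < incSq 1 s := fun s hs =>
    incSq_pos hs.1 one_pos (by linarith [hs.2, Real.pi_gt_three])
  exact integral_pos_of_pos_on_square (integrable_incSq_mul hV.1 1 1)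
    (fun z => mul_nonneg (mul_nonneg (incSq_nonneg _ _) (incSq_nonneg _ _))
      (hDensity_nonneg hc _ _)) one_pos
    fun u v hu hv => mul_pos (mul_pos (hs u hu) (hs v hv)) (hDensity_pos hc hu.1.ne' v)

variable (hH₂_ne : H₂ ≠ 1) (hW₁ : IsComplexGaussianNoise W₁ P')

include hH₂_ne hW₁

/-- The limit fields are nontrivial, vanish on the axes, have stationary increments, and their
increments are dependent exactly at the critical exponent. -/
lemma VLimit_properties (γ : ℝ) :
    ¬ VLimit W W₁ P' H₁ H₂ c γ 1 1 =ᵐ[P'] 0 ∧ VanishesOnAxes (VLimit W W₁ P' H₁ H₂ c γ) P' ∧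
    HasStationaryIncrements (VLimit W W₁ P' H₁ H₂ c γ) P' ∧
    (HasDependentIncrements (VLimit W W₁ P' H₁ H₂ c γ) P' ↔ γ = H₁ / H₂) := by
  rcases lt_trichotomy (H₁ / H₂) γ with h | h | h
  · obtain ⟨C, p, q, hV, hpq⟩ := isSheet_VPlus hW hW₁ hc hH₁ hH hH₁_ne hHH
    rw [VLimit, if_pos h]
    refine ⟨hV.not_ae_eq_zero, hV.vanishesOnAxes, hV.hasStationaryIncrements,
      iff_of_false (hV.not_hasDependentIncrements ?_) h.ne'⟩
    rcases hpq with ⟨_, _, hq⟩ | ⟨_, hp, _⟩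
    · exact Or.inr (Or.inl hq)
    · exact Or.inr (Or.inr (Or.inl hp))
  · have hV := isSpectralField_VBalanced hc hH₁ hH hH₁_ne hHH hW
    rw [VLimit, if_neg h.not_lt, if_neg h.not_gt]
    exact ⟨VBalanced_not_ae_eq_zero hc hH₁ hH hH₁_ne hHH hW, hV.vanishesOnAxes,
      hV.hasStationaryIncrements,
      iff_of_true (VBalanced_hasDependentIncrements hc hH₁ hH hH₁_ne hHH hW) h.symm⟩
  · obtain ⟨C, p, q, hV, hpq⟩ := isSheet_VMinus (W := W) hW hW₁ hc hH₁ hH hH₂_ne hHH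
    rw [VLimit, if_neg h.not_gt, if_pos h]
    refine ⟨hV.not_ae_eq_zero, hV.vanishesOnAxes, hV.hasStationaryIncrements,
      iff_of_false (hV.not_hasDependentIncrements ?_) h.ne⟩
    rcases hpq with ⟨_, hp, _⟩ | ⟨_, _, hq⟩
    · exact Or.inl hp
    · exact Or.inr (Or.inr (Or.inr hq))

/-- The two unbalanced limits are not proportional in law. -/
lemma not_fddEq_VPlus_VMinus (a : ℝ) :
    ¬ FddEq (VPlus W W₁ P' H₁ H₂ c) (fun x y ω => a * VMinus W W₁ P' H₁ H₂ c x y ω) P' := by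
  intro h
  obtain ⟨C, p, q, hV, hpq⟩ := isSheet_VPlus hW hW₁ hc hH₁ hH hH₁_ne hHH
  obtain ⟨C', p', q', hV', hpq'⟩ := isSheet_VMinus (W := W) hW hW₁ hc hH₁ hH hH₂_ne hHH
  obtain ⟨rfl, rfl⟩ := hV.exponents_eq hV' h
  -- The four pairings are excluded in turn by 1 + H₁ ≠ 1, 1 ≠ 2, 2 ≠ 1 and p < 2.
  rcases hpq with ⟨_, h1, h2⟩ | ⟨_, h1, h2⟩ <;> rcases hpq' with ⟨_, h3, h4⟩ | ⟨_, h3, h4⟩ <;>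
    linarith

end LimitTheorem

/-! ### Scaling limits and the main theorem -/

section Conclusions

variable {Ω Ω' : Type*} [MeasurableSpace Ω] [MeasurableSpace Ω'] {P : Measure Ω}
  [IsProbabilityMeasure P] {P' : Measure Ω'} [IsProbabilityMeasure P'] {X : ℤ → ℤ → Ω → ℝ}

lemma isScalingLimit_of_fddTendsto {γ H : ℝ} (hH : 0 < H) {V : ℝ → ℝ → Ω' → ℝ}
    (h : FddTendsto (fun n x y ω => (n : ℝ) ^ (-H) * partialSum X γ n x y ω) P V P')
    (hV : ¬ V 1 1 =ᵐ[P'] 0) : IsScalingLimit X P γ V P' := by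
  refine ⟨⟨fun n => (n : ℝ) ^ H, tendsto_natCast_rpow hH, ?_⟩, 1, 1, one_pos, one_pos, hV⟩
  simpa only [Real.rpow_neg (Nat.cast_nonneg _)] using h

omit [IsProbabilityMeasure P'] in
lemma IsCenteredGaussianField.fddEq_refl {V : ℝ → ℝ → Ω' → ℝ} {K : ℝ × ℝ → ℝ × ℝ → ℝ}
    (hV : IsCenteredGaussianField V P' K) : FddEq V V P' := fun _ p _ =>
  IdentDistrib.refl (hasGaussianLaw_pi (hV.gaussian.comp_right p)).aemeasurable

end Conclusions

end RandomField

theorem theorem1 {Ω : Type*} [MeasurableSpace Ω] (P : Measure Ω) [IsProbabilityMeasure P]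
    (X : ℤ → ℤ → Ω → ℝ) (g : ℝ → ℝ → ℝ) (H₁ H₂ c : ℝ)
    (hc : 0 < c) (hH₁ : 0 < H₁) (hH : H₁ ≤ H₂) (hH₁_ne : H₁ ≠ 1) (hH₂_ne : H₂ ≠ 1)
    (hHH : H₁ * H₂ < H₁ + H₂)
    (hg_bdd : ∃ M : ℝ, ∀ x ∈ Set.Icc (-Real.pi) Real.pi, ∀ y ∈ Set.Icc (-Real.pi) Real.pi,
      |g x y| ≤ M)
    (hg_cont : ContinuousAt (fun p : ℝ × ℝ => g p.1 p.2) (0, 0)) (hg_zero : g 0 0 = 1)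
    (hX_gauss : IsGaussianProcess (fun (p : ℤ × ℤ) ω => X p.1 p.2 ω) P)
    (hX_stat : IsStationary X P)
    (hX_mean : ∀ t s : ℤ, ∫ ω, X t s ω ∂P = 0)
    (hX_spec : HasSpectralDensity X P
      (fun x y => g x y / (|x| ^ 2 + c * |y| ^ (2 * H₂ / H₁)) ^ (H₁ / 2))) :
    -- convergence to the limit fields built on any Gaussian noises, and existence of such noises
    ((∀ {Ω' : Type*} [MeasurableSpace Ω'] (P' : Measure Ω') [IsProbabilityMeasure P']
        (W : Set (ℝ × ℝ) → Ω' → ℂ) (W₁ : Set ℝ → Ω' → ℂ),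
        IsComplexGaussianNoise W P' → IsComplexGaussianNoise W₁ P' →
        ∀ γ : ℝ, 0 < γ →
          FddTendsto (fun n x y ω => (n : ℝ) ^ (-expLimit H₁ H₂ γ) * partialSum X γ n x y ω) P
            (VLimit W W₁ P' H₁ H₂ c γ) P') ∧
      ∃ (Ω' : Type) (_ : MeasurableSpace Ω') (P' : Measure Ω') (_ : IsProbabilityMeasure P')
        (W : Set (ℝ × ℝ) → Ω' → ℂ) (W₁ : Set ℝ → Ω' → ℂ),
        IsComplexGaussianNoise W P' ∧ IsComplexGaussianNoise W₁ P') ∧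
    ExhibitsScalingTransitionAt X P (H₁ / H₂) ∧
    HasTypeILRDAt X P (H₁ / H₂) ∧
    (H₁ = H₂ → HasTypeIIsotropicLRD X P) ∧
    (H₁ ≠ H₂ → HasTypeIAnisotropicLRD X P) := by
  have hspec : HasSpectralDensity X P (fun x y => g x y * hDensity H₁ H₂ c x y) := by
    simpa only [hDensity, mul_one_div] using hX_spec
  -- A single pair of noises carries the limit fields for all γ at once.
  obtain ⟨Ω', mΩ', P', hP', W, W₁, hW, hW₁⟩ := exists_noises
  have hγ₀ : 0 < H₁ / H₂ := div_pos hH₁ (hH₁.trans_le hH)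
  have hprop := VLimit_properties hc hH₁ hH hH₁_ne hHH hW hH₂_ne hW₁
  have hlimit : ∀ γ, 0 < γ → IsScalingLimit X P γ (VLimit W W₁ P' H₁ H₂ c γ) P' := fun γ hγ =>
    isScalingLimit_of_fddTendsto (expLimit_pos hH₁ hH hH₁_ne hH₂_ne hγ)
      (fddTendsto_VLimit hc hH₁ hH hH₁_ne hH₂_ne hHH hg_bdd hg_cont hg_zero hX_gauss hX_mean hspec
        hW hW₁ hγ) (hprop γ).1
  have hLRD : HasTypeILRDAt X P (H₁ / H₂) := by
    refine ⟨Ω', mΩ', P', hP', VLimit W W₁ P' H₁ H₂ c,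
      fun γ hγ => ⟨hlimit γ hγ, (hprop γ).2.1, (hprop γ).2.2.1⟩, ⟨hγ₀, (hprop _).2.2.2.2 rfl,
        fun γ _ hne hD => hne ((hprop γ).2.2.2.1 hD)⟩, fun γ hγ => (hprop γ).2.2.2.1 hγ.2.1⟩
  refine ⟨⟨?_, Ω', mΩ', P', hP', W, W₁, hW, hW₁⟩, ?_, hLRD, fun h => ?_, fun h => ?_⟩
  · intro Ω'' _ P'' _ W' W₁' hW' hW₁' γ hγ
    exact fddTendsto_VLimit hc hH₁ hH hH₁_ne hH₂_ne hHH hg_bdd hg_cont hg_zero hX_gauss hX_mean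
      hspec hW' hW₁' hγ
  -- On each side of γ₀ the limit is literally `VPlus` or `VMinus`; Gaussianity serves only to
  -- supply measurability for the reflexivity of equality in law.
  · obtain ⟨_, _, _, hVp, _⟩ := isSheet_VPlus hW hW₁ hc hH₁ hH hH₁_ne hHH
    obtain ⟨_, _, _, hVm, _⟩ := isSheet_VMinus hW hW₁ hc hH₁ hH hH₂_ne hHH
    refine ⟨hγ₀, Ω', mΩ', P', hP', VLimit W W₁ P' H₁ H₂ c, VPlus W W₁ P' H₁ H₂ c,
      VMinus W W₁ P' H₁ H₂ c, hlimit, fun γ hγ => ?_, fun γ _ hγ => ?_,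
      fun a _ => not_fddEq_VPlus_VMinus hc hH₁ hH hH₁_ne hHH hW hH₂_ne hW₁ a⟩
    · rw [VLimit, if_pos hγ]
      exact hVp.2.2.2.fddEq_refl
    · rw [VLimit, if_neg hγ.not_gt, if_pos hγ]
      exact hVm.2.2.2.fddEq_refl
  · have e : H₁ / H₂ = 1 := by rw [h, div_self (hH₁.trans_le hH).ne']
    rw [HasTypeIIsotropicLRD, ← e]
    exact hLRD
  · exact ⟨H₁ / H₂, fun e => h ((div_eq_one_iff_eq (hH₁.trans_le hH).ne').1 e), hLRD⟩
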